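/- **Setting.** Write $(t,x)\in\mathbb R^{1+3}$, $x^0=t$, $r=|x|$, $m=\mathrm{diag}(-1,1,1,1)$; Latin indices run over $1,2,3$, Greek ones over $0,\dots,3$, repeated indices are summed. Fix a smooth cut-off $\chi$ with $\chi(z)=1$ for $z\ge 3/4$ and $\chi(z)=0$ for $z\le 1/2$, and constants $0<\gamma<1/2$, $0<\mu<1/2$. Fix an electromagnetic Lagrangian $\mathscr L(s_1,s_2)$ on an open neighbourhood $\mathcal U$ of $(0,0)$ with $\mathscr L(0,0)=0$ and $D\mathscr L(0,0)=(-\tfrac12,0)$ (agreement with Maxwell's $-\frac12 s_1$ to first order). For a Lorentzian metric $g$ and a two-form $F$ let $F^{\#\mu\nu}=(g^{-1})^{\mu\kappa}(g^{-1})^{\nu\lambda}F_{\kappa\lambda}$, ${}^\star F^{\#\mu\nu}=-\frac12|\det g|^{-1/2}[\mu\nu\kappa\lambda]F_{\kappa\lambda}$ (with $[0123]=1$, and ${}^\star F_{\mu\nu}$ lowered with $g$), $s_1=\frac12F_{\kappa\lambda}F^{\#\kappa\lambda}$, $s_2=\frac14F_{\kappa\lambda}{}^\star F^{\#\kappa\lambda}$,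 ${}^\star\mathcal M_{\mu\nu}=2\,\partial_{s_1}\mathscr L\,F_{\mu\nu}+\partial_{s_2}\mathscr L\,{}^\star F_{\mu\nu}$, $T_{\mu\nu}=-2\,\partial_{s_1}\mathscr L\,(g^{-1})^{\kappa\lambda}F_{\mu\kappa}F_{\nu\lambda}-s_2\,\partial_{s_2}\mathscr L\,g_{\mu\nu}+\mathscr L g_{\mu\nu}$, and $$N^{\#\mu\nu\kappa\lambda}=-\partial_{s_1}\mathscr L\{(g^{-1})^{\mu\kappa}(g^{-1})^{\nu\lambda}-(g^{-1})^{\mu\lambda}(g^{-1})^{\nu\kappa}\}-2\,\partial_{s_1}^2\mathscr L\,F^{\#\mu\nu}F^{\#\kappa\lambda}-\partial_{s_1}\partial_{s_2}\mathscr L\,\{F^{\#\mu\nu}\,{}^\star F^{\#\kappa\lambda}+{}^\star F^{\#\mu\nu}F^{\#\kappa\lambda}\}-\tfrac12\,\partial_{s_2}^2\mathscr L\;{}^\star F^{\#\mu\nu}\,{}^\star F^{\#\kappa\lambda}.$$ **Abstract data.** Abstract data of order $N$ consist of a number $M\ge0$ and fields $\underline h^{(1)}_{jk},K_{jk}=K_{kj},\mathfrak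 D_j,\mathfrak B_j$ on $\mathbb R^3$ such that $\underline g_{jk}=\delta_{jk}+\chi(r)\frac{2M}{r}\delta_{jk}+\underline h^{(1)}_{jk}$ is a Riemannian metric and the Gauss and Codazzi equations $\underline R-K_{ab}K^{ab}+(\mathrm{tr}K)^2=2T(\hat N,\hat N)$, $\underline{\mathscr D}^aK_{aj}-\underline{\mathscr D}_j\mathrm{tr}K=T(\hat N,\partial_j)$ and $\underline{\mathscr D}^a\mathfrak D_a=\underline{\mathscr D}^a\mathfrak B_a=0$ hold (operations with respect to $\underline g$; $T$ is computed from $F|_{t=0}$ and $g|_{t=0}$ below). They are asymptotically flat if, for some $\kappa>0$, $\underline h^{(1)}=o^{N+1}(r^{-1-\kappa})$ and $K,\mathfrak D,\mathfrak B=o^N(r^{-2-\kappa})$, where $f=o^n(r^{-a})$ means $f\in C^n$ and $r^{a+|I|}|\partial^If|\to0$ as $r\to\infty$ for $|I|\le n$. With $\|U\|^2_{H^N_\eta}=\sum_{|I|\le N}\int_{\mathbb R^3}(1+|x|^2)^{\eta+|I|}|\partial^IU|^2dx$ set $$E_{N;\gamma}(0)^2=\|\partial\underline h^{(1)}\|^2_{H^N_{1/2+\gamma}}+\|K\|^2_{H^N_{1/2+\gamma}}+\|\mathfrak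 D\|^2_{H^N_{1/2+\gamma}}+\|\mathfrak B\|^2_{H^N_{1/2+\gamma}}\in[0,\infty].$$ **Reduced data.** With $A=(1-\frac{2M}{r}\chi(r))^{1/2}$ and $\hat N=A^{-1}\partial_t$, the reduced data are $g_{00}=-A^2$, $g_{0j}=0$, $g_{jk}=\underline g_{jk}$, $\partial_tg_{00}=-2A^3\underline g^{ab}K_{ab}$, $\partial_tg_{0j}=A^2\underline g^{ab}\partial_a\underline g_{bj}-\frac12A^2\underline g^{ab}\partial_j\underline g_{ab}-A\partial_jA$, $\partial_tg_{jk}=2AK_{jk}$ at $t=0$, and a two-form $F|_{t=0}$ that tends to $0$ as $r\to\infty$ and satisfies $\mathfrak D_j=-{}^\star\mathcal M_{j\kappa}\hat N^\kappa$, $\mathfrak B_j=-{}^\star F_{j\kappa}\hat N^\kappa$. **Reduced system.** Let $g=m+h^{(0)}+h^{(1)}$, $h^{(0)}_{\mu\nu}=\chi(\frac rt)\chi(r)\frac{2M}{r}\delta_{\mu\nu}$ (with $\chi(r/t)=1$ at $t=0$), $\widetilde\square_g=(g^{-1})^{\kappa\lambda}\partial_\kappa\partial_\lambda$. The unknowns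 are $h^{(1)}$ (symmetric) and $F$ (a two-form), and the system is $$\widetilde\square_gh^{(1)}_{\mu\nu}=\mathfrak H_{\mu\nu}-\widetilde\square_gh^{(0)}_{\mu\nu},\qquad \partial_\lambda F_{\mu\nu}+\partial_\mu F_{\nu\lambda}+\partial_\nu F_{\lambda\mu}=0,\qquad N^{\#\mu\nu\kappa\lambda}\mathscr D_\mu F_{\kappa\lambda}=-\Gamma^\kappa(g^{-1})^{\nu\lambda}F_{\kappa\lambda}.$$ Here $\mathscr D$ is the Levi-Civita connection of $g$, with Christoffel symbols $\Gamma_{\mu}{}^{\kappa}{}_{\nu}$, $\Gamma^\kappa=(g^{-1})^{\mu\nu}\Gamma_{\mu}{}^{\kappa}{}_{\nu}$, and $\mathfrak H_{\mu\nu}$ is the expression, in $g,\partial g,F$ only, for which the first equation is $\widetilde R_{\mu\nu}=T_{\mu\nu}-\frac12g_{\mu\nu}(g^{-1})^{\kappa\lambda}T_{\kappa\lambda}$ with the modified Ricci tensor $\widetilde R_{\mu\nu}=R_{\mu\nu}-\frac12(g_{\kappa\nu}\mathscr D_\mu\Gamma^\kappa+g_{\kappa\mu}\mathscr D_\nu\Gamma^\kappa)+\frac12\Gamma_\mu\Gamma_\nu-\frac12\Gamma^\kappa(\partial_\mu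 g_{\kappa\nu}+\partial_\nu g_{\kappa\mu})$, $\Gamma_\mu=g_{\mu\kappa}\Gamma^\kappa$; explicitly $\mathfrak H_{\mu\nu}=\mathscr P(\nabla_\mu h,\nabla_\nu h)+\mathscr Q^{(1;h)}_{\mu\nu}(\nabla h,\nabla h)-2(T_{\mu\nu}-\frac12g_{\mu\nu}(g^{-1})^{\kappa\lambda}T_{\kappa\lambda})$ with the quadratic form $\mathscr P=\frac14(\partial_\mu\,\mathrm{tr}\,h)(\partial_\nu\,\mathrm{tr}\,h)-\frac12\langle\partial_\mu h,\partial_\nu h\rangle$ (undifferentiated $g^{-1}$ in the traces and contractions) and a sum $\mathscr Q^{(1;h)}$ of null forms in $\partial h=\partial g$. **Energy.** Let $\mathcal Z=\{\partial_\mu,\ x_\mu\partial_\nu-x_\nu\partial_\mu\ (\mu<\nu),\ x^\kappa\partial_\kappa\}$, with $x_\mu=m_{\mu\nu}x^\nu$, let $\nabla=\partial$ be the Minkowski connection, let $w(q)=1+(1+|q|)^{1+2\gamma}$ for $q\ge0$, $w(q)=1+(1+|q|)^{-2\mu}$ for $q<0$, $q=r-t$, and let $$\mathcal E_{N;\gamma;\mu}(t)^2=\sup_{0\le\tau\le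 t}\sum_{|I|\le N}\int_{\{\tau\}\times\mathbb R^3}\big\{|\nabla\nabla^I_{\mathcal Z}h^{(1)}|^2+|\mathcal L^I_{\mathcal Z}F|^2\big\}\,w(q)\,dx .$$ **Proposition (smallness of the initial energy).** There is $\varepsilon_0>0$, independent of $N$, such that for every integer $N\ge8$ for which $\mathscr L\in C^{N+2}(\mathcal U)$ there are constants $C_N,\widetilde C_N>0$ with the following property. Let asymptotically flat abstract data of order $N$ be given, and let $(h^{(1)},F)$ be a classical solution of the reduced system on some slab $[0,T)\times\mathbb R^3$, $T>0$, with $h^{(1)}\in C^{N+1}$, $F\in C^N$, $g$ Lorentzian and $(s_1,s_2)\in\mathcal U$, launched by the reduced data built from these abstract data. If $E_{N;\gamma}(0)+M\le\varepsilon\le\varepsilon_0$, then $$\mathcal E_{N;\gamma;\mu}(0)\le C_N\{E_{N;\gamma}(0)+M\}\le\widetilde C_N\,\varepsilon .$$ -/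

import Mathlib

open MeasureTheory Filter Topology
open scoped ENNReal

namespace EinsteinNLEM

noncomputable section

/- ### Points, coordinates, coordinate derivatives -/

/-- The Euclidean space `ℝ³`. -/
abbrev Space := EuclideanSpace ℝ (Fin 3)

/-- The spacetime `ℝ^{1+3}`; a point is `(t, x)`. -/
abbrev Spacetime := ℝ × Space

/-- The slab `[0, T) × ℝ³`. -/
def slab (T : ℝ) : Set Spacetime := Set.Ico 0 T ×ˢ Set.univ

/-- The coordinate `x^μ` of a spacetime point; `x^0 = t`. -/
def coord (μ : Fin 4) (p : Spacetime) : ℝ := Fin.cases p.1 (fun j => p.2 j) μ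

/-- The coordinate vector `∂/∂x^μ`. -/
def coordVec (μ : Fin 4) : Spacetime :=
  Fin.cases ((1 : ℝ), (0 : Space)) (fun j => ((0 : ℝ), EuclideanSpace.single j (1 : ℝ))) μ

/-- The spacetime coordinate derivative `∂_μ u` of a function on the set `S` (one-sided at the
boundary of `S`). In these coordinates it is also the Minkowskian covariant derivative `∇_μ`
of the components of a tensorfield. -/
def pd (S : Set Spacetime) (μ : Fin 4) (u : Spacetime → ℝ) (p : Spacetime) : ℝ :=
  fderivWithin ℝ u S p (coordVec μ)

/-- The spatial coordinate derivative `∂_j u` of a function on `ℝ³`. -/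
def sd (j : Fin 3) (u : Space → ℝ) (x : Space) : ℝ :=
  fderiv ℝ u x (EuclideanSpace.single j (1 : ℝ))

/-- The iterated spatial derivative along a list of coordinate directions. -/
def sdList : List (Fin 3) → (Space → ℝ) → Space → ℝ
  | [], u => u
  | j :: I, u => sd j (sdList I u)

/-- The iterated spatial derivative `∂^I u` for a coordinate multi-index `I` of length `k`. -/
def sdIter {k : ℕ} (I : Fin k → Fin 3) (u : Space → ℝ) : Space → ℝ := sdList (List.ofFn I) u

/- ### Weighted Sobolev norms and decay at spatial infinity -/

/-- The square of the weighted Sobolev norm `H^N_η` of a tensorfield on `ℝ³`, given by the finite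
family `U` of its components:
`∑_{|I| ≤ N} ∫ (1 + |x|²)^(η + |I|) |∇^I U|² dx`. -/
def sobolevSq {ι : Type*} [Fintype ι] (N : ℕ) (η : ℝ) (U : ι → Space → ℝ) : ℝ≥0∞ :=
  ∑ k ∈ Finset.range (N + 1), ∑ I : Fin k → Fin 3,
    ∫⁻ x : Space, ENNReal.ofReal
      ((1 + ‖x‖ ^ 2) ^ (η + (k : ℝ)) * ∑ i, (sdIter I (U i) x) ^ 2)

/-- `f = o^n(r^{-a})` as `r → ∞`: `f` is `n` times continuously differentiable and
`r^{a + |I|} |∂^I f| → 0` at spatial infinity for `|I| ≤ n`. -/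
def IsLittleOInfty (n : ℕ) (a : ℝ) (f : Space → ℝ) : Prop :=
  ContDiff ℝ (n : WithTop ℕ∞) f ∧
    ∀ k ≤ n, ∀ I : Fin k → Fin 3,
      Tendsto (fun x : Space => ‖x‖ ^ (a + (k : ℝ)) * |sdIter I f x|) (cocompact Space) (𝓝 0)

/-- A smooth cut-off with `χ(z) = 1` for `z ≥ 3/4` and `χ(z) = 0` for `z ≤ 1/2`. -/
structure IsCutoff (χ : ℝ → ℝ) : Prop where
  smooth : ∀ n : ℕ, ContDiff ℝ (n : WithTop ℕ∞) χ
  eq_one : ∀ z, 3 / 4 ≤ z → χ z = 1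
  eq_zero : ∀ z, z ≤ 1 / 2 → χ z = 0

/- ### Pointwise algebra and differential geometry in components -/

/-- The Minkowski metric `m = diag(-1, 1, 1, 1)`. -/
def mink : Matrix (Fin 4) (Fin 4) ℝ :=
  Matrix.diagonal (fun μ => if μ = 0 then -1 else 1)

/-- The Christoffel symbol `Γ_μ^κ_ν` of a metric with components `g` and first derivatives
`dg λ μ ν = ∂_λ g_{μν}`. -/
def christoffel {n : ℕ} (g : Matrix (Fin n) (Fin n) ℝ) (dg : Fin n → Fin n → Fin n → ℝ)
    (κ μ ν : Fin n) : ℝ :=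
  (1 / 2) * ∑ l, g⁻¹ κ l * (dg μ l ν + dg ν μ l - dg l μ ν)

/-- The contracted Christoffel symbol `Γ^κ = (g⁻¹)^{μν} Γ_μ^κ_ν`. -/
def contractedChristoffel {n : ℕ} (g : Matrix (Fin n) (Fin n) ℝ)
    (dg : Fin n → Fin n → Fin n → ℝ) (κ : Fin n) : ℝ :=
  ∑ μ, ∑ ν, g⁻¹ μ ν * christoffel g dg κ μ ν

/-- The totally antisymmetric symbol `[μνκλ]` with `[0123] = 1`: the determinant of the matrix
whose rows are the indicated unit vectors. -/
def antisym (μ ν κ l : Fin 4) : ℝ :=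
  Matrix.det (Matrix.of fun i j : Fin 4 => if ![μ, ν, κ, l] i = j then (1 : ℝ) else 0)

/-- `F^{#μν} = (g⁻¹)^{μκ} (g⁻¹)^{νλ} F_{κλ}`. -/
def raise (g : Matrix (Fin 4) (Fin 4) ℝ) (F : Fin 4 → Fin 4 → ℝ) (μ ν : Fin 4) : ℝ :=
  ∑ κ, ∑ l, g⁻¹ μ κ * g⁻¹ ν l * F κ l

/-- The raised Hodge dual `⋆F^{#μν} = ½ ε^{#μνκλ} F_{κλ}`, where
`ε^{#μνκλ} = -|det g|^{-1/2} [μνκλ]`. -/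
def hodgeUp (g : Matrix (Fin 4) (Fin 4) ℝ) (F : Fin 4 → Fin 4 → ℝ) (μ ν : Fin 4) : ℝ :=
  (1 / 2) * ∑ κ, ∑ l, (-(Real.sqrt |g.det|)⁻¹ * antisym μ ν κ l) * F κ l

/-- The Hodge dual `⋆F_{μν}` with respect to `g`. -/
def hodge (g : Matrix (Fin 4) (Fin 4) ℝ) (F : Fin 4 → Fin 4 → ℝ) (μ ν : Fin 4) : ℝ :=
  ∑ κ, ∑ l, g μ κ * g ν l * hodgeUp g F κ l

/-- The pair of electromagnetic invariants
`(½ (g⁻¹)^{κμ} (g⁻¹)^{λν} F_{κλ} F_{μν}, ¼ (g⁻¹)^{κμ} (g⁻¹)^{λν} F_{κλ} ⋆F_{μν})`. -/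
def invariants (g : Matrix (Fin 4) (Fin 4) ℝ) (F : Fin 4 → Fin 4 → ℝ) : ℝ × ℝ :=
  ((1 / 2) * ∑ κ, ∑ l, F κ l * raise g F κ l, (1 / 4) * ∑ κ, ∑ l, F κ l * hodgeUp g F κ l)

/- ### Nonlinear electromagnetism derived from a Lagrangian `L(s₁, s₂)` of the two invariants -/

/-- `∂L/∂s₁`. -/
def lagD1 (L : ℝ × ℝ → ℝ) (s : ℝ × ℝ) : ℝ := fderiv ℝ L s (1, 0)

/-- `∂L/∂s₂`. -/
def lagD2 (L : ℝ × ℝ → ℝ) (s : ℝ × ℝ) : ℝ := fderiv ℝ L s (0, 1)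

/-- The dual Maxwell tensor `⋆𝓜_{μν} = 2 (∂L/∂s₁) F_{μν} + (∂L/∂s₂) ⋆F_{μν}`, which is
`∂L/∂F_{μν}` with its indices lowered. -/
def maxwellDual (L : ℝ × ℝ → ℝ) (g : Matrix (Fin 4) (Fin 4) ℝ) (F : Fin 4 → Fin 4 → ℝ)
    (μ ν : Fin 4) : ℝ :=
  2 * lagD1 L (invariants g F) * F μ ν + lagD2 L (invariants g F) * hodge g F μ ν

/-- The tensor `N^{#μνκλ}` of the electromagnetic equations, i.e. `-½ ∂²L/∂F_{μν}∂F_{κλ}` with the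
term proportional to `ε^{#μνκλ}` removed. -/
def tensorN (L : ℝ × ℝ → ℝ) (g : Matrix (Fin 4) (Fin 4) ℝ) (F : Fin 4 → Fin 4 → ℝ)
    (μ ν κ l : Fin 4) : ℝ :=
  - lagD1 L (invariants g F) * (g⁻¹ μ κ * g⁻¹ ν l - g⁻¹ μ l * g⁻¹ ν κ)
  - 2 * lagD1 (lagD1 L) (invariants g F) * raise g F μ ν * raise g F κ l
  - lagD2 (lagD1 L) (invariants g F) *
      (raise g F μ ν * hodgeUp g F κ l + hodgeUp g F μ ν * raise g F κ l)
  - (1 / 2) * lagD2 (lagD2 L) (invariants g F) * hodgeUp g F μ ν * hodgeUp g F κ l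

/-- The energy-momentum tensor
`T_{μν} = -2 (∂L/∂s₁) (g⁻¹)^{κλ} F_{μκ} F_{νλ} - s₂ (∂L/∂s₂) g_{μν} + g_{μν} L`. -/
def energyMomentum (L : ℝ × ℝ → ℝ) (g : Matrix (Fin 4) (Fin 4) ℝ) (F : Fin 4 → Fin 4 → ℝ)
    (μ ν : Fin 4) : ℝ :=
  -2 * lagD1 L (invariants g F) * (∑ κ, ∑ l, g⁻¹ κ l * F μ κ * F ν l)
  - (invariants g F).2 * lagD2 L (invariants g F) * g μ ν
  + g μ ν * L (invariants g F)

/-- `L` is a Lagrangian for nonlinear electromagnetism, defined on the neighbourhood `U` of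
`(0, 0)`, that agrees with the linear Maxwell Lagrangian `-½ s₁` to first order at `(0, 0)`. -/
structure IsMaxwellLike (U : Set (ℝ × ℝ)) (L : ℝ × ℝ → ℝ) : Prop where
  isOpen : IsOpen U
  zero_mem : (0, 0) ∈ U
  value : L (0, 0) = 0
  deriv : HasFDerivAt L ((-(1 / 2) : ℝ) • ContinuousLinearMap.fst ℝ ℝ ℝ) (0, 0)

/- ### The quadratic terms of the wave equations

Below, `b` is the inverse metric used for the contractions and `dh λ μ ν = ∂_λ h_{μν}`. -/

/-- The null form `𝒬₀(∇ψ, ∇φ) = b^{κλ} ∂_κψ ∂_λφ`. -/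
def nullForm0 (b : Matrix (Fin 4) (Fin 4) ℝ) (u v : Fin 4 → ℝ) : ℝ :=
  ∑ κ, ∑ l, b κ l * u κ * v l

/-- The null form `𝒬_{μν}(∇ψ, ∇φ) = ∂_μψ ∂_νφ - ∂_νψ ∂_μφ`. -/
def nullForm (μ ν : Fin 4) (u v : Fin 4 → ℝ) : ℝ := u μ * v ν - u ν * v μ

/-- `𝒫(∇_μ h, ∇_ν h) = ¼ ∂_μ h_κ^κ ∂_ν h_λ^λ - ½ ∂_μ h^{κλ} ∂_ν h_{κλ}`. -/
def quadP (b : Matrix (Fin 4) (Fin 4) ℝ) (dh : Fin 4 → Fin 4 → Fin 4 → ℝ) (μ ν : Fin 4) : ℝ :=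
  (1 / 4) * (∑ κ, ∑ l, b κ l * dh μ κ l) * (∑ κ, ∑ l, b κ l * dh ν κ l)
  - (1 / 2) * ∑ κ, ∑ κ', ∑ l, ∑ l', b κ κ' * b l l' * dh μ κ l * dh ν κ' l'

/-- The combination of null forms `𝒬^{(1;h)}_{μν}(∇h, ∇h)`. -/
def quadQ (b : Matrix (Fin 4) (Fin 4) ℝ) (dh : Fin 4 → Fin 4 → Fin 4 → ℝ) (μ ν : Fin 4) : ℝ :=
  (∑ l, ∑ l', b l l' * nullForm0 b (fun κ => dh κ l μ) (fun κ => dh κ l' ν))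
  + ∑ κ, ∑ κ', ∑ l, ∑ l', b κ κ' * b l l' *
    ( - nullForm κ l' (fun a => dh a l μ) (fun a => dh a κ' ν)
      + nullForm μ κ (fun a => dh a κ' l') (fun a => dh a l ν)
      + nullForm ν κ (fun a => dh a κ' l') (fun a => dh a l μ)
      + (1 / 2) * nullForm l' μ (fun a => dh a κ κ') (fun a => dh a l ν)
      + (1 / 2) * nullForm l' ν (fun a => dh a κ κ') (fun a => dh a l μ))

/-- The inhomogeneous term `𝔥_{μν}` of the reduced wave equations,
`𝒫 + 𝒬^{(1;h)} - 2 (T_{μν} - ½ g_{μν} (g⁻¹)^{κλ} T_{κλ})`, with `dg = ∂g = ∇h`.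
For every metric `g` the tensor `-½ (g⁻¹ ∂∂ g_{μν} - 𝒫 - 𝒬^{(1;h)})`, with `𝒫`, `𝒬^{(1;h)}`
contracted with `g⁻¹`, equals the modified Ricci tensor
`R_{μν} - ½ (g_{κν} 𝒟_μ Γ^κ + g_{κμ} 𝒟_ν Γ^κ) + ½ Γ_μ Γ_ν
  - ½ Γ^κ (∂_μ g_{κν} + ∂_ν g_{κμ})`, where `Γ_μ = g_{μκ} Γ^κ`. Contracting with `m⁻¹` instead
only moves terms that are cubic, of the form `O(|h| |∇h|²)`, into the error terms. -/
def waveSource (L : ℝ × ℝ → ℝ) (g : Matrix (Fin 4) (Fin 4) ℝ)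
    (dg : Fin 4 → Fin 4 → Fin 4 → ℝ) (F : Fin 4 → Fin 4 → ℝ) (μ ν : Fin 4) : ℝ :=
  quadP g⁻¹ dg μ ν + quadQ g⁻¹ dg μ ν
  - 2 * (energyMomentum L g F μ ν
      - (1 / 2) * g μ ν * ∑ κ, ∑ l, g⁻¹ κ l * energyMomentum L g F κ l)

/-- The inhomogeneous term `𝔉^ν` of the reduced electromagnetic equations: the equation
`N^{#μνκλ} ∇_μ F_{κλ} = 𝔉^ν` is
`N^{#μνκλ} 𝒟_μ F_{κλ} = -Γ^κ (g⁻¹)^{νλ} F_{κλ}`, with `𝒟` the Levi-Civita connection of `g`. -/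
def maxwellSource (L : ℝ × ℝ → ℝ) (g : Matrix (Fin 4) (Fin 4) ℝ)
    (dg : Fin 4 → Fin 4 → Fin 4 → ℝ) (F : Fin 4 → Fin 4 → ℝ) (ν : Fin 4) : ℝ :=
  (∑ μ, ∑ κ, ∑ l, tensorN L g F μ ν κ l *
      ∑ a, (christoffel g dg a μ κ * F a l + christoffel g dg a μ l * F κ a))
  - ∑ κ, ∑ l, contractedChristoffel g dg κ * g⁻¹ ν l * F κ l

/- ### Abstract initial data -/

/-- The fields of abstract initial data on `ℝ³`: the ADM mass `M`, the remainder `h̲^{(1)}` of the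
metric, the second fundamental form `K`, and the one-forms `𝔇`, `𝔅`. -/
structure AbstractData where
  M : ℝ
  h1 : Fin 3 → Fin 3 → Space → ℝ
  K : Fin 3 → Fin 3 → Space → ℝ
  D : Fin 3 → Space → ℝ
  B : Fin 3 → Space → ℝ

/-- The Riemannian metric `g̲_{jk} = δ_{jk} + χ(r) (2M/r) δ_{jk} + h̲^{(1)}_{jk}`. -/
def AbstractData.metric (χ : ℝ → ℝ) (d : AbstractData) (x : Space) : Matrix (Fin 3) (Fin 3) ℝ :=
  Matrix.of fun j k =>
    (if j = k then 1 + χ ‖x‖ * (2 * d.M / ‖x‖) else 0) + d.h1 j k x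

/-- `∂_a g̲_{jk}`. -/
def AbstractData.dmetric (χ : ℝ → ℝ) (d : AbstractData) (x : Space) (a j k : Fin 3) : ℝ :=
  sd a (fun y => d.metric χ y j k) x

/-- The Christoffel symbol `Γ_a^c_b` of `g̲`. -/
def AbstractData.chris (χ : ℝ → ℝ) (d : AbstractData) (c a b : Fin 3) (x : Space) : ℝ :=
  christoffel (d.metric χ x) (d.dmetric χ x) c a b

/-- The Ricci tensor of `g̲`. -/
def AbstractData.ricci (χ : ℝ → ℝ) (d : AbstractData) (j k : Fin 3) (x : Space) : ℝ :=
  (∑ c, (sd c (d.chris χ c j k) x - sd j (d.chris χ c c k) x))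
  + ∑ c, ∑ l, (d.chris χ c c l x * d.chris χ l j k x - d.chris χ l j c x * d.chris χ c l k x)

/-- The scalar curvature of `g̲`. -/
def AbstractData.scalarCurv (χ : ℝ → ℝ) (d : AbstractData) (x : Space) : ℝ :=
  ∑ j, ∑ k, (d.metric χ x)⁻¹ j k * d.ricci χ j k x

/-- The trace `(g̲⁻¹)^{ab} K_{ab}`. -/
def AbstractData.trK (χ : ℝ → ℝ) (d : AbstractData) (x : Space) : ℝ :=
  ∑ a, ∑ b, (d.metric χ x)⁻¹ a b * d.K a b x

/-- The covariant derivative `𝒟̲_a K_{bj}`. -/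
def AbstractData.covK (χ : ℝ → ℝ) (d : AbstractData) (x : Space) (a b j : Fin 3) : ℝ :=
  sd a (d.K b j) x - ∑ c, (d.chris χ c a b x * d.K c j x + d.chris χ c a j x * d.K b c x)

/-- The divergence `(g̲⁻¹)^{ab} 𝒟̲_a X_b` of a one-form. -/
def AbstractData.divergence (χ : ℝ → ℝ) (d : AbstractData) (X : Fin 3 → Space → ℝ)
    (x : Space) : ℝ :=
  ∑ a, ∑ b, (d.metric χ x)⁻¹ a b * (sd a (X b) x - ∑ c, d.chris χ c a b x * X c x)

/-- The lapse `A = (1 - (2M/r) χ(r))^{1/2}`. -/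
def AbstractData.lapse (χ : ℝ → ℝ) (d : AbstractData) (x : Space) : ℝ :=
  Real.sqrt (1 - 2 * d.M / ‖x‖ * χ ‖x‖)

/-- The data `g_{00} = -A²`, `g_{0j} = 0`, `g_{jk} = g̲_{jk}` for the spacetime metric. -/
def AbstractData.metric4 (χ : ℝ → ℝ) (d : AbstractData) (x : Space) :
    Matrix (Fin 4) (Fin 4) ℝ :=
  Matrix.of fun μ ν =>
    Fin.cases
      (Fin.cases (-(d.lapse χ x) ^ 2) (fun _ => 0) ν)
      (fun j => Fin.cases 0 (fun k => d.metric χ x j k) ν) μ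

/-- The data for `∂_t g_{μν}`:
`∂_t g_{00} = -2A³ (g̲⁻¹)^{ab} K_{ab}`,
`∂_t g_{0j} = A² (g̲⁻¹)^{ab} ∂_a g̲_{bj} - ½ A² (g̲⁻¹)^{ab} ∂_j g̲_{ab} - A ∂_j A`,
`∂_t g_{jk} = 2A K_{jk}`.
The sign of `∂_t g_{00}` is the one for which the wave coordinate condition `Γ^0 = 0` holds
at `t = 0`, given `∂_t g_{jk} = 2A K_{jk}`. -/
def AbstractData.dtmetric4 (χ : ℝ → ℝ) (d : AbstractData) (x : Space) (μ ν : Fin 4) : ℝ :=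
  let shift : Fin 3 → ℝ := fun j =>
    d.lapse χ x ^ 2 * (∑ a, ∑ b, (d.metric χ x)⁻¹ a b * d.dmetric χ x a b j)
    - (1 / 2) * d.lapse χ x ^ 2 * (∑ a, ∑ b, (d.metric χ x)⁻¹ a b * d.dmetric χ x j a b)
    - d.lapse χ x * sd j (d.lapse χ) x
  Fin.cases
    (Fin.cases (-2 * d.lapse χ x ^ 3 * d.trK χ x) (fun k => shift k) ν)
    (fun j => Fin.cases (shift j) (fun k => 2 * d.lapse χ x * d.K j k x) ν) μ

/-- The data norm `E_{N;γ}(0)`. -/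
def AbstractData.norm (N : ℕ) (γ : ℝ) (d : AbstractData) : ℝ≥0∞ :=
  ( sobolevSq N (1 / 2 + γ)
      (fun i : Fin 3 × Fin 3 × Fin 3 => sd i.1 (d.h1 i.2.1 i.2.2))
    + sobolevSq N (1 / 2 + γ) (fun i : Fin 3 × Fin 3 => d.K i.1 i.2)
    + sobolevSq N (1 / 2 + γ) d.D
    + sobolevSq N (1 / 2 + γ) d.B ) ^ (1 / 2 : ℝ)

/-- The abstract data are asymptotically flat, with differentiability `N` and decay rate `κ`. -/
structure AbstractData.AsymptoticallyFlat (N : ℕ) (κ : ℝ) (d : AbstractData) : Prop where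
  h1 : ∀ j k, IsLittleOInfty (N + 1) (1 + κ) (d.h1 j k)
  K : ∀ j k, IsLittleOInfty N (2 + κ) (d.K j k)
  D : ∀ j, IsLittleOInfty N (2 + κ) (d.D j)
  B : ∀ j, IsLittleOInfty N (2 + κ) (d.B j)

/-- The one-forms `𝔇_j = -⋆𝓜_{jκ} N̂^κ` and `𝔅_j = -⋆F_{jκ} N̂^κ`, with `N̂ = A⁻¹ ∂_t` the unit
normal of `{t = 0}`, are those of the Faraday tensor `F₀` along `{t = 0}`. For weak fields this
determines `F₀` in terms of the abstract data among the weak fields; the condition at infinity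
selects this solution. -/
structure AbstractData.IsInitialFaraday (χ : ℝ → ℝ) (L : ℝ × ℝ → ℝ) (d : AbstractData)
    (F₀ : Space → Fin 4 → Fin 4 → ℝ) : Prop where
  displacement : ∀ x (j : Fin 3),
    d.D j x = -(maxwellDual L (d.metric4 χ x) (F₀ x) j.succ 0 * (d.lapse χ x)⁻¹)
  induction : ∀ x (j : Fin 3),
    d.B j x = -(hodge (d.metric4 χ x) (F₀ x) j.succ 0 * (d.lapse χ x)⁻¹)
  vanishing : ∀ μ ν, Tendsto (fun x => F₀ x μ ν) (cocompact Space) (𝓝 0)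

/-- `d` is a set of abstract initial data for the Einstein-nonlinear electromagnetic system whose
electromagnetic part is described by the Faraday tensor `F₀` along `{t = 0}`: `g̲` is a Riemannian
metric, `K` is symmetric, and the Gauss, Codazzi and electromagnetic constraints hold. -/
structure AbstractData.IsAdmissible (χ : ℝ → ℝ) (L : ℝ × ℝ → ℝ) (d : AbstractData)
    (F₀ : Space → Fin 4 → Fin 4 → ℝ) : Prop where
  metric_posDef : ∀ x, (d.metric χ x).PosDef
  K_symm : ∀ j k x, d.K j k x = d.K k j x
  gauss : ∀ x,
    d.scalarCurv χ x
      - (∑ a, ∑ a', ∑ b, ∑ b', (d.metric χ x)⁻¹ a a' * (d.metric χ x)⁻¹ b b' *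
          d.K a b x * d.K a' b' x)
      + (d.trK χ x) ^ 2
    = 2 * (energyMomentum L (d.metric4 χ x) (F₀ x) 0 0 * ((d.lapse χ x)⁻¹) ^ 2)
  codazzi : ∀ x (j : Fin 3),
    (∑ a, ∑ b, (d.metric χ x)⁻¹ a b * d.covK χ x a b j)
      - (∑ a, ∑ b, (d.metric χ x)⁻¹ a b * d.covK χ x j a b)
    = energyMomentum L (d.metric4 χ x) (F₀ x) 0 j.succ * (d.lapse χ x)⁻¹
  div_D : ∀ x, d.divergence χ d.D x = 0
  div_B : ∀ x, d.divergence χ d.B x = 0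

/- ### The reduced system -/

/-- The Schwarzschild tail `h^{(0)}_{μν} = χ(r/t) χ(r) (2M/r) δ_{μν}`. The factor `χ(r/t)` is read
as its limit `1` at `t = 0`. -/
def schwarzschildTail (χ : ℝ → ℝ) (M : ℝ) (μ ν : Fin 4) (p : Spacetime) : ℝ :=
  if μ = ν then
    (if p.1 ≤ 0 then 1 else χ (‖p.2‖ / p.1)) * χ ‖p.2‖ * (2 * M / ‖p.2‖)
  else 0

/-- The spacetime metric `g = m + h^{(0)} + h^{(1)}`. -/
def spacetimeMetric (χ : ℝ → ℝ) (M : ℝ) (h1 : Fin 4 → Fin 4 → Spacetime → ℝ) (p : Spacetime) :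
    Matrix (Fin 4) (Fin 4) ℝ :=
  Matrix.of fun μ ν => mink μ ν + schwarzschildTail χ M μ ν p + h1 μ ν p

/-- The reduced wave operator `(g⁻¹)^{κλ} ∇_κ ∇_λ u` at a point where the metric is `g`. -/
def reducedBox (S : Set Spacetime) (g : Matrix (Fin 4) (Fin 4) ℝ) (u : Spacetime → ℝ)
    (p : Spacetime) : ℝ :=
  ∑ κ, ∑ l, g⁻¹ κ l * pd S κ (pd S l u) p

/-- `(h^{(1)}, F)` is a classical solution on `[0, T) × ℝ³` of the reduced system with Lagrangian
`L` (defined on `U`) and mass parameter `M`; `h^{(1)}` is of class `C^{N+1}` and `F` of class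
`C^N`. -/
structure IsReducedSolution (χ : ℝ → ℝ) (U : Set (ℝ × ℝ)) (L : ℝ × ℝ → ℝ) (M : ℝ) (N : ℕ) (T : ℝ)
    (h1 F : Fin 4 → Fin 4 → Spacetime → ℝ) : Prop where
  h1_regular : ∀ μ ν, ContDiffOn ℝ ((N + 1 : ℕ) : WithTop ℕ∞) (h1 μ ν) (slab T)
  F_regular : ∀ μ ν, ContDiffOn ℝ (N : WithTop ℕ∞) (F μ ν) (slab T)
  h1_symm : ∀ μ ν, ∀ p ∈ slab T, h1 μ ν p = h1 ν μ p
  F_antisymm : ∀ μ ν, ∀ p ∈ slab T, F μ ν p = - F ν μ p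
  lorentzian : ∀ p ∈ slab T, (spacetimeMetric χ M h1 p).det < 0
  invariants_mem : ∀ p ∈ slab T,
    invariants (spacetimeMetric χ M h1 p) (fun μ ν => F μ ν p) ∈ U
  wave : ∀ p ∈ slab T, ∀ μ ν,
    reducedBox (slab T) (spacetimeMetric χ M h1 p) (h1 μ ν) p
      = waveSource L (spacetimeMetric χ M h1 p)
          (fun l α β => pd (slab T) l (fun q => spacetimeMetric χ M h1 q α β) p)
          (fun α β => F α β p) μ ν
        - reducedBox (slab T) (spacetimeMetric χ M h1 p) (schwarzschildTail χ M μ ν) p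
  faraday : ∀ p ∈ slab T, ∀ l μ ν,
    pd (slab T) l (F μ ν) p + pd (slab T) μ (F ν l) p + pd (slab T) ν (F l μ) p = 0
  maxwell : ∀ p ∈ slab T, ∀ ν,
    ∑ μ, ∑ κ, ∑ l,
        tensorN L (spacetimeMetric χ M h1 p) (fun α β => F α β p) μ ν κ l
          * pd (slab T) μ (F κ l) p
      = maxwellSource L (spacetimeMetric χ M h1 p)
          (fun l α β => pd (slab T) l (fun q => spacetimeMetric χ M h1 q α β) p)
          (fun α β => F α β p) ν

/-- The solution `(h^{(1)}, F)` on `[0, T) × ℝ³` is launched by the reduced data that are built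
from the abstract data `d`. -/
structure IsLaunchedBy (χ : ℝ → ℝ) (L : ℝ × ℝ → ℝ) (d : AbstractData) (T : ℝ)
    (h1 F : Fin 4 → Fin 4 → Spacetime → ℝ) : Prop where
  metric : ∀ x μ ν, spacetimeMetric χ d.M h1 (0, x) μ ν = d.metric4 χ x μ ν
  dtmetric : ∀ x μ ν,
    pd (slab T) 0 (fun q => spacetimeMetric χ d.M h1 q μ ν) (0, x) = d.dtmetric4 χ x μ ν
  faraday : d.IsInitialFaraday χ L (fun x μ ν => F μ ν (0, x))

/- ### The energy -/

/-- Labels of the vectorfields in `𝒵`: the translations `∂_μ`, the fields `Ω_{μν}` with `μ < ν`,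
and the scaling field `S`. -/
abbrev ZLabel := Fin 4 ⊕ {i : Fin 4 × Fin 4 // i.1 < i.2} ⊕ Unit

/-- `x_μ = m_{μκ} x^κ`. -/
def coordLow (μ : Fin 4) (p : Spacetime) : ℝ := ∑ κ, mink μ κ * coord κ p

/-- The component `Z^κ` of the fields `∂_μ`, `Ω_{μν} = x_μ ∂_ν - x_ν ∂_μ`, `S = x^κ ∂_κ`. -/
def zComp : ZLabel → Fin 4 → Spacetime → ℝ
  | Sum.inl μ, κ, _ => if κ = μ then 1 else 0
  | Sum.inr (Sum.inl i), κ, p =>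
      coordLow i.1.1 p * (if κ = i.1.2 then 1 else 0)
      - coordLow i.1.2 p * (if κ = i.1.1 then 1 else 0)
  | Sum.inr (Sum.inr _), κ, p => coord κ p

/-- `∇_Z U` for a type `(0,2)` tensorfield. -/
def covZ (S : Set Spacetime) (Z : ZLabel) (U : Fin 4 → Fin 4 → Spacetime → ℝ) :
    Fin 4 → Fin 4 → Spacetime → ℝ :=
  fun μ ν p => ∑ κ, zComp Z κ p * pd S κ (U μ ν) p

/-- The Lie derivative `ℒ_Z U` of a type `(0,2)` tensorfield. -/
def lieZ (S : Set Spacetime) (Z : ZLabel) (U : Fin 4 → Fin 4 → Spacetime → ℝ) :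
    Fin 4 → Fin 4 → Spacetime → ℝ :=
  fun μ ν p => ∑ κ, (zComp Z κ p * pd S κ (U μ ν) p
    + U κ ν p * pd S μ (zComp Z κ) p + U μ κ p * pd S ν (zComp Z κ) p)

/-- `∇_𝒵^I U` for a `𝒵`-multi-index `I` of length `k`. -/
def covZIter (S : Set Spacetime) {k : ℕ} (I : Fin k → ZLabel)
    (U : Fin 4 → Fin 4 → Spacetime → ℝ) : Fin 4 → Fin 4 → Spacetime → ℝ :=
  (List.ofFn I).foldr (covZ S) U

/-- `ℒ_𝒵^I U` for a `𝒵`-multi-index `I` of length `k`. -/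
def lieZIter (S : Set Spacetime) {k : ℕ} (I : Fin k → ZLabel)
    (U : Fin 4 → Fin 4 → Spacetime → ℝ) : Fin 4 → Fin 4 → Spacetime → ℝ :=
  (List.ofFn I).foldr (lieZ S) U

/-- The energy weight `w(q)`: `1 + (1 + |q|)^{1+2γ}` for `q ≥ 0`, `1 + (1 + |q|)^{-2μ}` for
`q < 0`. -/
def weight (γ μ q : ℝ) : ℝ :=
  if 0 ≤ q then 1 + (1 + |q|) ^ (1 + 2 * γ) else 1 + (1 + |q|) ^ (-2 * μ)

/-- The square of the energy `ℰ_{N;γ;μ}(t)` of a pair `(h^{(1)}, F)` given on the set `S`. Tensors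
are measured by the Euclidean norm of their components in the coordinates `x^μ`. -/
def energySq (S : Set Spacetime) (N : ℕ) (γ μ : ℝ) (h1 F : Fin 4 → Fin 4 → Spacetime → ℝ)
    (t : ℝ) : ℝ≥0∞ :=
  ⨆ τ ∈ Set.Icc 0 t, ∑ k ∈ Finset.range (N + 1), ∑ I : Fin k → ZLabel,
    ∫⁻ x : Space, ENNReal.ofReal
      (((∑ l, ∑ α, ∑ β, (pd S l (covZIter S I h1 α β) (τ, x)) ^ 2)
          + ∑ α, ∑ β, (lieZIter S I F α β (τ, x)) ^ 2)
        * weight γ μ (‖x‖ - τ))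

/-- The energy `ℰ_{N;γ;μ}(t)`. -/
def energy (S : Set Spacetime) (N : ℕ) (γ μ : ℝ) (h1 F : Fin 4 → Fin 4 → Spacetime → ℝ)
    (t : ℝ) : ℝ≥0∞ :=
  energySq S N γ μ h1 F t ^ (1 / 2 : ℝ)

end

end EinsteinNLEM

open EinsteinNLEM

/-! At `t = 0` the energy is a finite sum of weighted `L²` integrals of derivatives of `∂h^{(1)}`
and `F`, time derivatives included. It suffices to bound every derivative of order `k ≤ N` of these
fields in `L²` with weight `r^{1/2+γ+k}` by a multiple of `E + M`: the fields in `𝒵` have affine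
components, so each of them costs one power of `r`, which is the power gained by the derivative it
contains (`GradientJet.covZ`, `TensorJet.lieZ`).

Spatial derivatives come from the data. Time derivatives are removed by induction on their number
(`Level`, `Setting.level_succ`): the wave equation is solved for `∂_t² h^{(1)}` because `(g⁻¹)^{00}
≠ 0`, the homogeneous Maxwell equations give `∂_t F_{ab}`, and the spatial components of the
inhomogeneous ones give `∂_t F_{0k}` because `evolMatrix` is invertible near `(m, 0)`.

The nonlinear terms are treated in two scales of bounds, pointwise and `L²`. A weighted Sobolev
inequality (`exists_weighted_sobolev`) turns the norm into decay `r^{-2-k}` of all but the three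
highest orders. In a product, one of the two factors carries few enough derivatives to be bounded
pointwise (`Jet.mul_l2`), and smooth functions of `(g, F)` are handled by the chain rule
(`Jet.comp_pt`, `Jet.comp_l2`).

The decay of the mass term `M/r` is critical: `M/r²` and `M/r³` do not lie in the spaces required of
`∂h^{(1)}` and its derivatives. The contributions linear in `M` cancel, in `∂_t g_{0j}` by the
choice of the lapse (`Setting.dtmetric_shift_eq`), and in the wave equation because `1/r` is
harmonic (`laplacian_newton_eq_zero`). The remaining contributions of the mass carry a further
factor that decays like `1/r`, or are quadratic in first derivatives; they are of size `r^{-3}` and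
`r^{-4}` in the two cases, which suffices since `γ < 1/2`.

The initial `F` is given only implicitly by `𝔇` and `𝔅`. It is small everywhere by a continuity
argument in `x` that starts at infinity (`exists_isSmall`); on small fields a local inverse of
`dualMap` recovers its regularity, and a linear formula then recovers its decay
(`Setting.ctl_F_initial`).

Constants are uniform because every bound concerns the whole family of solutions, indexed by
`Launch`, and is linear in the parameter `Launch.size`, which is finally taken to be `E + M`. The
threshold `ε₀` is independent of `N` because smallness uses three derivatives of the data and `L ∈
C²` only. -/

namespace EinsteinNLEM

/-! ### Calculus up to the boundary of the half-space -/

/-- The half-space `{t ≥ 0}` of the spacetime. -/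
def half : Set Spacetime := Set.Ici 0 ×ˢ Set.univ

/-- `C^n` regularity, up to the boundary, near `{t = 0}`. -/
def Smooth (n : ℕ) (u : Spacetime → ℝ) : Prop :=
  ∀ x : Space, ContDiffWithinAt ℝ (n : WithTop ℕ∞) u half (0, x)

/-- Equality in a one-sided neighbourhood of every point of `{t = 0}`. -/
def GermEq (u v : Spacetime → ℝ) : Prop := ∀ x : Space, u =ᶠ[𝓝[half] (0, x)] v

/-- The coordinate derivative in the half-space. -/
noncomputable abbrev D (μ : Fin 4) (u : Spacetime → ℝ) : Spacetime → ℝ := pd half μ u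

lemma uniqueDiffOn_half : UniqueDiffOn ℝ half :=
  (uniqueDiffOn_Ici 0).prod uniqueDiffOn_univ

lemma mem_half (x : Space) : ((0, x) : Spacetime) ∈ half := by
  simp [half]

lemma half_subset_closure_interior (p : Spacetime) (hp : p ∈ half) :
    p ∈ closure (interior half) := by
  rw [half, interior_prod_eq, interior_Ici, interior_univ, closure_prod_eq, closure_Ioi,
    closure_univ]
  exact hp

namespace Smooth

variable {n m : ℕ} {u v : Spacetime → ℝ}

lemma mono (h : Smooth n u) (hm : m ≤ n) : Smooth m u := fun x =>
  (h x).of_le (by exact_mod_cast hm)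

lemma eventually (h : Smooth n u) (x : Space) :
    ∀ᶠ p in 𝓝[half] (0, x), ContDiffWithinAt ℝ (n : WithTop ℕ∞) u half p := by
  have := (h x).eventually (by exact_mod_cast (WithTop.natCast_ne_top n : ((n : ℕ∞) ≠ ⊤)))
  rwa [Set.insert_eq_of_mem (mem_half x)] at this

lemma eventually_differentiable (h : Smooth 1 u) (x : Space) :
    ∀ᶠ p in 𝓝[half] (0, x), DifferentiableWithinAt ℝ u half p := by
  filter_upwards [h.eventually x] with p hp
  exact hp.differentiableWithinAt (by simp)

lemma D (h : Smooth (n + 1) u) (μ : Fin 4) : Smooth n (D μ u) := fun x =>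
  ((h x).fderivWithin_right uniqueDiffOn_half (by norm_cast) (mem_half x)).clm_apply
    contDiffWithinAt_const

lemma congr (h : Smooth n u) (huv : GermEq u v) : Smooth n v := fun x =>
  (h x).congr_of_eventuallyEq (huv x).symm ((huv x).self_of_nhdsWithin (mem_half x)).symm

lemma const (c : ℝ) : Smooth n (fun _ => c) := fun _ => contDiffWithinAt_const

lemma add (hu : Smooth n u) (hv : Smooth n v) : Smooth n (fun p => u p + v p) := fun x =>
  (hu x).add (hv x)

lemma sub (hu : Smooth n u) (hv : Smooth n v) : Smooth n (fun p => u p - v p) := fun x =>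
  (hu x).sub (hv x)

lemma mul (hu : Smooth n u) (hv : Smooth n v) : Smooth n (fun p => u p * v p) := fun x =>
  (hu x).mul (hv x)

lemma sum {β : Type*} {s : Finset β} {u : β → Spacetime → ℝ} (h : ∀ b ∈ s, Smooth n (u b)) :
    Smooth n (fun p => ∑ b ∈ s, u b p) := fun x =>
  ContDiffWithinAt.sum fun b hb => h b hb x

lemma comp {β : Type*} [Fintype β] {u : β → Spacetime → ℝ} {Φ : (β → ℝ) → ℝ} {V : Set (β → ℝ)}
    (hV : IsOpen V) (hΦ : ContDiffOn ℝ (n : WithTop ℕ∞) Φ V) (hu : ∀ b, Smooth n (u b))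
    (hmem : ∀ x : Space, (fun b => u b (0, x)) ∈ V) :
    Smooth n (fun p => Φ fun b => u b p) := fun x =>
  ((hΦ.contDiffAt (hV.mem_nhds (hmem x))).comp_contDiffWithinAt (f := fun p b => u b p) (0, x)
    (contDiffWithinAt_pi.2 fun b => hu b x))

lemma continuous_slice (h : Smooth n u) : Continuous fun x : Space => u (0, x) := by
  rw [continuous_iff_continuousAt]
  intro x
  have h1 : Tendsto u (𝓝[half] (0, x)) (𝓝 (u (0, x))) := (h x).continuousWithinAt
  have h2 : Tendsto (fun y : Space => ((0, y) : Spacetime)) (𝓝 x) (𝓝[half] (0, x)) :=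
    tendsto_nhdsWithin_of_tendsto_nhds_of_eventually_within _
      (Continuous.tendsto (by fun_prop) x) (Eventually.of_forall mem_half)
  exact h1.comp h2

end Smooth

namespace GermEq

variable {u v w : Spacetime → ℝ}

lemma refl (u : Spacetime → ℝ) : GermEq u u := fun _ => EventuallyEq.rfl

lemma of_eq (h : ∀ p, u p = v p) : GermEq u v := fun _ => Eventually.of_forall h

lemma symm (h : GermEq u v) : GermEq v u := fun x => (h x).symm

lemma trans (h : GermEq u v) (h' : GermEq v w) : GermEq u w := fun x => (h x).trans (h' x)

lemma eq (h : GermEq u v) (x : Space) : u (0, x) = v (0, x) :=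
  (h x).self_of_nhdsWithin (mem_half x)

lemma D (h : GermEq u v) (μ : Fin 4) : GermEq (D μ u) (D μ v) := fun x => by
  filter_upwards [(h x).fderivWithin (𝕜 := ℝ)] with p hp
  simp only [EinsteinNLEM.D, pd, hp]

end GermEq

lemma D_const (c : ℝ) (μ : Fin 4) : GermEq (D μ fun _ => c) (fun _ => 0) := by
  refine GermEq.of_eq fun p => ?_
  simp [D, pd]

lemma D_add {u v : Spacetime → ℝ} (hu : Smooth 1 u) (hv : Smooth 1 v) (μ : Fin 4) :
    GermEq (D μ fun p => u p + v p) (fun p => D μ u p + D μ v p) := fun x => by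
  filter_upwards [hu.eventually_differentiable x, hv.eventually_differentiable x,
    self_mem_nhdsWithin] with p h1 h2 hp
  have := fderivWithin_add (uniqueDiffOn_half p hp) h1 h2
  simp only [D, pd]
  change fderivWithin ℝ (u + v) half p _ = _
  rw [this]; rfl

lemma D_sub {u v : Spacetime → ℝ} (hu : Smooth 1 u) (hv : Smooth 1 v) (μ : Fin 4) :
    GermEq (D μ fun p => u p - v p) (fun p => D μ u p - D μ v p) := fun x => by
  filter_upwards [hu.eventually_differentiable x, hv.eventually_differentiable x,
    self_mem_nhdsWithin] with p h1 h2 hp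
  have := fderivWithin_sub (uniqueDiffOn_half p hp) h1 h2
  simp only [D, pd]
  change fderivWithin ℝ (u - v) half p _ = _
  rw [this]; rfl

lemma D_mul {u v : Spacetime → ℝ} (hu : Smooth 1 u) (hv : Smooth 1 v) (μ : Fin 4) :
    GermEq (D μ fun p => u p * v p) (fun p => D μ u p * v p + u p * D μ v p) := fun x => by
  filter_upwards [hu.eventually_differentiable x, hv.eventually_differentiable x,
    self_mem_nhdsWithin] with p h1 h2 hp
  have := fderivWithin_mul (uniqueDiffOn_half p hp) h1 h2
  simp only [D, pd]
  change fderivWithin ℝ (u * v) half p _ = _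
  rw [this]; simp; ring

lemma D_sum {β : Type*} {s : Finset β} {u : β → Spacetime → ℝ} (h : ∀ b ∈ s, Smooth 1 (u b))
    (μ : Fin 4) :
    GermEq (D μ fun p => ∑ b ∈ s, u b p) (fun p => ∑ b ∈ s, D μ (u b) p) := fun x => by
  have h' : ∀ᶠ p in 𝓝[half] (0, x), ∀ b ∈ s, DifferentiableWithinAt ℝ (u b) half p :=
    (Finset.eventually_all s).2 fun b hb => (h b hb).eventually_differentiable x
  filter_upwards [h', self_mem_nhdsWithin] with p h1 hp
  have := fderivWithin_fun_sum (uniqueDiffOn_half p hp) h1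
  simp only [D, pd, this]
  simp

/-- The partial derivative of a function of finitely many real variables. -/
noncomputable def partialD {β : Type*} [Fintype β] [DecidableEq β] (b : β) (Φ : (β → ℝ) → ℝ)
    (y : β → ℝ) : ℝ := fderiv ℝ Φ y (Pi.single b 1)

lemma D_comp {β : Type*} [Fintype β] [DecidableEq β] {u : β → Spacetime → ℝ} {Φ : (β → ℝ) → ℝ}
    {V : Set (β → ℝ)} (hV : IsOpen V) (hΦ : ContDiffOn ℝ 1 Φ V)
    (hu : ∀ b, Smooth 1 (u b)) (hmem : ∀ x : Space, (fun b => u b (0, x)) ∈ V) (μ : Fin 4) :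
    GermEq (D μ fun p => Φ fun b => u b p)
      (fun p => ∑ b, partialD b Φ (fun b => u b p) * D μ (u b) p) := fun x => by
  have h1 : ∀ᶠ p in 𝓝[half] (0, x), ∀ b, DifferentiableWithinAt ℝ (u b) half p :=
    eventually_all.2 fun b => (hu b).eventually_differentiable x
  have h2 : Tendsto (fun p b => u b p) (𝓝[half] ((0, x) : Spacetime)) (𝓝 fun b => u b (0, x)) :=
    tendsto_pi_nhds.2 fun b => ((hu b) x).continuousWithinAt
  filter_upwards [h1, h2.eventually (hV.mem_nhds (hmem x)), self_mem_nhdsWithin] with p hd hm hp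
  have hΦp : DifferentiableAt ℝ Φ (fun b => u b p) :=
    (hΦ.contDiffAt (hV.mem_nhds hm)).differentiableAt (by simp)
  have hc : HasFDerivWithinAt (fun p b => u b p)
      (ContinuousLinearMap.pi fun b => fderivWithin ℝ (u b) half p) half p :=
    hasFDerivWithinAt_pi.2 fun b => (hd b).hasFDerivWithinAt
  have := (hΦp.hasFDerivAt.comp_hasFDerivWithinAt p hc).fderivWithin (uniqueDiffOn_half p hp)
  simp only [D, pd, partialD]
  change fderivWithin ℝ (Φ ∘ fun p b => u b p) half p _ = _
  rw [this, ContinuousLinearMap.comp_apply]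
  set v := (ContinuousLinearMap.pi fun b => fderivWithin ℝ (u b) half p) (coordVec μ) with hv
  have hvs : v = ∑ b, v b • (Pi.single b (1 : ℝ) : β → ℝ) := by
    ext c
    simp [Finset.sum_apply, Pi.single_apply]
  rw [hvs, map_sum]
  refine Finset.sum_congr rfl fun b _ => ?_
  rw [map_smul, smul_eq_mul, mul_comm]
  simp [hv]

/-- Second derivatives are symmetric up to the boundary because every point of `half` is a limit of
interior points. -/
lemma D_comm {u : Spacetime → ℝ} (hu : Smooth 2 u) (μ ν : Fin 4) :
    GermEq (D μ (D ν u)) (D ν (D μ u)) := fun x => by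
  filter_upwards [hu.eventually x, self_mem_nhdsWithin] with p hc hp
  have hs := hc.isSymmSndFDerivWithinAt (by simp) uniqueDiffOn_half
    (half_subset_closure_interior p hp) hp
  have hd : DifferentiableWithinAt ℝ (fderivWithin ℝ u half) half p :=
    (hc.fderivWithin_right (m := 1) uniqueDiffOn_half (by norm_num) hp).differentiableWithinAt
      (by simp)
  have key : ∀ a b : Fin 4, D a (D b u) p
      = fderivWithin ℝ (fderivWithin ℝ u half) half p (coordVec a) (coordVec b) := by
    intro a b
    have := fderivWithin_clm_apply (uniqueDiffOn_half p hp) hd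
      (differentiableWithinAt_const (c := coordVec b))
    change fderivWithin ℝ (fun q => fderivWithin ℝ u half q (coordVec b)) half p _ = _
    rw [this]
    simp
  rw [key, key, hs]

/-- The direction `k.succ` is tangent to `{t = 0}`, so the one-sided derivative sees only the trace
of `u`. In this way data on `{t = 0}` determine the purely spatial derivatives of the solution. -/
lemma D_slice {u : Spacetime → ℝ} (hu : Smooth 1 u) (k : Fin 3) (x : Space) :
    D k.succ u (0, x) = sd k (fun y => u (0, y)) x := by
  have h1 : HasFDerivWithinAt u (fderivWithin ℝ u half (0, x)) half (0, x) :=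
    ((hu x).differentiableWithinAt (by simp)).hasFDerivWithinAt
  have h2 : HasFDerivAt (fun y : Space => ((0, y) : Spacetime))
      (ContinuousLinearMap.inr ℝ ℝ Space) x :=
    (hasFDerivAt_const (0 : ℝ) x).prodMk (hasFDerivAt_id x)
  have h3 := h1.comp_hasFDerivAt x h2 (Eventually.of_forall mem_half)
  simp only [D, pd, sd]
  change _ = fderiv ℝ (u ∘ fun y => (0, y)) x _
  rw [h3.fderiv]
  simp [coordVec]

lemma D_congr_slice {u v : Spacetime → ℝ} (hu : Smooth 1 u) (hv : Smooth 1 v)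
    (h : ∀ x : Space, u (0, x) = v (0, x)) (k : Fin 3) (x : Space) :
    D k.succ u (0, x) = D k.succ v (0, x) := by
  rw [D_slice hu, D_slice hv]
  simp only [h]

/-- The static extension of a function on space. -/
def lift (f : Space → ℝ) : Spacetime → ℝ := fun p => f p.2

lemma smooth_lift {n : ℕ} {f : Space → ℝ} (hf : ContDiff ℝ (n : WithTop ℕ∞) f) :
    Smooth n (lift f) := fun _ => (hf.comp contDiff_snd).contDiffWithinAt

lemma D_zero_lift {f : Space → ℝ} (hf : ContDiff ℝ 1 f) :
    GermEq (D 0 (lift f)) (fun _ => 0) := fun x => by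
  filter_upwards [self_mem_nhdsWithin] with p hp
  have h : HasFDerivAt (lift f) ((fderiv ℝ f p.2).comp (ContinuousLinearMap.snd ℝ ℝ Space)) p :=
    (hf.differentiable (by simp) p.2).hasFDerivAt.comp p hasFDerivAt_snd
  simp only [D, pd]
  rw [h.hasFDerivWithinAt.fderivWithin (uniqueDiffOn_half p hp)]
  simp [coordVec]

lemma D_succ_lift {f : Space → ℝ} (hf : ContDiff ℝ 1 f) (k : Fin 3) :
    GermEq (D k.succ (lift f)) (lift (sd k f)) := fun x => by
  filter_upwards [self_mem_nhdsWithin] with p hp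
  have h : HasFDerivAt (lift f) ((fderiv ℝ f p.2).comp (ContinuousLinearMap.snd ℝ ℝ Space)) p :=
    (hf.differentiable (by simp) p.2).hasFDerivAt.comp p hasFDerivAt_snd
  simp only [D, pd, lift, sd]
  change fderivWithin ℝ (lift f) half p _ = _
  rw [h.hasFDerivWithinAt.fderivWithin (uniqueDiffOn_half p hp)]
  simp [coordVec]

lemma contDiff_sd {n : ℕ} {f : Space → ℝ} (hf : ContDiff ℝ ((n + 1 : ℕ) : WithTop ℕ∞) f)
    (k : Fin 3) : ContDiff ℝ (n : WithTop ℕ∞) (sd k f) :=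
  (hf.fderiv_right (m := (n : WithTop ℕ∞)) (by norm_cast)).clm_apply contDiff_const

lemma contDiff_partialD {β : Type*} [Fintype β] [DecidableEq β] {n : ℕ} {Φ : (β → ℝ) → ℝ}
    {V : Set (β → ℝ)} (hV : IsOpen V) (hΦ : ContDiffOn ℝ ((n + 1 : ℕ) : WithTop ℕ∞) Φ V) (b : β) :
    ContDiffOn ℝ (n : WithTop ℕ∞) (partialD b Φ) V :=
  (hΦ.fderiv_of_isOpen hV (by norm_cast)).clm_apply contDiffOn_const

end EinsteinNLEM

/-! ### Weights and uniform bounds for families of functions -/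

namespace EinsteinNLEM

/-- The weight `(1 + |x|²)^{1/2}`. -/
noncomputable def jp (x : Space) : ℝ := Real.sqrt (1 + ‖x‖ ^ 2)

lemma one_le_jp (x : Space) : 1 ≤ jp x := Real.one_le_sqrt.2 (by nlinarith [sq_nonneg ‖x‖])

lemma jp_pos (x : Space) : 0 < jp x := one_pos.trans_le (one_le_jp x)

lemma jp_rpow_pos (x : Space) (s : ℝ) : 0 < jp x ^ s := Real.rpow_pos_of_pos (jp_pos x) s

lemma jp_sq (x : Space) : jp x ^ 2 = 1 + ‖x‖ ^ 2 := Real.sq_sqrt (by positivity)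

lemma continuous_jp : Continuous jp := by unfold jp; fun_prop

lemma continuous_jp_rpow (s : ℝ) : Continuous fun x => jp x ^ s :=
  continuous_jp.rpow_const fun x => Or.inl (jp_pos x).ne'

lemma norm_le_jp (x : Space) : ‖x‖ ≤ jp x :=
  Real.le_sqrt_of_sq_le (by linarith)

lemma jp_rpow_mono (x : Space) {s t : ℝ} (h : s ≤ t) : jp x ^ s ≤ jp x ^ t :=
  Real.rpow_le_rpow_of_exponent_le (one_le_jp x) h

lemma jp_rpow_eq (x : Space) (s : ℝ) : jp x ^ (2 * s) = (1 + ‖x‖ ^ 2) ^ s := by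
  rw [Real.rpow_mul (jp_pos x).le, ← jp_sq]
  norm_num

lemma jp_le_one_add (x : Space) : jp x ≤ 1 + ‖x‖ :=
  Real.sqrt_le_iff.2 ⟨by positivity, by nlinarith [norm_nonneg x]⟩

lemma one_add_le_jp (x : Space) : 1 + ‖x‖ ≤ 2 * jp x := by
  linarith [norm_le_jp x, one_le_jp x]

lemma lintegral_jp_lt_top {s : ℝ} (hs : 3 < s) : ∫⁻ x : Space, ENNReal.ofReal (jp x ^ (-s)) < ∞ := by
  have h := (integrable_rpow_neg_one_add_norm_sq (E := Space) (μ := volume) (r := s)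
    (by simpa using hs)).lintegral_lt_top
  refine lt_of_eq_of_lt (lintegral_congr fun x => ?_) h
  rw [← jp_rpow_eq]; ring_nf

section Bounds

variable {ι : Type*}

/-- Uniform pointwise decay. -/
def PtBd (θ : ι → ℝ) (e : ℝ) (a : ι → Space → ℝ) : Prop :=
  ∃ C : ℝ, 0 ≤ C ∧ ∀ i x, |a i x| ≤ C * θ i * jp x ^ (-e)

/-- Uniform bounds in weighted `L²`, phrased through measurable majorants. -/
def L2Bd (θ : ι → ℝ) (w : ℝ) (a : ι → Space → ℝ) : Prop :=
  ∃ C : ℝ, 0 ≤ C ∧ ∃ b : ι → Space → ℝ, ∀ i, Measurable (b i) ∧ (∀ x, |a i x| ≤ b i x) ∧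
    ∫⁻ x, ENNReal.ofReal ((jp x ^ w * b i x) ^ 2) ≤ ENNReal.ofReal (C * θ i ^ 2)

/-- Closure properties of a scale of bounds. -/
structure BoundScale (P : ℝ → (ι → Space → ℝ) → Prop) : Prop where
  zero : ∀ e, P e fun _ _ => 0
  add : ∀ {e a b}, P e a → P e b → P e fun i x => a i x + b i x
  const_mul : ∀ (c : ℝ) {e a}, P e a → P e fun i x => c * a i x
  anti : ∀ {e e' a}, e' ≤ e → P e a → P e' a
  dom : ∀ {e a b}, (∀ i x, |b i x| ≤ |a i x|) → P e a → P e b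

lemma boundScale_ptBd {θ : ι → ℝ} (hθ : ∀ i, 0 ≤ θ i) : BoundScale (PtBd θ) where
  zero e := ⟨0, le_rfl, fun i x => by simp⟩
  add := by
    rintro e a b ⟨C, hC, h⟩ ⟨C', hC', h'⟩
    refine ⟨C + C', by positivity, fun i x => ?_⟩
    calc |a i x + b i x| ≤ |a i x| + |b i x| := abs_add_le _ _
      _ ≤ _ := by linarith [h i x, h' i x]
  const_mul := by
    rintro c e a ⟨C, hC, h⟩
    refine ⟨|c| * C, by positivity, fun i x => ?_⟩
    rw [abs_mul, mul_assoc, mul_assoc, ← mul_assoc C]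
    exact mul_le_mul_of_nonneg_left (h i x) (abs_nonneg c)
  anti := by
    rintro e e' a hee ⟨C, hC, h⟩
    refine ⟨C, hC, fun i x => (h i x).trans ?_⟩
    exact mul_le_mul_of_nonneg_left (jp_rpow_mono x (by linarith)) (mul_nonneg hC (hθ i))
  dom := by
    rintro e a b hab ⟨C, hC, h⟩
    exact ⟨C, hC, fun i x => (hab i x).trans (h i x)⟩

lemma boundScale_l2Bd (θ : ι → ℝ) : BoundScale (L2Bd θ) where
  zero e := ⟨0, le_rfl, fun _ _ => 0, fun i => ⟨measurable_const, by simp, by simp⟩⟩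
  add := by
    rintro e a a' ⟨C, hC, b, h⟩ ⟨C', hC', b', h'⟩
    refine ⟨2 * C + 2 * C', by positivity, fun i x => b i x + b' i x, fun i => ?_⟩
    obtain ⟨h1, h2, h3⟩ := h i
    obtain ⟨h1', h2', h3'⟩ := h' i
    refine ⟨h1.add h1', fun x => (abs_add_le _ _).trans (add_le_add (h2 x) (h2' x)), ?_⟩
    have hm : Measurable fun x => 2 * ENNReal.ofReal ((jp x ^ e * b i x) ^ 2) :=
      ((((continuous_jp_rpow e).measurable.mul h1).pow_const 2).ennreal_ofReal).const_mul 2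
    calc ∫⁻ x, ENNReal.ofReal ((jp x ^ e * (b i x + b' i x)) ^ 2)
        ≤ ∫⁻ x, (2 * ENNReal.ofReal ((jp x ^ e * b i x) ^ 2)
            + 2 * ENNReal.ofReal ((jp x ^ e * b' i x) ^ 2)) := by
          refine lintegral_mono fun x => ?_
          rw [← ENNReal.ofReal_ofNat 2, ← ENNReal.ofReal_mul (by norm_num),
            ← ENNReal.ofReal_mul (by norm_num), ← ENNReal.ofReal_add (by positivity) (by positivity)]
          refine ENNReal.ofReal_le_ofReal ?_
          nlinarith [sq_nonneg (jp x ^ e * b i x - jp x ^ e * b' i x)]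
      _ = 2 * (∫⁻ x, ENNReal.ofReal ((jp x ^ e * b i x) ^ 2))
            + 2 * ∫⁻ x, ENNReal.ofReal ((jp x ^ e * b' i x) ^ 2) := by
          rw [lintegral_add_left hm, lintegral_const_mul' _ _ (by simp),
            lintegral_const_mul' _ _ (by simp)]
      _ ≤ 2 * ENNReal.ofReal (C * θ i ^ 2) + 2 * ENNReal.ofReal (C' * θ i ^ 2) := by gcongr
      _ = _ := by
          rw [← ENNReal.ofReal_ofNat 2, ← ENNReal.ofReal_mul (by norm_num),
            ← ENNReal.ofReal_mul (by norm_num), ← ENNReal.ofReal_add (by positivity) (by positivity)]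
          congr 1; ring
  const_mul := by
    rintro c e a ⟨C, hC, b, h⟩
    refine ⟨c ^ 2 * C, by positivity, fun i x => |c| * b i x, fun i => ?_⟩
    obtain ⟨h1, h2, h3⟩ := h i
    refine ⟨h1.const_mul _, fun x => ?_, ?_⟩
    · rw [abs_mul]; exact mul_le_mul_of_nonneg_left (h2 x) (abs_nonneg c)
    · calc ∫⁻ x, ENNReal.ofReal ((jp x ^ e * (|c| * b i x)) ^ 2)
          = ∫⁻ x, ENNReal.ofReal (c ^ 2) * ENNReal.ofReal ((jp x ^ e * b i x) ^ 2) := by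
            refine lintegral_congr fun x => ?_
            rw [← ENNReal.ofReal_mul (by positivity), ← sq_abs c]; congr 1; ring
        _ = ENNReal.ofReal (c ^ 2) * ∫⁻ x, ENNReal.ofReal ((jp x ^ e * b i x) ^ 2) :=
            lintegral_const_mul' _ _ (by simp)
        _ ≤ ENNReal.ofReal (c ^ 2) * ENNReal.ofReal (C * θ i ^ 2) := by gcongr
        _ = _ := by rw [← ENNReal.ofReal_mul (by positivity)]; congr 1; ring
  anti := by
    rintro e e' a hee ⟨C, hC, b, h⟩
    refine ⟨C, hC, b, fun i => ?_⟩
    obtain ⟨h1, h2, h3⟩ := h i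
    refine ⟨h1, h2, (lintegral_mono fun x => ENNReal.ofReal_le_ofReal ?_).trans h3⟩
    have := jp_rpow_mono x hee
    have hb : 0 ≤ b i x := (abs_nonneg _).trans (h2 x)
    have := (jp_rpow_pos x e').le
    gcongr
  dom := by
    rintro e a b' hab ⟨C, hC, b, h⟩
    exact ⟨C, hC, b, fun i => ⟨(h i).1, fun x => (hab i x).trans ((h i).2.1 x), (h i).2.2⟩⟩

lemma BoundScale.sum {P : ℝ → (ι → Space → ℝ) → Prop} (hP : BoundScale P) {β : Type*}
    {s : Finset β} {e : ℝ} {a : β → ι → Space → ℝ} (h : ∀ b ∈ s, P e (a b)) :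
    P e fun i x => ∑ b ∈ s, a b i x := by
  classical
  induction s using Finset.induction_on with
  | empty => simpa using hP.zero e
  | insert b s hb ih =>
    simp only [Finset.sum_insert hb]
    exact hP.add (h b (by simp)) (ih fun c hc => h c (by simp [hc]))

lemma BoundScale.abs {P : ℝ → (ι → Space → ℝ) → Prop} (hP : BoundScale P) {e : ℝ}
    {a : ι → Space → ℝ} (h : P e a) : P e fun i x => |a i x| :=
  hP.dom (fun _ _ => (abs_abs _).le) h

/-- One factor is measured with parameter `1`. The product of two small quantities is thus recorded
as linear in `θ`, which is all that is needed and keeps a single scale of bounds. -/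
lemma PtBd.mul {θ : ι → ℝ} {e e' : ℝ} {a b : ι → Space → ℝ} (ha : PtBd (fun _ => 1) e a)
    (hb : PtBd θ e' b) : PtBd θ (e + e') fun i x => a i x * b i x := by
  obtain ⟨C, hC, h⟩ := ha
  obtain ⟨C', hC', h'⟩ := hb
  refine ⟨C * C', by positivity, fun i x => ?_⟩
  rw [abs_mul]
  refine (mul_le_mul (h i x) (h' i x) (abs_nonneg _)
    (mul_nonneg (by simpa using hC) (jp_rpow_pos x _).le)).trans (le_of_eq ?_)
  rw [neg_add, Real.rpow_add (jp_pos x)]; ring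

lemma PtBd.mul_l2Bd {θ : ι → ℝ} {e w : ℝ} {a b : ι → Space → ℝ} (ha : PtBd (fun _ => 1) e a)
    (hb : L2Bd θ w b) : L2Bd θ (w + e) fun i x => a i x * b i x := by
  obtain ⟨C, hC, h⟩ := ha
  obtain ⟨C', hC', c, h'⟩ := hb
  refine ⟨C ^ 2 * C', by positivity, fun i x => C * jp x ^ (-e) * c i x, fun i => ?_⟩
  obtain ⟨h1, h2, h3⟩ := h' i
  refine ⟨((continuous_jp_rpow (-e)).measurable.const_mul C).mul h1, fun x => ?_, ?_⟩
  · rw [abs_mul]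
    exact mul_le_mul (by simpa using h i x) (h2 x) (abs_nonneg _)
      (mul_nonneg hC (jp_rpow_pos x _).le)
  · calc ∫⁻ x, ENNReal.ofReal ((jp x ^ (w + e) * (C * jp x ^ (-e) * c i x)) ^ 2)
        = ∫⁻ x, ENNReal.ofReal (C ^ 2) * ENNReal.ofReal ((jp x ^ w * c i x) ^ 2) := by
          refine lintegral_congr fun x => ?_
          rw [← ENNReal.ofReal_mul (by positivity), Real.rpow_add (jp_pos x),
            Real.rpow_neg (jp_pos x).le]
          have := (jp_rpow_pos x e).ne'
          congr 1; field_simp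
      _ = ENNReal.ofReal (C ^ 2) * ∫⁻ x, ENNReal.ofReal ((jp x ^ w * c i x) ^ 2) :=
          lintegral_const_mul' _ _ (by simp)
      _ ≤ ENNReal.ofReal (C ^ 2) * ENNReal.ofReal (C' * θ i ^ 2) := by gcongr
      _ = _ := by rw [← ENNReal.ofReal_mul (by positivity)]; congr 1; ring

/-- The function `r^{-2(e-w)}` is integrable at infinity in `ℝ³` exactly when `2(e-w) > 3`. -/
lemma PtBd.l2Bd {θ : ι → ℝ} {e w : ℝ} {a : ι → Space → ℝ} (ha : PtBd θ e a)
    (hw : w + 3 / 2 < e) : L2Bd θ w a := by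
  obtain ⟨C, hC, h⟩ := ha
  set I := ∫⁻ x : Space, ENNReal.ofReal (jp x ^ (-(2 * (e - w)))) with hI
  have hfin : I < ∞ := lintegral_jp_lt_top (by linarith)
  refine ⟨C ^ 2 * I.toReal, by positivity, fun i x => C * θ i * jp x ^ (-e),
    fun i => ⟨(continuous_jp_rpow (-e)).measurable.const_mul _, h i, ?_⟩⟩
  calc ∫⁻ x, ENNReal.ofReal ((jp x ^ w * (C * θ i * jp x ^ (-e))) ^ 2)
      = ∫⁻ x, ENNReal.ofReal ((C * θ i) ^ 2) * ENNReal.ofReal (jp x ^ (-(2 * (e - w)))) := by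
        refine lintegral_congr fun x => ?_
        rw [← ENNReal.ofReal_mul (by positivity)]
        have : jp x ^ (-(2 * (e - w))) = (jp x ^ w * jp x ^ (-e)) ^ 2 := by
          rw [← Real.rpow_add (jp_pos x), ← Real.rpow_natCast, ← Real.rpow_mul (jp_pos x).le]
          congr 1; push_cast; ring
        rw [this]; congr 1; ring
    _ = ENNReal.ofReal ((C * θ i) ^ 2) * I := lintegral_const_mul' _ _ (by simp)
    _ ≤ _ := by
        rw [← ENNReal.ofReal_toReal hfin.ne, ← ENNReal.ofReal_mul (by positivity),
          ENNReal.toReal_ofReal ENNReal.toReal_nonneg]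
        exact ENNReal.ofReal_le_ofReal (le_of_eq (by ring))

lemma PtBd.of_le_one {θ : ι → ℝ} (hθ : ∀ i, θ i ≤ 1) {e : ℝ} {a : ι → Space → ℝ}
    (ha : PtBd θ e a) : PtBd (fun _ => 1) e a := by
  obtain ⟨C, hC, h⟩ := ha
  refine ⟨C, hC, fun i x => (h i x).trans ?_⟩
  exact mul_le_mul_of_nonneg_right (mul_le_mul_of_nonneg_left (hθ i) hC) (jp_rpow_pos x _).le

end Bounds

/-! ### Jets along the initial surface and the weighted product rules -/

section Jets

variable {ι : Type*}

/-- The derivatives of order `< n` of `u` at `t = 0`, with at most `j` of them in the direction of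
time, satisfy the bounds `P`, whose exponent grows by one with each derivative. -/
def Jet (P : ℝ → (ι → Space → ℝ) → Prop) : ℕ → ℕ → ℝ → (ι → Spacetime → ℝ) → Prop
  | 0, _, _, _ => True
  | n + 1, j, e, u => P e (fun i x => u i (0, x))
      ∧ (∀ k : Fin 3, Jet P n j (e + 1) fun i => D k.succ (u i))
      ∧ (1 ≤ j → Jet P n (j - 1) (e + 1) fun i => D 0 (u i))

variable {P Q : ℝ → (ι → Space → ℝ) → Prop} {n m j : ℕ} {e w : ℝ} {u v : ι → Spacetime → ℝ}

namespace Jet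

lemma congr (h : ∀ i, GermEq (u i) (v i)) (hu : Jet P n j e u) : Jet P n j e v := by
  induction n generalizing j e u v with
  | zero => trivial
  | succ n ih =>
    obtain ⟨h1, h2, h3⟩ := hu
    refine ⟨?_, fun k => ih (fun i => (h i).D _) (h2 k), fun hj => ih (fun i => (h i).D _) (h3 hj)⟩
    simpa only [fun i x => (h i).eq x] using h1

lemma mono_order (hu : Jet P n j e u) (hm : m ≤ n) : Jet P m j e u := by
  induction m generalizing n j e u with
  | zero => trivial
  | succ m ih =>
    obtain ⟨n, rfl⟩ : ∃ n', n = n' + 1 := ⟨n - 1, by omega⟩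
    exact ⟨hu.1, fun k => ih (hu.2.1 k) (by omega), fun hj => ih (hu.2.2 hj) (by omega)⟩

lemma mono_time {j' : ℕ} (hu : Jet P n j e u) (hj : j' ≤ j) : Jet P n j' e u := by
  induction n generalizing j j' e u with
  | zero => trivial
  | succ n ih =>
    exact ⟨hu.1, fun k => ih (hu.2.1 k) hj, fun h => ih (hu.2.2 (by omega)) (by omega)⟩

lemma imp {s : ℝ} (h : ∀ e a, P e a → Q (e + s) a) (hu : Jet P n j e u) : Jet Q n j (e + s) u := by
  induction n generalizing j e u with
  | zero => trivial
  | succ n ih =>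
    have hs : e + s + 1 = e + 1 + s := by ring
    refine ⟨h _ _ hu.1, fun k => ?_, fun hj => ?_⟩
    · rw [hs]; exact ih (hu.2.1 k)
    · rw [hs]; exact ih (hu.2.2 hj)

lemma anti (hP : BoundScale P) {e' : ℝ} (hu : Jet P n j e u) (he : e' ≤ e) : Jet P n j e' u := by
  have := hu.imp (Q := P) (s := e' - e) fun _ _ h => hP.anti (by linarith) h
  simpa using this

lemma zero (hP : BoundScale P) : Jet P n j e fun _ _ => 0 := by
  induction n generalizing j e with
  | zero => trivial
  | succ n ih =>
    exact ⟨hP.zero _, fun k => congr (fun i => (D_const 0 _).symm) ih,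
      fun _ => congr (fun i => (D_const 0 _).symm) ih⟩

lemma add (hP : BoundScale P) (hsu : ∀ i, Smooth (n - 1) (u i)) (hsv : ∀ i, Smooth (n - 1) (v i))
    (hu : Jet P n j e u) (hv : Jet P n j e v) : Jet P n j e fun i p => u i p + v i p := by
  induction n generalizing j e u v with
  | zero => trivial
  | succ n ih =>
    refine ⟨hP.add hu.1 hv.1, ?_⟩
    rcases n with _ | n
    · exact ⟨fun _ => trivial, fun _ => trivial⟩
    · have hg := fun μ i => (D_add ((hsu i).mono (by omega)) ((hsv i).mono (by omega)) μ).symm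
      exact ⟨fun k => congr (hg _) (ih (fun i => (hsu i).D _) (fun i => (hsv i).D _)
          (hu.2.1 k) (hv.2.1 k)),
        fun hj => congr (hg _) (ih (fun i => (hsu i).D _) (fun i => (hsv i).D _)
          (hu.2.2 hj) (hv.2.2 hj))⟩

lemma const_mul (hP : BoundScale P) (c : ℝ) (hsu : ∀ i, Smooth (n - 1) (u i))
    (hu : Jet P n j e u) : Jet P n j e fun i p => c * u i p := by
  induction n generalizing j e u with
  | zero => trivial
  | succ n ih =>
    refine ⟨hP.const_mul c hu.1, ?_⟩
    rcases n with _ | n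
    · exact ⟨fun _ => trivial, fun _ => trivial⟩
    · have hg : ∀ μ i, GermEq (fun p => c * D μ (u i) p) (D μ fun p => c * u i p) := by
        intro μ i
        refine GermEq.symm (fun x => ?_)
        filter_upwards [D_mul (Smooth.const c) ((hsu i).mono (m := 1) (by omega)) μ x,
          D_const c μ x] with p hp hp'
        rw [hp, hp']; ring
      exact ⟨fun k => congr (hg _) (ih (fun i => (hsu i).D _) (hu.2.1 k)),
        fun hj => congr (hg _) (ih (fun i => (hsu i).D _) (hu.2.2 hj))⟩

/-- With no time derivatives allowed, the jet depends on the traces at `t = 0` only. -/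
lemma congr_slice (hsu : ∀ i, Smooth (n - 1) (u i)) (hsv : ∀ i, Smooth (n - 1) (v i))
    (h : ∀ i (x : Space), u i (0, x) = v i (0, x)) (hu : Jet P n 0 e u) : Jet P n 0 e v := by
  induction n generalizing e u v with
  | zero => trivial
  | succ n ih =>
    refine ⟨by simpa only [h] using hu.1, fun k => ?_, fun hj => absurd hj (by omega)⟩
    rcases n with _ | n
    · trivial
    · exact ih (fun i => (hsu i).D _) (fun i => (hsv i).D _)
        (fun i x => D_congr_slice ((hsu i).mono (by omega)) ((hsv i).mono (by omega)) (h i) k x)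
        (hu.2.1 k)

/-- A derivative that contains a time derivative can be rewritten, by commutation, so that `∂_t`
acts first; what remains is a derivative of `∂_t u` with at most `j` further time derivatives. -/
lemma of_time (hsu : ∀ i, Smooth (n - 1) (u i)) (hu : Jet P n j e u)
    (ht : Jet P (n - 1) j (e + 1) fun i => D 0 (u i)) : Jet P n (j + 1) e u := by
  induction n generalizing e u with
  | zero => trivial
  | succ n ih =>
    refine ⟨hu.1, fun k => ?_, fun _ => ht⟩
    rcases n with _ | n
    · trivial
    refine ih (fun i => (hsu i).D _) (hu.2.1 k) ?_
    rcases n with _ | n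
    · trivial
    exact congr (fun i => D_comm ((hsu i).mono (by omega)) _ _) (ht.2.1 k)

lemma mul_pt {θ : ι → ℝ} (hθ : ∀ i, 0 ≤ θ i) {e' : ℝ} (hsu : ∀ i, Smooth (n - 1) (u i))
    (hsv : ∀ i, Smooth (n - 1) (v i)) (hu : Jet (PtBd fun _ => 1) n j e u)
    (hv : Jet (PtBd θ) n j e' v) : Jet (PtBd θ) n j (e + e') fun i p => u i p * v i p := by
  induction n generalizing j e e' u v with
  | zero => trivial
  | succ n ih =>
    refine ⟨hu.1.mul hv.1, ?_⟩
    rcases n with _ | n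
    · exact ⟨fun _ => trivial, fun _ => trivial⟩
    have hP := boundScale_ptBd hθ
    have hg := fun μ i => (D_mul ((hsu i).mono (m := 1) (by omega))
      ((hsv i).mono (m := 1) (by omega)) μ).symm
    have hs1 := fun i => (hsu i).mono (m := n) (by omega)
    have hs2 := fun i => (hsv i).mono (m := n) (by omega)
    have e1 : e + 1 + e' = e + e' + 1 := by ring
    have e2 : e + (e' + 1) = e + e' + 1 := by ring
    refine ⟨fun k => congr (hg k.succ) (add hP ?_ ?_ ?_ ?_), fun hj => congr (hg 0) (add hP ?_ ?_ ?_ ?_)⟩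
    · exact fun i => ((hsu i).D _).mul (hs2 i)
    · exact fun i => (hs1 i).mul ((hsv i).D _)
    · rw [← e1]; exact ih (fun i => (hsu i).D _) hs2 (hu.2.1 k) (hv.mono_order (by omega))
    · rw [← e2]; exact ih hs1 (fun i => (hsv i).D _) (hu.mono_order (by omega)) (hv.2.1 k)
    · exact fun i => ((hsu i).D _).mul (hs2 i)
    · exact fun i => (hs1 i).mul ((hsv i).D _)
    · rw [← e1]
      exact ih (fun i => (hsu i).D _) hs2 (hu.2.2 hj)
        ((hv.mono_order (by omega)).mono_time (by omega))
    · rw [← e2]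
      exact ih hs1 (fun i => (hsv i).D _) ((hu.mono_order (by omega)).mono_time (by omega))
        (hv.2.2 hj)

lemma tail (hu : Jet P n j e u) (k : Fin 3) : Jet P (n - 1) j (e + 1) fun i => D k.succ (u i) := by
  rcases n with _ | n
  · trivial
  · exact hu.2.1 k

lemma tail_time (hu : Jet P n j e u) (hj : 1 ≤ j) :
    Jet P (n - 1) (j - 1) (e + 1) fun i => D 0 (u i) := by
  rcases n with _ | n
  · trivial
  · exact hu.2.2 hj

/-- By the Leibniz rule `a` derivatives fall on `u` and `b` on `v` with `a + b < n ≤ n₁ + n₂`. Hence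
`a < n₁` or `b < n₂`: one factor is bounded pointwise and the other is kept in `L²`. The two
conditions on `w` are the two cases. -/
lemma mul_l2 {θ : ι → ℝ} {n₁ n₂ : ℕ} {e₁ e₂ w₁ w₂ : ℝ} (hsu : ∀ i, Smooth (n - 1) (u i))
    (hsv : ∀ i, Smooth (n - 1) (v i)) (hu : Jet (PtBd fun _ => 1) n₁ j e₁ u)
    (hu' : Jet (L2Bd θ) n j w₁ u) (hv : Jet (PtBd fun _ => 1) n₂ j e₂ v)
    (hv' : Jet (L2Bd θ) n j w₂ v) (hn : n ≤ n₁ + n₂) (h₁ : w ≤ w₁ + e₂) (h₂ : w ≤ w₂ + e₁) :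
    Jet (L2Bd θ) n j w fun i p => u i p * v i p := by
  induction n generalizing j n₁ n₂ e₁ e₂ w w₁ w₂ u v with
  | zero => trivial
  | succ n ih =>
    have hP := boundScale_l2Bd θ
    refine ⟨?_, ?_⟩
    -- If no pointwise bound on `u` is left, then `v` still has one, since the orders satisfy `n + 1
    -- ≤ 0 + n₂`.
    · rcases n₁ with _ | n₁
      · obtain ⟨n₂, rfl⟩ : ∃ k, n₂ = k + 1 := ⟨n₂ - 1, by omega⟩
        have := hP.anti h₁ (hv.1.mul_l2Bd hu'.1)
        simpa only [mul_comm] using this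
      · exact hP.anti h₂ (hu.1.mul_l2Bd hv'.1)
    rcases n with _ | n
    · exact ⟨fun _ => trivial, fun _ => trivial⟩
    have hg := fun μ i => (D_mul ((hsu i).mono (m := 1) (by omega))
      ((hsv i).mono (m := 1) (by omega)) μ).symm
    have hs1 := fun i => (hsu i).mono (m := n) (by omega)
    have hs2 := fun i => (hsv i).mono (m := n) (by omega)
    refine ⟨fun k => congr (hg k.succ) (add hP ?_ ?_ ?_ ?_), fun hj => congr (hg 0) (add hP ?_ ?_ ?_ ?_)⟩
    · exact fun i => ((hsu i).D _).mul (hs2 i)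
    · exact fun i => (hs1 i).mul ((hsv i).D _)
    · exact ih (fun i => (hsu i).D _) hs2 (hu.tail k) (hu'.2.1 k) hv (hv'.mono_order (by omega))
        (by omega) (by linarith) (by linarith)
    · exact ih hs1 (fun i => (hsv i).D _) hu (hu'.mono_order (by omega)) (hv.tail k) (hv'.2.1 k)
        (by omega) (by linarith) (by linarith)
    · exact fun i => ((hsu i).D _).mul (hs2 i)
    · exact fun i => (hs1 i).mul ((hsv i).D _)
    · exact ih (fun i => (hsu i).D _) hs2 (hu.tail_time hj) (hu'.2.2 hj) (hv.mono_time (by omega))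
        ((hv'.mono_order (by omega)).mono_time (by omega)) (by omega) (by linarith) (by linarith)
    · exact ih hs1 (fun i => (hsv i).D _) (hu.mono_time (by omega))
        ((hu'.mono_order (by omega)).mono_time (by omega)) (hv.tail_time hj) (hv'.2.2 hj)
        (by omega) (by linarith) (by linarith)

/-- All derivatives of `u` are bounded pointwise here, so the orders need not be shared out. The
intended `u` are the components of the fields in `𝒵`, for which `e = -1`, and their derivatives, for
which `e = 0`. -/
lemma pt_mul_l2 {θ : ι → ℝ} (hsu : ∀ i, Smooth (n - 1) (u i))
    (hsv : ∀ i, Smooth (n - 1) (v i)) (hu : Jet (PtBd fun _ => 1) n j e u)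
    (hv : Jet (L2Bd θ) n j w v) : Jet (L2Bd θ) n j (w + e) fun i p => u i p * v i p := by
  induction n generalizing j e w u v with
  | zero => trivial
  | succ n ih =>
    have hP := boundScale_l2Bd θ
    refine ⟨hu.1.mul_l2Bd hv.1, ?_⟩
    rcases n with _ | n
    · exact ⟨fun _ => trivial, fun _ => trivial⟩
    have hg := fun μ i => (D_mul ((hsu i).mono (m := 1) (by omega))
      ((hsv i).mono (m := 1) (by omega)) μ).symm
    have hs1 := fun i => (hsu i).mono (m := n) (by omega)
    have hs2 := fun i => (hsv i).mono (m := n) (by omega)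
    have e1 : w + (e + 1) = w + e + 1 := by ring
    have e2 : w + 1 + e = w + e + 1 := by ring
    refine ⟨fun k => congr (hg k.succ) (add hP ?_ ?_ ?_ ?_), fun hj => congr (hg 0) (add hP ?_ ?_ ?_ ?_)⟩
    · exact fun i => ((hsu i).D _).mul (hs2 i)
    · exact fun i => (hs1 i).mul ((hsv i).D _)
    · rw [← e1]; exact ih (fun i => (hsu i).D _) hs2 (hu.2.1 k) (hv.mono_order (by omega))
    · rw [← e2]; exact ih hs1 (fun i => (hsv i).D _) (hu.mono_order (by omega)) (hv.2.1 k)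
    · exact fun i => ((hsu i).D _).mul (hs2 i)
    · exact fun i => (hs1 i).mul ((hsv i).D _)
    · rw [← e1]
      exact ih (fun i => (hsu i).D _) hs2 (hu.2.2 hj)
        ((hv.mono_order (by omega)).mono_time (by omega))
    · rw [← e2]
      exact ih hs1 (fun i => (hsv i).D _) ((hu.mono_order (by omega)).mono_time (by omega))
        (hv.2.2 hj)

end Jet

end Jets

end EinsteinNLEM

namespace EinsteinNLEM

/-! ### Composition with smooth functions of the fields -/

section Composition

lemma exists_lipschitz_of_isCompact {β : Type*} [Fintype β] {Φ : (β → ℝ) → ℝ} {V B : Set (β → ℝ)} (hV : IsOpen V)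
    (hΦ : ContDiffOn ℝ 1 Φ V) (hB : IsCompact B) (hconv : Convex ℝ B) (hBV : B ⊆ V) :
    ∃ C : ℝ, 0 ≤ C ∧ ∀ y ∈ B, ∀ y' ∈ B, |Φ y' - Φ y| ≤ C * ‖y' - y‖ := by
  have hc : ContinuousOn (fun y => fderiv ℝ Φ y) B :=
    (hΦ.continuousOn_fderiv_of_isOpen hV le_rfl).mono hBV
  obtain ⟨C, hC⟩ := hB.exists_bound_of_continuousOn hc
  refine ⟨max C 0, le_max_right _ _, fun y hy y' hy' => ?_⟩
  exact hconv.norm_image_sub_le_of_norm_fderiv_le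
    (fun z hz => (hΦ.contDiffAt (hV.mem_nhds (hBV hz))).differentiableAt (by simp))
    (fun z hz => (hC z hz).trans (le_max_left _ _)) hy hy'

variable {β : Type*} [Fintype β]

variable {ι : Type*} {V B : Set (β → ℝ)} {c : β → ℝ} {u : β → ι → Spacetime → ℝ}
  {n m j : ℕ} {e w : ℝ}

lemma BoundScale.comp {P : ℝ → (ι → Space → ℝ) → Prop} (hP : BoundScale P) (hV : IsOpen V)
    (hB : IsCompact B) (hconv : Convex ℝ B) (hBV : B ⊆ V) (hc : c ∈ B)
    (hmem : ∀ i (x : Space), (fun b => u b i (0, x)) ∈ B) {Φ : (β → ℝ) → ℝ}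
    (hΦ : ContDiffOn ℝ 1 Φ V) (hu : ∀ b, P e fun i x => u b i (0, x) - c b) :
    P e fun i x => Φ (fun b => u b i (0, x)) - Φ c := by
  obtain ⟨C, hC, h⟩ := exists_lipschitz_of_isCompact hV hΦ hB hconv hBV
  refine hP.dom (a := fun i x => C * ∑ b, |u b i (0, x) - c b|) (fun i x => ?_)
    (hP.const_mul C (hP.sum fun b _ => hP.abs (hu b)))
  refine (h c hc _ (hmem i x)).trans (le_trans ?_ (le_abs_self _))
  refine mul_le_mul_of_nonneg_left ?_ hC
  refine (pi_norm_le_iff_of_nonneg (Finset.sum_nonneg fun _ _ => abs_nonneg _)).2 fun b => ?_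
  exact Finset.single_le_sum (f := fun b => |u b i (0, x) - c b|) (fun _ _ => abs_nonneg _)
    (Finset.mem_univ b)

lemma D_sub_const {v : Spacetime → ℝ} (hv : Smooth 1 v) (a : ℝ) (μ : Fin 4) :
    GermEq (D μ fun p => v p - a) (D μ v) := fun x => by
  filter_upwards [D_sub hv (Smooth.const a) μ x, D_const a μ x] with p h1 h2
  rw [h1, h2, sub_zero]

variable [DecidableEq β]

/-- Splitting `∂_bΦ(u)` into its value at `c` and a difference produces a term linear in `u - c` and
a product whose coefficient has the original form, with `∂_bΦ` in place of `Φ`. This closes the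
inductions below. -/
lemma D_comp_sub {Φ : (β → ℝ) → ℝ} (hV : IsOpen V) (hΦ : ContDiffOn ℝ 1 Φ V)
    {u : β → Spacetime → ℝ}
    (hu : ∀ b, Smooth 1 (u b)) (hmem : ∀ x : Space, (fun b => u b (0, x)) ∈ V) (μ : Fin 4) :
    GermEq (D μ fun p => Φ (fun b => u b p) - Φ c)
      (fun p => ∑ b, (partialD b Φ c * D μ (fun p => u b p - c b) p
        + (partialD b Φ (fun b => u b p) - partialD b Φ c) * D μ (fun p => u b p - c b) p)) :=
  fun x => by
  have h1 : ∀ᶠ p in 𝓝[half] ((0, x) : Spacetime), ∀ b,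
      D μ (fun p => u b p - c b) p = D μ (u b) p :=
    eventually_all.2 fun b => D_sub_const (hu b) (c b) μ x
  filter_upwards [D_comp hV hΦ hu hmem μ x, h1,
    D_sub_const (Smooth.comp hV hΦ hu hmem) (Φ c) μ x] with p hp hp' hs
  rw [hs, hp]
  refine Finset.sum_congr rfl fun b _ => ?_
  rw [hp' b]; ring

lemma Jet.sum {P : ℝ → (ι → Space → ℝ) → Prop} (hP : BoundScale P) {κ : Type*} {s : Finset κ}
    {v : κ → ι → Spacetime → ℝ} (hs : ∀ b ∈ s, ∀ i, Smooth (n - 1) (v b i))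
    (h : ∀ b ∈ s, Jet P n j e (v b)) : Jet P n j e fun i p => ∑ b ∈ s, v b i p := by
  classical
  induction s using Finset.induction_on with
  | empty => simpa using Jet.zero hP
  | insert b s hb ih =>
    simp only [Finset.sum_insert hb]
    exact Jet.add hP (hs b (by simp)) (fun i => Smooth.sum fun c hc => hs c (by simp [hc]) i)
      (h b (by simp)) (ih (fun c hc => hs c (by simp [hc])) fun c hc => h c (by simp [hc]))

lemma Jet.of_ptBd_le_one {θ : ι → ℝ} (hθ : ∀ i, θ i ≤ 1) {v : ι → Spacetime → ℝ}
    (h : Jet (PtBd θ) n j e v) : Jet (PtBd fun _ => 1) n j e v := by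
  have := h.imp (Q := PtBd fun _ => 1) (s := 0) fun e a ha => by
    simpa using ha.of_le_one hθ
  simpa using this

variable {θ : ι → ℝ}

/-- Order zero is the Lipschitz estimate on the compact convex set `B`. For a first derivative,
`D_comp_sub` leaves the coefficient `∂_bΦ(u) - ∂_bΦ(c)`, to which the induction hypothesis applies
at one order less; `e ≥ 0` ensures that this factor never destroys decay. -/
lemma Jet.comp_pt (hθ : ∀ i, θ i ∈ Set.Icc (0 : ℝ) 1) (hV : IsOpen V)
    (hB : IsCompact B) (hconv : Convex ℝ B) (hBV : B ⊆ V) (hc : c ∈ B)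
    (hmem : ∀ i (x : Space), (fun b => u b i (0, x)) ∈ B) (he : 0 ≤ e)
    (hs : ∀ b i, Smooth (n - 1) (u b i))
    (hu : ∀ b, Jet (PtBd θ) n j e fun i p => u b i p - c b)
    {Φ : (β → ℝ) → ℝ} (hΦ : ContDiffOn ℝ (n : WithTop ℕ∞) Φ V) :
    Jet (PtBd θ) n j e fun i p => Φ (fun b => u b i p) - Φ c := by
  induction n generalizing j Φ with
  | zero => trivial
  | succ n ih =>
    have hP := boundScale_ptBd fun i => (hθ i).1
    have hΦ1 : ContDiffOn ℝ 1 Φ V := hΦ.of_le (by norm_cast; omega)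
    refine ⟨hP.comp hV hB hconv hBV hc hmem hΦ1 fun b => (hu b).1, ?_⟩
    rcases n with _ | n
    · exact ⟨fun _ => trivial, fun _ => trivial⟩
    have hg := fun μ i => (D_comp_sub (c := c) hV hΦ1 (fun b => (hs b i).mono (m := 1) (by omega))
      (fun x => hBV (hmem i x)) μ).symm
    have hd : ∀ b, ContDiffOn ℝ ((n + 1 : ℕ) : WithTop ℕ∞) (partialD b Φ) V :=
      fun b => contDiff_partialD hV hΦ b
    have hs1 : ∀ b i, Smooth n (u b i) := fun b i => (hs b i).mono (by omega)
    have hS : ∀ b i, Smooth n fun p => partialD b Φ (fun b => u b i p) - partialD b Φ c :=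
      fun b i => (Smooth.comp hV ((hd b).of_le (by norm_cast; omega)) (fun b => hs1 b i)
        fun x => hBV (hmem i x)).sub (Smooth.const _)
    have hSu : ∀ μ b i, Smooth n (D μ fun p => u b i p - c b) :=
      fun μ b i => ((hs b i).sub (Smooth.const _)).D μ
    refine ⟨fun k => Jet.congr (hg k.succ) (Jet.sum hP (fun b _ i => ?_) fun b _ => ?_),
      fun hj => Jet.congr (hg 0) (Jet.sum hP (fun b _ i => ?_) fun b _ => ?_)⟩
    · exact ((Smooth.const _).mul (hSu _ b i)).add ((hS b i).mul (hSu _ b i))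
    · refine Jet.add hP (fun i => (Smooth.const _).mul (hSu _ b i))
        (fun i => (hS b i).mul (hSu _ b i)) (Jet.const_mul hP _ (hSu _ b) ((hu b).2.1 k)) ?_
      refine Jet.anti hP (Jet.mul_pt (fun i => (hθ i).1) (hS b) (hSu _ b)
        (Jet.of_ptBd_le_one (fun i => (hθ i).2) (ih hs1 (fun b => (hu b).mono_order (by omega))
          (hd b))) ((hu b).2.1 k)) (by linarith)
    · exact ((Smooth.const _).mul (hSu _ b i)).add ((hS b i).mul (hSu _ b i))
    · refine Jet.add hP (fun i => (Smooth.const _).mul (hSu _ b i))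
        (fun i => (hS b i).mul (hSu _ b i)) (Jet.const_mul hP _ (hSu _ b) ((hu b).2.2 hj)) ?_
      refine Jet.anti hP (Jet.mul_pt (fun i => (hθ i).1) (hS b) (hSu _ b)
        (Jet.of_ptBd_le_one (fun i => (hθ i).2) (ih hs1
          (fun b => ((hu b).mono_order (by omega)).mono_time (by omega))
          (hd b))) ((hu b).2.2 hj)) (by linarith)

/-- The induction is that of `Jet.comp_pt`, but the products are estimated with `Jet.mul_l2`. The
condition `n ≤ 2 * m` says that pointwise control of half of the derivatives is enough, because in
each product at most one factor carries more than half of them. -/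
lemma Jet.comp_l2 (hθ : ∀ i, θ i ∈ Set.Icc (0 : ℝ) 1) (hV : IsOpen V)
    (hB : IsCompact B) (hconv : Convex ℝ B) (hBV : B ⊆ V) (hc : c ∈ B)
    (hmem : ∀ i (x : Space), (fun b => u b i (0, x)) ∈ B) (he : 0 ≤ e)
    (hs : ∀ b i, Smooth (n - 1) (u b i))
    (hu : ∀ b, Jet (PtBd θ) m j e fun i p => u b i p - c b)
    (hu' : ∀ b, Jet (L2Bd θ) n j w fun i p => u b i p - c b) (hnm : n ≤ 2 * m)
    {Φ : (β → ℝ) → ℝ} (hΦ : ContDiffOn ℝ (n : WithTop ℕ∞) Φ V) :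
    Jet (L2Bd θ) n j w fun i p => Φ (fun b => u b i p) - Φ c := by
  induction n generalizing j Φ with
  | zero => trivial
  | succ n ih =>
    have hP := boundScale_l2Bd θ
    have hΦ1 : ContDiffOn ℝ 1 Φ V := hΦ.of_le (by norm_cast; omega)
    refine ⟨hP.comp hV hB hconv hBV hc hmem hΦ1 fun b => (hu' b).1, ?_⟩
    rcases n with _ | n
    · exact ⟨fun _ => trivial, fun _ => trivial⟩
    have hg := fun μ i => (D_comp_sub (c := c) hV hΦ1 (fun b => (hs b i).mono (m := 1) (by omega))
      (fun x => hBV (hmem i x)) μ).symm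
    have hd : ∀ b, ContDiffOn ℝ ((n + 1 : ℕ) : WithTop ℕ∞) (partialD b Φ) V :=
      fun b => contDiff_partialD hV hΦ b
    have hs1 : ∀ b i, Smooth n (u b i) := fun b i => (hs b i).mono (by omega)
    have hS : ∀ b i, Smooth n fun p => partialD b Φ (fun b => u b i p) - partialD b Φ c :=
      fun b i => (Smooth.comp hV ((hd b).of_le (by norm_cast; omega)) (fun b => hs1 b i)
        fun x => hBV (hmem i x)).sub (Smooth.const _)
    have hSu : ∀ μ b i, Smooth n (D μ fun p => u b i p - c b) :=
      fun μ b i => ((hs b i).sub (Smooth.const _)).D μ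
    -- The order is capped at `n + 1` because `∂_bΦ` and the fields are used here with that many
    -- derivatives at most; the product rule below needs `n + 1 ≤ min (n + 1) m + (m - 1)`.
    have hpt : ∀ b, Jet (PtBd θ) (min (n + 1) m) j e
        fun i p => partialD b Φ (fun b => u b i p) - partialD b Φ c := fun b =>
      Jet.comp_pt hθ hV hB hconv hBV hc hmem he (fun b i => (hs b i).mono (by omega))
        (fun b => (hu b).mono_order (by omega)) ((hd b).of_le (by norm_cast; omega))
    have h1 : ∀ i, θ i ≤ 1 := fun i => (hθ i).2
    refine ⟨fun k => Jet.congr (hg k.succ) (Jet.sum hP (fun b _ i => ?_) fun b _ => ?_),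
      fun hj => Jet.congr (hg 0) (Jet.sum hP (fun b _ i => ?_) fun b _ => ?_)⟩
    · exact ((Smooth.const _).mul (hSu _ b i)).add ((hS b i).mul (hSu _ b i))
    · refine Jet.add hP (fun i => (Smooth.const _).mul (hSu _ b i))
        (fun i => (hS b i).mul (hSu _ b i)) (Jet.const_mul hP _ (hSu _ b) ((hu' b).2.1 k)) ?_
      exact Jet.mul_l2 (hS b) (hSu _ b) (Jet.of_ptBd_le_one h1 (hpt b))
        (ih hs1 hu (fun b => (hu' b).mono_order (by omega)) (by omega) (hd b))
        (Jet.of_ptBd_le_one h1 ((hu b).tail k)) ((hu' b).2.1 k)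
        (by omega) (by linarith) (by linarith)
    · exact ((Smooth.const _).mul (hSu _ b i)).add ((hS b i).mul (hSu _ b i))
    · refine Jet.add hP (fun i => (Smooth.const _).mul (hSu _ b i))
        (fun i => (hS b i).mul (hSu _ b i)) (Jet.const_mul hP _ (hSu _ b) ((hu' b).2.2 hj)) ?_
      exact Jet.mul_l2 (hS b) (hSu _ b)
        (Jet.of_ptBd_le_one h1 ((hpt b).mono_time (j' := j - 1) (by omega)))
        (ih hs1 (fun b => (hu b).mono_time (by omega))
          (fun b => ((hu' b).mono_order (by omega)).mono_time (by omega)) (by omega) (hd b))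
        (Jet.of_ptBd_le_one h1 ((hu b).tail_time hj)) ((hu' b).2.2 hj)
        (by omega) (by linarith) (by linarith)

end Composition

/-! ### Families controlled both pointwise and in `L²` -/

section Controlled

variable {ι : Type*}

/-- Families of class `C^r` whose derivatives at `t = 0` of order `< n` are controlled in weighted
`L²` and those of order `< m` pointwise, with at most `j` of the derivatives in the direction of
time. -/
structure Ctl (θ : ι → ℝ) (r n m j : ℕ) (w e : ℝ) (u : ι → Spacetime → ℝ) : Prop where
  smooth : ∀ i, Smooth r (u i)
  l2_order : n ≤ r + 1
  pt_order : m ≤ r + 1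
  pt : Jet (PtBd θ) m j e u
  l2 : Jet (L2Bd θ) n j w u

/-- Families that differ from the constant `c` by a small function that decays like `1 / r`. -/
abbrev Near (θ : ι → ℝ) (r n m j : ℕ) (c : ℝ) (u : ι → Spacetime → ℝ) : Prop :=
  Ctl θ r n m j (-1) 1 fun i p => u i p - c

namespace Ctl

variable {θ : ι → ℝ} {r n m j : ℕ} {w e w' e' w₁ e₁ w₂ e₂ c : ℝ} {u v : ι → Spacetime → ℝ}

lemma congr (h : ∀ i, GermEq (u i) (v i)) (hu : Ctl θ r n m j w e u) : Ctl θ r n m j w e v :=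
  ⟨fun i => (hu.smooth i).congr (h i), hu.2, hu.3, hu.pt.congr h, hu.l2.congr h⟩

lemma mono {r' n' m' j' : ℕ} (hu : Ctl θ r n m j w e u) (hr : r' ≤ r) (hn : n' ≤ n) (hm : m' ≤ m)
    (hj : j' ≤ j) (hn' : n' ≤ r' + 1) (hm' : m' ≤ r' + 1) : Ctl θ r' n' m' j' w e u :=
  ⟨fun i => (hu.smooth i).mono hr, hn', hm', (hu.pt.mono_order hm).mono_time hj,
    (hu.l2.mono_order hn).mono_time hj⟩

lemma mono_time {j' : ℕ} (hu : Ctl θ r n m j w e u) (hj : j' ≤ j) : Ctl θ r n m j' w e u :=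
  hu.mono le_rfl le_rfl le_rfl hj hu.2 hu.3

lemma congr_slice (hv : ∀ i, Smooth r (v i)) (h : ∀ i (x : Space), u i (0, x) = v i (0, x))
    (hu : Ctl θ r n m 0 w e u) : Ctl θ r n m 0 w e v := by
  have h2 := hu.2
  have h3 := hu.3
  exact ⟨hv, h2, h3,
    hu.pt.congr_slice (fun i => (hu.smooth i).mono (by omega)) (fun i => (hv i).mono (by omega)) h,
    hu.l2.congr_slice (fun i => (hu.smooth i).mono (by omega)) (fun i => (hv i).mono (by omega)) h⟩

lemma D_succ (hu : Ctl θ (r + 1) n m j w e u) (k : Fin 3) :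
    Ctl θ r (n - 1) (m - 1) j (w + 1) (e + 1) fun i => D k.succ (u i) := by
  have h2 := hu.2
  have h3 := hu.3
  exact ⟨fun i => (hu.smooth i).D _, by omega, by omega, hu.pt.tail k, hu.l2.tail k⟩

lemma D_zero (hu : Ctl θ (r + 1) n m (j + 1) w e u) :
    Ctl θ r (n - 1) (m - 1) j (w + 1) (e + 1) fun i => D 0 (u i) := by
  have h2 := hu.2
  have h3 := hu.3
  exact ⟨fun i => (hu.smooth i).D _, by omega, by omega, hu.pt.tail_time (by omega),
    hu.l2.tail_time (by omega)⟩

lemma of_D (hs : ∀ i, Smooth (r + 1) (u i)) (hpt : PtBd θ e fun i x => u i (0, x))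
    (hl2 : L2Bd θ w fun i x => u i (0, x))
    (h : ∀ k : Fin 3, Ctl θ r n m j (w + 1) (e + 1) fun i => D k.succ (u i))
    (h0 : 1 ≤ j → Ctl θ r n m (j - 1) (w + 1) (e + 1) fun i => D 0 (u i)) :
    Ctl θ (r + 1) (n + 1) (m + 1) j w e u := by
  have h2 := (h 0).2
  have h3 := (h 0).3
  exact ⟨hs, by omega, by omega, ⟨hpt, fun k => (h k).pt, fun hj => (h0 hj).pt⟩,
    ⟨hl2, fun k => (h k).l2, fun hj => (h0 hj).l2⟩⟩

lemma of_time (hu : Ctl θ (r + 1) n m j w e u)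
    (h : Ctl θ r (n - 1) (m - 1) j (w + 1) (e + 1) fun i => D 0 (u i)) :
    Ctl θ (r + 1) n m (j + 1) w e u := by
  have h2 := hu.2
  have h3 := hu.3
  exact ⟨hu.smooth, h2, h3, hu.pt.of_time (fun i => (hu.smooth i).mono (by omega)) h.pt,
    hu.l2.of_time (fun i => (hu.smooth i).mono (by omega)) h.l2⟩

variable (hθ : ∀ i, θ i ∈ Set.Icc (0 : ℝ) 1)
include hθ

lemma anti (hu : Ctl θ r n m j w e u) (hw : w' ≤ w) (he : e' ≤ e) : Ctl θ r n m j w' e' u :=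
  ⟨hu.smooth, hu.2, hu.3, hu.pt.anti (boundScale_ptBd fun i => (hθ i).1) he,
    hu.l2.anti (boundScale_l2Bd θ) hw⟩

lemma zero (hn : n ≤ r + 1) (hm : m ≤ r + 1) : Ctl θ r n m j w e fun _ _ => 0 :=
  ⟨fun _ => Smooth.const 0, hn, hm, Jet.zero (boundScale_ptBd fun i => (hθ i).1),
    Jet.zero (boundScale_l2Bd θ)⟩

lemma add (hu : Ctl θ r n m j w e u) (hv : Ctl θ r n m j w e v) :
    Ctl θ r n m j w e fun i p => u i p + v i p := by
  have h2 := hu.2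
  have h3 := hu.3
  exact ⟨fun i => (hu.smooth i).add (hv.smooth i), h2, h3,
    hu.pt.add (boundScale_ptBd fun i => (hθ i).1) (fun i => (hu.smooth i).mono (by omega))
      (fun i => (hv.smooth i).mono (by omega)) hv.pt,
    hu.l2.add (boundScale_l2Bd θ) (fun i => (hu.smooth i).mono (by omega))
      (fun i => (hv.smooth i).mono (by omega)) hv.l2⟩

lemma const_mul (a : ℝ) (hu : Ctl θ r n m j w e u) :
    Ctl θ r n m j w e fun i p => a * u i p := by
  have h2 := hu.2
  have h3 := hu.3
  exact ⟨fun i => (Smooth.const a).mul (hu.smooth i), h2, h3,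
    hu.pt.const_mul (boundScale_ptBd fun i => (hθ i).1) a (fun i => (hu.smooth i).mono (by omega)),
    hu.l2.const_mul (boundScale_l2Bd θ) a (fun i => (hu.smooth i).mono (by omega))⟩

lemma neg (hu : Ctl θ r n m j w e u) : Ctl θ r n m j w e fun i p => -u i p :=
  (hu.const_mul hθ (-1)).congr fun i => GermEq.of_eq fun p => by ring

lemma sub (hu : Ctl θ r n m j w e u) (hv : Ctl θ r n m j w e v) :
    Ctl θ r n m j w e fun i p => u i p - v i p :=
  (hu.add hθ (hv.neg hθ)).congr fun i => GermEq.of_eq fun p => by ring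

lemma sum {β : Type*} {s : Finset β} {u : β → ι → Spacetime → ℝ} (hn : n ≤ r + 1) (hm : m ≤ r + 1)
    (h : ∀ b ∈ s, Ctl θ r n m j w e (u b)) :
    Ctl θ r n m j w e fun i p => ∑ b ∈ s, u b i p := by
  classical
  induction s using Finset.induction_on with
  | empty => simpa using zero hθ hn hm
  | insert b s hb ih =>
    simp only [Finset.sum_insert hb]
    exact (h b (by simp)).add hθ (ih fun c hc => h c (by simp [hc]))

lemma mul (hu : Ctl θ r n m j w₁ e₁ u) (hv : Ctl θ r n m j w₂ e₂ v) (hnm : n ≤ 2 * m)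
    (h₁ : w ≤ w₁ + e₂) (h₂ : w ≤ w₂ + e₁) (he : e ≤ e₁ + e₂) :
    Ctl θ r n m j w e fun i p => u i p * v i p := by
  have h2 := hu.2
  have h3 := hu.3
  have hP := boundScale_ptBd fun i => (hθ i).1
  have hle := fun i => (hθ i).2
  exact ⟨fun i => (hu.smooth i).mul (hv.smooth i), h2, h3,
    (Jet.mul_pt (fun i => (hθ i).1) (fun i => (hu.smooth i).mono (by omega))
      (fun i => (hv.smooth i).mono (by omega)) (hu.pt.of_ptBd_le_one hle) hv.pt).anti hP he,
    Jet.mul_l2 (fun i => (hu.smooth i).mono (by omega))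
      (fun i => (hv.smooth i).mono (by omega)) (hu.pt.of_ptBd_le_one hle) hu.l2
      (hv.pt.of_ptBd_le_one hle) hv.l2 (by omega) h₁ h₂⟩

/-- From `u v = c v + (u - c) v`: a coefficient close to a constant preserves the class of `v`. When
`u - c` carries the many derivatives, it is only in `L²` with weight `-1`, and the condition `w + 1
≤ e` lets the decay of `v` make up for this. -/
lemma near_mul (hu : Near θ r n m j c u) (hv : Ctl θ r n m j w e v) (hnm : n ≤ 2 * m)
    (hw : w + 1 ≤ e) : Ctl θ r n m j w e fun i p => u i p * v i p :=
  ((hv.const_mul hθ c).add hθ (hu.mul hθ hv hnm (w := w) (e := e) (by linarith) (by linarith)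
    (by linarith))).congr fun i => GermEq.of_eq fun p => by ring

lemma comp {β : Type*} [Fintype β] {V B : Set (β → ℝ)} {c : β → ℝ} {u : β → ι → Spacetime → ℝ}
    {k : ℕ} (hV : IsOpen V) (hB : IsCompact B) (hconv : Convex ℝ B) (hBV : B ⊆ V) (hc : c ∈ B)
    (hmem : ∀ i (x : Space), (fun b => u b i (0, x)) ∈ B) (he : 0 ≤ e)
    (hu : ∀ b, Ctl θ r n m j w e fun i p => u b i p - c b) (hnm : n ≤ 2 * m)
    (hn : n ≤ r + 1) (hm : m ≤ r + 1)
    (hnk : n ≤ k) (hmk : m ≤ k) (hrk : r ≤ k)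
    {Φ : (β → ℝ) → ℝ} (hΦ : ContDiffOn ℝ (k : WithTop ℕ∞) Φ V) :
    Ctl θ r n m j w e fun i p => Φ (fun b => u b i p) - Φ c := by
  classical
  have hs : ∀ b i, Smooth r (u b i) := fun b i =>
    (((hu b).smooth i).add (Smooth.const (c b))).congr (GermEq.of_eq fun p => by ring)
  exact ⟨fun i => (Smooth.comp hV (hΦ.of_le (by exact_mod_cast hrk)) (fun b => hs b i)
      fun x => hBV (hmem i x)).sub (Smooth.const _), hn, hm,
    Jet.comp_pt hθ hV hB hconv hBV hc hmem he (fun b i => (hs b i).mono (by omega))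
      (fun b => (hu b).pt) (hΦ.of_le (by exact_mod_cast hmk)),
    Jet.comp_l2 hθ hV hB hconv hBV hc hmem he (fun b i => (hs b i).mono (by omega))
      (fun b => (hu b).pt) (fun b => (hu b).l2) hnm
      (hΦ.of_le (by exact_mod_cast hnk))⟩

end Ctl

end Controlled

end EinsteinNLEM

namespace EinsteinNLEM

/-! ### A weighted Sobolev inequality by integration from infinity -/

section Sobolev

lemma enorm_le_lintegral_of_tendsto_atTop {f : ℝ → ℝ} (hf : ContDiff ℝ 1 f)
    (h0 : Tendsto f atTop (𝓝 0)) (a : ℝ) : ‖f a‖ₑ ≤ ∫⁻ s in Set.Ici a, ‖deriv f s‖ₑ := by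
  have h1 : Tendsto (fun b => ‖f b - f a‖ₑ) atTop (𝓝 ‖(0 : ℝ) - f a‖ₑ) :=
    (continuous_enorm.tendsto _).comp (h0.sub_const (f a))
  rw [zero_sub, enorm_neg] at h1
  refine le_of_tendsto h1 ?_
  filter_upwards [eventually_ge_atTop a] with b hb
  exact (enorm_sub_le_lintegral_deriv_of_contDiffOn_Icc hf.contDiffOn hb).trans
    (lintegral_mono_set Set.Icc_subset_Ici_self)

lemma enorm_le_lintegral_of_tendsto_atBot {f : ℝ → ℝ} (hf : ContDiff ℝ 1 f)
    (h0 : Tendsto f atBot (𝓝 0)) (a : ℝ) : ‖f a‖ₑ ≤ ∫⁻ s in Set.Iic a, ‖deriv f s‖ₑ := by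
  have h1 : Tendsto (fun b => ‖f a - f b‖ₑ) atBot (𝓝 ‖f a - (0 : ℝ)‖ₑ) :=
    (continuous_enorm.tendsto _).comp (h0.const_sub (f a))
  rw [sub_zero] at h1
  refine le_of_tendsto h1 ?_
  filter_upwards [eventually_le_atBot a] with b hb
  exact (enorm_sub_le_lintegral_deriv_of_contDiffOn_Icc hf.contDiffOn hb).trans
    (lintegral_mono_set Set.Icc_subset_Iic_self)

/-- The fundamental theorem of calculus is applied on the half-line that leads from `a` away from
the origin. -/
lemma enorm_le_lintegral_outward {f : ℝ → ℝ} (hf : ContDiff ℝ 1 f)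
    (h0 : Tendsto f (cocompact ℝ) (𝓝 0)) (a : ℝ) :
    ‖f a‖ₑ ≤ ∫⁻ s in {s | |a| ≤ |s|}, ‖deriv f s‖ₑ := by
  rw [cocompact_eq_atBot_atTop] at h0
  rcases le_total 0 a with ha | ha
  · refine (enorm_le_lintegral_of_tendsto_atTop hf (h0.mono_left le_sup_right) a).trans
      (lintegral_mono_set fun s hs => ?_)
    exact abs_le_abs_of_nonneg ha hs
  · refine (enorm_le_lintegral_of_tendsto_atBot hf (h0.mono_left le_sup_left) a).trans
      (lintegral_mono_set fun s hs => ?_)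
    exact abs_le_abs_of_nonpos ha hs

/-- The point of `ℝ³` with the given coordinates. -/
noncomputable abbrev pt (y : Fin 3 → ℝ) : Space := WithLp.toLp 2 y

lemma continuous_pt : Continuous pt := PiLp.continuous_toLp 2 _

lemma enorm_le_lintegral_sd {f : Space → ℝ} (hf : ContDiff ℝ 1 f)
    (h0 : Tendsto f (cocompact Space) (𝓝 0)) (i : Fin 3) (y : Fin 3 → ℝ) :
    ‖f (pt y)‖ₑ ≤ ∫⁻ s in {s | |y i| ≤ |s|}, ‖sd i f (pt (Function.update y i s))‖ₑ := by
  have hline : ∀ s, pt (Function.update y i s)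
      = pt (Function.update y i 0) + s • EuclideanSpace.single i (1 : ℝ) := by
    intro s
    ext k
    by_cases hk : k = i
    · subst hk; simp
    · simp [hk]
  have hd : ∀ s, HasDerivAt (fun s => f (pt (Function.update y i s)))
      (sd i f (pt (Function.update y i s))) s := by
    intro s
    have h1 : HasDerivAt (fun s : ℝ => pt (Function.update y i s))
        (EuclideanSpace.single i (1 : ℝ)) s := by
      rw [funext hline]
      simpa using ((hasDerivAt_id s).smul_const (EuclideanSpace.single i (1 : ℝ))).const_add
        (pt (Function.update y i 0))
    exact ((hf.differentiable (by simp) _).hasFDerivAt).comp_hasDerivAt s h1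
  have hc : ContDiff ℝ 1 fun s => f (pt (Function.update y i s)) := by
    refine hf.comp ?_
    rw [funext hline]
    fun_prop
  have hco : Tendsto (fun s => pt (Function.update y i s)) (cocompact ℝ) (cocompact Space) := by
    refine tendsto_cocompact_of_tendsto_dist_comp_atTop (0 : Space) ?_
    refine tendsto_atTop_mono (f := fun s : ℝ => ‖s‖) (fun s => ?_) (tendsto_norm_cocompact_atTop)
    rw [dist_zero_right]
    simpa using PiLp.norm_apply_le (pt (Function.update y i s)) i
  have := enorm_le_lintegral_outward hc (h0.comp hco) (y i)
  simp only [Function.update_eq_self, (hd _).deriv] at this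
  exact this

/-- Integrating outward along the three axes in turn bounds `f x` by the integral of one mixed third
derivative over the octant-like set `|x_i| ≤ |z_i|`. This set lies outside the ball of radius `‖x‖`,
and that is the source of the decay. -/
lemma enorm_le_lintegral_three {f : Space → ℝ} (hf : ContDiff ℝ 3 f)
    (h0 : Tendsto f (cocompact Space) (𝓝 0)) (h1 : Tendsto (sd 0 f) (cocompact Space) (𝓝 0))
    (h2 : Tendsto (sd 1 (sd 0 f)) (cocompact Space) (𝓝 0)) (x : Space) :
    ‖f x‖ₑ ≤ ∫⁻ y in {y : Space | ‖x‖ ≤ ‖y‖}, ‖sd 2 (sd 1 (sd 0 f)) y‖ₑ := by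
  have c1 : ContDiff ℝ 2 (sd 0 f) := contDiff_sd (n := 2) hf 0
  have c2 : ContDiff ℝ 1 (sd 1 (sd 0 f)) := contDiff_sd (n := 1) c1 1
  have c3 : ContDiff ℝ 0 (sd 2 (sd 1 (sd 0 f))) := contDiff_sd (n := 0) c2 2
  set g := sd 2 (sd 1 (sd 0 f)) with hg
  set y : Fin 3 → ℝ := x.ofLp with hy
  set A : Set (Fin 3 → ℝ) := {z | ∀ i, |y i| ≤ |z i|} with hA
  have hAm : MeasurableSet A := by
    have : A = ⋂ i, {z : Fin 3 → ℝ | |y i| ≤ |z i|} := by ext z; simp [hA]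
    rw [this]
    exact MeasurableSet.iInter fun i => measurableSet_le measurable_const (by fun_prop)
  set G : (Fin 3 → ℝ) → ℝ≥0∞ := A.indicator fun z => ‖g (pt z)‖ₑ with hG
  have hGm : Measurable G :=
    ((c3.continuous.comp continuous_pt).enorm.measurable).indicator hAm
  have key : ‖f x‖ₑ ≤ ∫⁻ z, G z := by
    have e : ∫⁻ z, G z = ∫⁻ s₀, ∫⁻ s₁, ∫⁻ s₂, G (Function.update (Function.update
        (Function.update y 0 s₀) 1 s₁) 2 s₂) := by
      rw [volume_pi, lintegral_eq_lmarginal_univ y, lmarginal_erase _ hGm (Finset.mem_univ 0)]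
      refine lintegral_congr fun s₀ => ?_
      rw [lmarginal_erase _ hGm (i := 1) (by decide)]
      refine lintegral_congr fun s₁ => ?_
      rw [lmarginal_erase _ hGm (i := 2) (by decide)]
      refine lintegral_congr fun s₂ => ?_
      have : ((Finset.univ.erase (0 : Fin 3)).erase 1).erase 2 = ∅ := by decide
      rw [this, lmarginal_empty]
    rw [e]
    have m : ∀ a : ℝ, MeasurableSet {s : ℝ | |a| ≤ |s|} := fun a =>
      measurableSet_le measurable_const (by fun_prop)
    refine (enorm_le_lintegral_sd (hf.of_le (by norm_num)) h0 0 y).trans ?_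
    rw [← lintegral_indicator (m _)]
    refine lintegral_mono fun s₀ => ?_
    by_cases hs₀ : |y 0| ≤ |s₀|
    swap
    · rw [Set.indicator_of_notMem (by simpa using hs₀)]; exact zero_le
    rw [Set.indicator_of_mem (by simpa using hs₀)]
    refine (enorm_le_lintegral_sd (c1.of_le (by norm_num)) h1 1 _).trans ?_
    rw [← lintegral_indicator (m _)]
    refine lintegral_mono fun s₁ => ?_
    by_cases hs₁ : |y 1| ≤ |s₁|
    swap
    · rw [Set.indicator_of_notMem (by simpa using hs₁)]; exact zero_le
    rw [Set.indicator_of_mem (by simpa using hs₁)]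
    refine (enorm_le_lintegral_sd c2 h2 2 _).trans ?_
    rw [← lintegral_indicator (m _)]
    refine lintegral_mono fun s₂ => ?_
    by_cases hs₂ : |y 2| ≤ |s₂|
    swap
    · rw [Set.indicator_of_notMem (by simpa using hs₂)]; exact zero_le
    rw [Set.indicator_of_mem (by simpa using hs₂), hG, Set.indicator_of_mem]
    intro i
    fin_cases i
    · simpa using hs₀
    · simpa using hs₁
    · simpa using hs₂
  refine key.trans ?_
  have hR : MeasurableSet {z : Space | ‖x‖ ≤ ‖z‖} :=
    measurableSet_le measurable_const measurable_norm
  rw [← lintegral_indicator hR,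
    ← (PiLp.volume_preserving_toLp (Fin 3)).lintegral_comp
      (c3.continuous.enorm.measurable.indicator hR)]
  refine lintegral_mono fun z => ?_
  simp only [hG]
  by_cases hz : z ∈ A
  swap
  · rw [Set.indicator_of_notMem hz]; exact zero_le
  rw [Set.indicator_of_mem hz, Set.indicator_of_mem]
  rw [Set.mem_ofPred_eq, EuclideanSpace.norm_eq, EuclideanSpace.norm_eq]
  refine Real.sqrt_le_sqrt (Finset.sum_le_sum fun i _ => ?_)
  exact pow_le_pow_left₀ (norm_nonneg _) (by simpa using hz i) 2

/-- The Cauchy–Schwarz inequality in `enorm_le_lintegral_three`, with the weight of the norm and its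
inverse. The constant depends on `γ` alone, not on `k`, on `f` or on the number of derivatives
available. -/
lemma exists_weighted_sobolev {γ : ℝ} (hγ : 0 < γ) :
    ∃ C : ℝ, 0 ≤ C ∧ ∀ (k : ℝ), 0 ≤ k → ∀ (f : Space → ℝ) (S : ℝ), 0 ≤ S → ContDiff ℝ 3 f →
      Tendsto f (cocompact Space) (𝓝 0) → Tendsto (sd 0 f) (cocompact Space) (𝓝 0) →
      Tendsto (sd 1 (sd 0 f)) (cocompact Space) (𝓝 0) →
      ∫⁻ y, ENNReal.ofReal ((jp y ^ (1 / 2 + γ + k + 3) * sd 2 (sd 1 (sd 0 f)) y) ^ 2)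
        ≤ ENNReal.ofReal (S ^ 2) →
      ∀ x, |f x| ≤ C * S * jp x ^ (-(2 + k)) := by
  set I := ∫⁻ x : Space, ENNReal.ofReal (jp x ^ (-(3 + 2 * γ))) with hI
  have hfin : I < ∞ := lintegral_jp_lt_top (by linarith)
  refine ⟨Real.sqrt I.toReal, Real.sqrt_nonneg _, fun k hk f S hS hf h0 h1 h2 hint x => ?_⟩
  have c3 : ContDiff ℝ 0 (sd 2 (sd 1 (sd 0 f))) :=
    contDiff_sd (n := 0) (contDiff_sd (n := 1) (contDiff_sd (n := 2) hf 0) 1) 2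
  set g := sd 2 (sd 1 (sd 0 f)) with hg
  -- The exponent splits as `2a = 2(2 + k) + (3 + 2γ)`: outside the ball the first part is bounded
  -- by its value at `x`, and the second is integrable on `ℝ³`.
  set a := 1 / 2 + γ + k + 3 with ha
  have hR : MeasurableSet {z : Space | ‖x‖ ≤ ‖z‖} :=
    measurableSet_le measurable_const measurable_norm
  have hm1 : Measurable fun y : Space => ENNReal.ofReal |jp y ^ a * g y| :=
    (((continuous_jp_rpow a).mul c3.continuous).abs.measurable).ennreal_ofReal
  have hm2 : Measurable fun y : Space => ENNReal.ofReal (jp y ^ (-a)) :=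
    (continuous_jp_rpow (-a)).measurable.ennreal_ofReal
  have e1 := enorm_le_lintegral_three hf h0 h1 h2 x
  have e2 : ∫⁻ y in {y : Space | ‖x‖ ≤ ‖y‖}, ‖g y‖ₑ
      = ∫⁻ y in {y : Space | ‖x‖ ≤ ‖y‖}, ((fun y => ENNReal.ofReal |jp y ^ a * g y|) *
        fun y => ENNReal.ofReal (jp y ^ (-a))) y := by
    refine lintegral_congr fun y => ?_
    have hp := jp_rpow_pos y a
    rw [Pi.mul_apply, ← ENNReal.ofReal_mul (abs_nonneg _), abs_mul, abs_of_pos hp,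
      Real.rpow_neg (jp_pos y).le, Real.enorm_eq_ofReal_abs]
    congr 1
    field_simp
  have e3 := ENNReal.lintegral_mul_le_Lp_mul_Lq (volume.restrict {y : Space | ‖x‖ ≤ ‖y‖})
    (p := 2) (q := 2) (by constructor <;> norm_num) hm1.aemeasurable hm2.aemeasurable
  have e4 : ∫⁻ y in {y : Space | ‖x‖ ≤ ‖y‖}, ENNReal.ofReal |jp y ^ a * g y| ^ (2 : ℝ)
      ≤ ENNReal.ofReal (S ^ 2) := by
    refine (setLIntegral_le_lintegral _ _).trans (le_trans (lintegral_mono fun y => ?_) hint)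
    rw [ENNReal.ofReal_rpow_of_nonneg (abs_nonneg _) (by norm_num), Real.rpow_two, sq_abs]
  have e5 : ∫⁻ y in {y : Space | ‖x‖ ≤ ‖y‖}, ENNReal.ofReal (jp y ^ (-a)) ^ (2 : ℝ)
      ≤ ENNReal.ofReal ((jp x ^ (-(2 + k))) ^ 2 * I.toReal) := by
    calc ∫⁻ y in {y : Space | ‖x‖ ≤ ‖y‖}, ENNReal.ofReal (jp y ^ (-a)) ^ (2 : ℝ)
        ≤ ∫⁻ y in {y : Space | ‖x‖ ≤ ‖y‖}, ENNReal.ofReal ((jp x ^ (-(2 + k))) ^ 2) *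
            ENNReal.ofReal (jp y ^ (-(3 + 2 * γ))) := by
          refine setLIntegral_mono_ae
            ((continuous_jp_rpow _).measurable.ennreal_ofReal.const_mul _).aemeasurable
            (Eventually.of_forall fun y hy => ?_)
          rw [ENNReal.ofReal_rpow_of_nonneg (jp_rpow_pos _ _).le (by norm_num),
            ← ENNReal.ofReal_mul (by positivity)]
          refine ENNReal.ofReal_le_ofReal ?_
          have hxy : jp x ≤ jp y := Real.sqrt_le_sqrt (by
            have : ‖x‖ ≤ ‖y‖ := hy
            gcongr)
          have hle : jp y ^ (-(2 + k)) ≤ jp x ^ (-(2 + k)) :=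
            Real.rpow_le_rpow_of_nonpos (jp_pos x) hxy (by linarith)
          have heq : (jp y ^ (-a)) ^ (2 : ℝ)
              = (jp y ^ (-(2 + k))) ^ 2 * jp y ^ (-(3 + 2 * γ)) := by
            rw [← Real.rpow_natCast (jp y ^ (-(2 + k))), ← Real.rpow_mul (jp_pos y).le,
              ← Real.rpow_mul (jp_pos y).le, ← Real.rpow_add (jp_pos y)]
            congr 1
            simp only [ha]; push_cast; ring
          rw [heq]
          have := (jp_rpow_pos y (-(3 + 2 * γ))).le
          have := (jp_rpow_pos y (-(2 + k))).le
          gcongr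
      _ ≤ ENNReal.ofReal ((jp x ^ (-(2 + k))) ^ 2) * I := by
          rw [lintegral_const_mul' _ _ (by simp)]
          gcongr
          exact setLIntegral_le_lintegral _ _
      _ = _ := by rw [ENNReal.ofReal_mul (by positivity), ENNReal.ofReal_toReal hfin.ne]
  have e6 : ‖f x‖ₑ ≤ ENNReal.ofReal (S ^ 2) ^ (1 / 2 : ℝ) *
      ENNReal.ofReal ((jp x ^ (-(2 + k))) ^ 2 * I.toReal) ^ (1 / 2 : ℝ) := by
    rw [e2] at e1
    refine e1.trans (e3.trans ?_)
    gcongr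
  rw [ENNReal.ofReal_rpow_of_nonneg (by positivity) (by norm_num),
    ENNReal.ofReal_rpow_of_nonneg (by positivity) (by norm_num),
    ← ENNReal.ofReal_mul (by positivity), Real.enorm_eq_ofReal_abs,
    ENNReal.ofReal_le_ofReal_iff (by positivity), ← Real.sqrt_eq_rpow, ← Real.sqrt_eq_rpow,
    Real.sqrt_sq hS, Real.sqrt_mul (by positivity), Real.sqrt_sq (jp_rpow_pos _ _).le] at e6
  linarith

end Sobolev

end EinsteinNLEM

namespace EinsteinNLEM

/-! ### Static extensions of data and of explicit profiles -/

section StaticFamilies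

variable {ι : Type*} {P : ℝ → (ι → Space → ℝ) → Prop}

lemma sdList_append (I : List (Fin 3)) (k : Fin 3) (f : Space → ℝ) :
    sdList (I ++ [k]) f = sdList I (sd k f) := by
  induction I with
  | nil => rfl
  | cons a I ih => simp only [List.cons_append, sdList, ih]

lemma contDiff_sdList {n m : ℕ} {f : Space → ℝ} (I : List (Fin 3))
    (hf : ContDiff ℝ (n : WithTop ℕ∞) f) (h : m + I.length ≤ n) :
    ContDiff ℝ (m : WithTop ℕ∞) (sdList I f) := by
  induction I generalizing m with
  | nil => exact hf.of_le (by exact_mod_cast (by simpa using h))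
  | cons a I ih => exact contDiff_sd (ih (by simp at h; omega)) a

lemma jet_lift (hP : BoundScale P) {n j : ℕ} {e : ℝ} {f : ι → Space → ℝ}
    (hf : ∀ i, ContDiff ℝ ((n - 1 : ℕ) : WithTop ℕ∞) (f i))
    (h : ∀ I : List (Fin 3), I.length < n → P (e + I.length) fun i => sdList I (f i)) :
    Jet P n j e fun i => lift (f i) := by
  induction n generalizing e j f with
  | zero => trivial
  | succ n ih =>
    refine ⟨by simpa [lift, sdList] using h [] (by simp), ?_⟩
    rcases n with _ | n
    · exact ⟨fun _ => trivial, fun _ => trivial⟩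
    have hf1 : ∀ i, ContDiff ℝ 1 (f i) := fun i => (hf i).of_le (by norm_cast; omega)
    refine ⟨fun k => Jet.congr (fun i => (D_succ_lift (hf1 i) k).symm) (ih ?_ ?_),
      fun _ => Jet.congr (fun i => (D_zero_lift (hf1 i)).symm) (Jet.zero hP)⟩
    · exact fun i => contDiff_sd (hf i) k
    · intro I hI
      have := h (I ++ [k]) (by simpa using hI)
      simp only [sdList_append, List.length_append, List.length_singleton] at this
      convert! this using 1
      push_cast; ring

/-- The tails of data that are bounded by `θ i` in a weighted Sobolev space. -/
lemma exists_pointwise_bound {γ : ℝ} (hγ : 0 < γ) :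
    ∃ C : ℝ, 0 ≤ C ∧ ∀ (N : ℕ) (f : Space → ℝ) (S : ℝ), 0 ≤ S →
      ContDiff ℝ (N : WithTop ℕ∞) f →
      (∀ I : List (Fin 3), I.length < N → Tendsto (sdList I f) (cocompact Space) (𝓝 0)) →
      (∀ I : List (Fin 3), I.length ≤ N →
        ∫⁻ y, ENNReal.ofReal ((jp y ^ (1 / 2 + γ + I.length) * sdList I f y) ^ 2)
          ≤ ENNReal.ofReal (S ^ 2)) →
      ∀ I : List (Fin 3), I.length + 3 ≤ N →
        ∀ x, |sdList I f x| ≤ C * S * jp x ^ (-(2 + (I.length : ℝ))) := by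
  obtain ⟨C, hC, h⟩ := exists_weighted_sobolev hγ
  refine ⟨C, hC, fun N f S hS hf hd hi I hI x => ?_⟩
  refine h I.length (by positivity) (sdList I f) S hS
    (contDiff_sdList (m := 3) I hf (by omega)) (hd I (by omega))
    (hd (0 :: I) (by simp; omega)) (hd (1 :: 0 :: I) (by simp; omega)) ?_ x
  have := hi (2 :: 1 :: 0 :: I) (by simp; omega)
  simp only [List.length_cons, sdList] at this
  push_cast at this
  rw [show 1 / 2 + γ + (I.length : ℝ) + 3 = 1 / 2 + γ + ((I.length : ℝ) + 1 + 1 + 1) by ring]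
  exact this

/-- The `L²` bounds are those of the norm. The pointwise ones stop at order `N - 3`, since the
Sobolev inequality consumes three derivatives. -/
lemma ctl_lift_of_sobolev {γ : ℝ} (hγ : 0 < γ) {θ : ι → ℝ} (hθ : ∀ i, 0 ≤ θ i) {N : ℕ}
    (hN : 3 ≤ N) {f : ι → Space → ℝ} (hf : ∀ i, ContDiff ℝ (N : WithTop ℕ∞) (f i))
    (hd : ∀ i, ∀ I : List (Fin 3), I.length < N →
      Tendsto (sdList I (f i)) (cocompact Space) (𝓝 0))
    (hi : ∀ i, ∀ I : List (Fin 3), I.length ≤ N →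
        ∫⁻ y, ENNReal.ofReal ((jp y ^ (1 / 2 + γ + I.length) * sdList I (f i) y) ^ 2)
          ≤ ENNReal.ofReal (θ i ^ 2)) :
    Ctl θ N (N + 1) (N - 2) 0 (1 / 2 + γ) 2 fun i => lift (f i) := by
  obtain ⟨C, hC, h⟩ := exists_pointwise_bound hγ
  refine ⟨fun i => smooth_lift (hf i), le_rfl, by omega, ?_, ?_⟩
  · refine jet_lift (boundScale_ptBd hθ) (fun i => (hf i).of_le (by norm_cast; omega))
      fun I hI => ⟨C, hC, fun i x => h N (f i) (θ i) (hθ i) (hf i) (hd i) (hi i) I (by omega) x⟩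
  · refine jet_lift (boundScale_l2Bd θ) (fun i => (hf i).of_le (by norm_cast))
      fun I hI => ⟨1, zero_le_one, fun i x => |sdList I (f i) x|, fun i => ⟨?_, fun x => le_rfl, ?_⟩⟩
    · exact (contDiff_sdList (m := 0) I (hf i) (by omega)).continuous.abs.measurable
    · refine (le_of_eq (lintegral_congr fun x => ?_)).trans ((hi i I (by omega)).trans (by simp))
      rw [mul_pow, sq_abs, mul_pow]

/-- Functions whose derivatives gain one power of decay each. -/
structure IsSymbol (e : ℝ) (f : Space → ℝ) : Prop where
  smooth : ∀ n : ℕ, ContDiff ℝ (n : WithTop ℕ∞) f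
  bound : ∀ I : List (Fin 3), ∃ C : ℝ, 0 ≤ C ∧
    ∀ x, |sdList I f x| ≤ C * jp x ^ (-(e + (I.length : ℝ)))

lemma IsSymbol.sd {e : ℝ} {f : Space → ℝ} (hf : IsSymbol e f) (k : Fin 3) :
    IsSymbol (e + 1) (sd k f) where
  smooth n := contDiff_sd (hf.smooth (n + 1)) k
  bound I := by
    obtain ⟨C, hC, h⟩ := hf.bound (I ++ [k])
    refine ⟨C, hC, fun x => ?_⟩
    have := h x
    simp only [sdList_append, List.length_append, List.length_singleton] at this
    convert this using 3
    push_cast; ring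

lemma sdList_const_mul {n : ℕ} (c : ℝ) {f : Space → ℝ} (hf : ContDiff ℝ (n : WithTop ℕ∞) f)
    (I : List (Fin 3)) (hI : I.length ≤ n) (x : Space) :
    sdList I (fun y => c * f y) x = c * sdList I f x := by
  induction I generalizing x with
  | nil => rfl
  | cons k I ih =>
    simp only [List.length_cons] at hI
    have h1 : sdList I (fun y => c * f y) = fun y => c * sdList I f y :=
      funext fun y => ih (by omega) y
    have h2 : DifferentiableAt ℝ (sdList I f) x :=
      (contDiff_sdList (m := 1) I hf (by omega)).differentiable (by simp) x
    simp only [sdList, h1, sd]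
    rw [fderiv_const_mul h2]
    simp

lemma IsSymbol.ctl {θ c : ι → ℝ} {A : ℝ} (hθ : ∀ i, 0 ≤ θ i) (hA : 0 ≤ A)
    (hc : ∀ i, |c i| ≤ A * θ i) {e w : ℝ} {f : Space → ℝ} (hf : IsSymbol e f)
    (hw : w + 3 / 2 < e) {r n m j : ℕ} (hn : n ≤ r + 1) (hm : m ≤ r + 1) :
    Ctl θ r n m j w e fun i => lift fun x => c i * f x := by
  have hs : ∀ (k : ℕ) i, ContDiff ℝ (k : WithTop ℕ∞) fun x => c i * f x :=
    fun k i => contDiff_const.mul (hf.smooth k)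
  have hpt : ∀ I : List (Fin 3), PtBd θ (e + I.length) fun i => sdList I fun x => c i * f x := by
    intro I
    obtain ⟨C, hC, h⟩ := hf.bound I
    refine ⟨A * C, by positivity, fun i x => ?_⟩
    change |sdList I (fun x => c i * f x) x| ≤ _
    rw [sdList_const_mul (c i) (hf.smooth I.length) I le_rfl, abs_mul]
    refine (mul_le_mul (hc i) (h x) (abs_nonneg _) (mul_nonneg hA (hθ i))).trans (le_of_eq ?_)
    ring
  exact ⟨fun i => smooth_lift (hs r i), hn, hm,
    jet_lift (boundScale_ptBd hθ) (hs _) fun I _ => hpt I,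
    jet_lift (boundScale_l2Bd θ) (hs _) fun I _ => (hpt I).l2Bd (by linarith)⟩

end StaticFamilies

/-! ### The cut-off Newtonian potential -/

section Radial

lemma sd_congr_of_eventuallyEq {f g : Space → ℝ} {x : Space} (h : f =ᶠ[𝓝 x] g) (k : Fin 3) :
    sd k f x = sd k g x := by
  simp only [sd, h.fderiv_eq]

lemma isOpen_exterior : IsOpen {x : Space | 3 / 4 < ‖x‖} := isOpen_lt continuous_const continuous_norm

lemma jp_rpow_ge {x : Space} {s : ℝ} (hs : 0 ≤ s) (hx : ‖x‖ ≤ 1) : 1 ≤ 2 ^ s * jp x ^ (-s) := by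
  have h2 : jp x ≤ 2 := (jp_le_one_add x).trans (by linarith)
  rw [Real.rpow_neg (jp_pos x).le, ← div_eq_mul_inv, one_le_div (jp_rpow_pos x s)]
  exact Real.rpow_le_rpow (jp_pos x).le h2 hs

lemma exists_bound_closedBall {f : Space → ℝ} (hf : Continuous f) :
    ∃ C : ℝ, 0 ≤ C ∧ ∀ x, ‖x‖ ≤ 1 → |f x| ≤ C := by
  obtain ⟨C, hC⟩ := (isCompact_closedBall (0 : Space) 1).exists_bound_of_continuousOn hf.continuousOn
  exact ⟨max C 0, le_max_right _ _, fun x hx => (hC x (by simpa using hx)).trans (le_max_left _ _)⟩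

/-- A smooth function with compact support is a symbol of every order: its derivatives are bounded
on the unit ball, where the weight is bounded below, and vanish outside. -/
lemma isSymbol_of_eq_zero {f : Space → ℝ} (hf : ∀ n : ℕ, ContDiff ℝ (n : WithTop ℕ∞) f)
    (h0 : ∀ x, 3 / 4 < ‖x‖ → f x = 0) {e : ℝ} (he : 0 ≤ e) : IsSymbol e f where
  smooth := hf
  bound I := by
    have hz : ∀ x, 3 / 4 < ‖x‖ → sdList I f x = 0 := by
      induction I with
      | nil => exact h0
      | cons k I ih =>
        intro x hx
        have : sdList I f =ᶠ[𝓝 x] fun _ => 0 := by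
          filter_upwards [isOpen_exterior.mem_nhds hx] with y hy using ih y hy
        simp only [sdList]
        rw [sd_congr_of_eventuallyEq this]
        simp [sd]
    obtain ⟨C, hC, hb⟩ := exists_bound_closedBall
      (contDiff_sdList (m := 0) I (hf I.length) (by omega)).continuous
    refine ⟨C * 2 ^ (e + I.length), by positivity, fun x => ?_⟩
    rcases le_or_gt ‖x‖ 1 with hx | hx
    · rw [mul_assoc]
      exact (hb x hx).trans (le_mul_of_one_le_right hC (jp_rpow_ge (by positivity) hx))
    · rw [hz x (by linarith), abs_zero]
      have := jp_rpow_pos x (-(e + I.length))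
      positivity

/-- Homogeneity of degree `-a` outside of a ball. -/
def IsHomog (a : ℕ) (f : Space → ℝ) : Prop :=
  ∀ x, 3 / 4 < ‖x‖ → ∀ l : ℝ, 1 ≤ l → l ^ a * f (l • x) = f x

lemma IsHomog.sd {a : ℕ} {f : Space → ℝ} (h : IsHomog a f) (hf : ContDiff ℝ 1 f) (k : Fin 3) :
    IsHomog (a + 1) (sd k f) := by
  intro x hx l hl
  have h1 : (fun y => l ^ a * f (l • y)) =ᶠ[𝓝 x] f := by
    filter_upwards [isOpen_exterior.mem_nhds hx] with y hy using h y hy l hl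
  have h2 : HasFDerivAt (fun y : Space => l ^ a * f (l • y))
      (l ^ a • (fderiv ℝ f (l • x)).comp (l • ContinuousLinearMap.id ℝ Space)) x :=
    (((hf.differentiable (by simp) (l • x)).hasFDerivAt).comp x
      ((hasFDerivAt_id x).const_smul l)).const_mul _
  rw [← sd_congr_of_eventuallyEq h1]
  simp only [EinsteinNLEM.sd, h2.fderiv]
  simp
  ring

/-- Outside the unit ball the value at `x` is the value at `x/‖x‖` times `‖x‖^{-a}`; compactness
takes care of the rest. -/
lemma IsHomog.bound {a : ℕ} {f : Space → ℝ} (h : IsHomog a f) (hf : Continuous f) :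
    ∃ C : ℝ, 0 ≤ C ∧ ∀ x, |f x| ≤ C * jp x ^ (-(a : ℝ)) := by
  obtain ⟨C, hC, hb⟩ := exists_bound_closedBall hf
  refine ⟨C * 2 ^ (a : ℝ), by positivity, fun x => ?_⟩
  rw [mul_assoc]
  rcases le_or_gt ‖x‖ 1 with hx | hx
  · exact (hb x hx).trans (le_mul_of_one_le_right hC (jp_rpow_ge (by positivity) hx))
  · have hx0 : ‖x‖ ≠ 0 := by positivity
    have hu : ‖‖x‖⁻¹ • x‖ = 1 := by
      rw [norm_smul, norm_inv, norm_norm, inv_mul_cancel₀ hx0]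
    have h1 := h (‖x‖⁻¹ • x) (by rw [hu]; norm_num) ‖x‖ hx.le
    rw [smul_smul, mul_inv_cancel₀ hx0, one_smul] at h1
    have h2 : ‖x‖ ^ a * |f x| ≤ C := by
      have := hb _ hu.le
      rwa [← h1, abs_mul, abs_of_nonneg (by positivity)] at this
    have h3 : jp x ^ (a : ℝ) ≤ 2 ^ (a : ℝ) * ‖x‖ ^ a := by
      rw [← Real.rpow_natCast ‖x‖, ← Real.mul_rpow (by norm_num) (by positivity)]
      exact Real.rpow_le_rpow (jp_pos x).le ((jp_le_one_add x).trans (by linarith)) (by positivity)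
    have hj := jp_rpow_pos x (a : ℝ)
    rw [Real.rpow_neg (jp_pos x).le, ← mul_assoc, ← div_eq_mul_inv, le_div_iff₀ hj]
    calc |f x| * jp x ^ (a : ℝ) ≤ |f x| * (2 ^ (a : ℝ) * ‖x‖ ^ a) := by gcongr
      _ = 2 ^ (a : ℝ) * (‖x‖ ^ a * |f x|) := by ring
      _ ≤ 2 ^ (a : ℝ) * C := by gcongr
      _ = _ := by ring

lemma IsHomog.isSymbol {a : ℕ} {f : Space → ℝ} (h : IsHomog a f)
    (hf : ∀ n : ℕ, ContDiff ℝ (n : WithTop ℕ∞) f) : IsSymbol a f where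
  smooth := hf
  bound I := by
    have hI : IsHomog (a + I.length) (sdList I f) := by
      induction I with
      | nil => exact h
      | cons k I ih =>
        exact ih.sd (contDiff_sdList (m := 1) I (hf (1 + I.length)) le_rfl) k
    simpa using hI.bound (contDiff_sdList (m := 0) I (hf I.length) (by omega)).continuous

/-- The cut-off Newtonian potential `χ(r) / r`. -/
noncomputable def newton (χ : ℝ → ℝ) (x : Space) : ℝ := χ ‖x‖ * ‖x‖⁻¹

variable {χ : ℝ → ℝ}

lemma contDiff_newton (hχ : IsCutoff χ) (n : ℕ) : ContDiff ℝ (n : WithTop ℕ∞) (newton χ) := by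
  rw [contDiff_iff_contDiffAt]
  intro x
  by_cases hx : x = 0
  · have : newton χ =ᶠ[𝓝 x] fun _ => 0 := by
      have : Metric.ball (0 : Space) (1 / 2) ∈ 𝓝 x := by
        rw [hx]; exact Metric.ball_mem_nhds _ (by norm_num)
      filter_upwards [this] with y hy
      rw [newton, hχ.eq_zero _ (by simpa using (mem_ball_zero_iff.1 hy).le), zero_mul]
    exact contDiffAt_const.congr_of_eventuallyEq this
  · have h1 : ContDiffAt ℝ (n : WithTop ℕ∞) (fun y : Space => ‖y‖) x := contDiffAt_norm ℝ hx
    exact ((hχ.smooth n).contDiffAt.comp x h1).mul (h1.inv (norm_ne_zero_iff.2 hx))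

lemma isSymbol_newton (hχ : IsCutoff χ) : IsSymbol 1 (newton χ) := by
  have : IsHomog 1 (newton χ) := by
    intro x hx l hl
    have hx0 : ‖x‖ ≠ 0 := by linarith
    have hl0 : l ≠ 0 := by linarith
    have hn : ‖l • x‖ = l * ‖x‖ := by rw [norm_smul, Real.norm_of_nonneg (by linarith)]
    rw [newton, newton, hn, hχ.eq_one _ (by nlinarith), hχ.eq_one _ hx.le]
    field_simp
  simpa using this.isSymbol (contDiff_newton hχ)

lemma hasFDerivAt_norm_sq_rpow (s : ℝ) {x : Space} (hx : x ≠ 0) :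
    HasFDerivAt (fun y : Space => (‖y‖ ^ 2) ^ s)
      ((s * (‖x‖ ^ 2) ^ (s - 1)) • ((2 : ℕ) • innerSL ℝ x)) x := by
  have h := (hasStrictFDerivAt_norm_sq x).hasFDerivAt
  have := h.rpow_const (p := s) (Or.inl (by positivity))
  simpa using this

/-- This cancellation is indispensable. The second derivatives of `1/r` decay only like `r^{-3}`,
which is not square integrable with the weight `r^{3/2+γ}` required of the source of the wave
equation; their trace vanishes beyond the cut-off. Powers of `‖x‖²` are differentiated in place of
the norm. -/
lemma laplacian_newton_eq_zero (hχ : IsCutoff χ) {x : Space} (hx : 3 / 4 < ‖x‖) :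
    ∑ k, sd k (sd k (newton χ)) x = 0 := by
  have e1 : ∀ y ∈ {y : Space | 3 / 4 < ‖y‖}, newton χ y = (‖y‖ ^ 2) ^ (-1 / 2 : ℝ) := by
    intro y hy
    have hy' : 3 / 4 < ‖y‖ := hy
    rw [newton, hχ.eq_one _ hy'.le, one_mul, ← Real.rpow_natCast, ← Real.rpow_mul (norm_nonneg _)]
    norm_num [Real.rpow_neg_one]
  have hne : ∀ y ∈ {y : Space | 3 / 4 < ‖y‖}, y ≠ 0 := by
    rintro y hy rfl
    norm_num at hy
  have e2 : ∀ k, ∀ y ∈ {y : Space | 3 / 4 < ‖y‖},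
      sd k (newton χ) y = -((‖y‖ ^ 2) ^ (-3 / 2 : ℝ) * y k) := by
    intro k y hy
    have : newton χ =ᶠ[𝓝 y] fun z => (‖z‖ ^ 2) ^ (-1 / 2 : ℝ) := by
      filter_upwards [isOpen_exterior.mem_nhds hy] with z hz using e1 z hz
    rw [sd_congr_of_eventuallyEq this, sd, (hasFDerivAt_norm_sq_rpow _ (hne y hy)).fderiv]
    simp [EuclideanSpace.inner_single_right]
    ring_nf
  have e3 : ∀ k, sd k (sd k (newton χ)) x
      = 3 * (‖x‖ ^ 2) ^ (-5 / 2 : ℝ) * x k ^ 2 - (‖x‖ ^ 2) ^ (-3 / 2 : ℝ) := by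
    intro k
    have : sd k (newton χ) =ᶠ[𝓝 x] fun z => -((‖z‖ ^ 2) ^ (-3 / 2 : ℝ) * z k) := by
      filter_upwards [isOpen_exterior.mem_nhds hx] with z hz using e2 k z hz
    have hp : HasFDerivAt (fun z : Space => z k) (EuclideanSpace.proj k : Space →L[ℝ] ℝ) x :=
      (EuclideanSpace.proj k : Space →L[ℝ] ℝ).hasFDerivAt
    have hq := ((hasFDerivAt_norm_sq_rpow (-3 / 2) (hne x hx)).mul hp).neg.fderiv
    rw [sd_congr_of_eventuallyEq this, sd]
    change fderiv ℝ (-((fun z : Space => (‖z‖ ^ 2) ^ (-3 / 2 : ℝ)) * fun z : Space => z k)) x _ = _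
    rw [hq]
    simp [EuclideanSpace.inner_single_right]
    ring_nf
  simp only [e3, Finset.sum_sub_distrib, ← Finset.mul_sum]
  have hs : ∑ k, x k ^ 2 = ‖x‖ ^ 2 := by
    rw [EuclideanSpace.norm_sq_eq]; simp
  have hpos : 0 < ‖x‖ ^ 2 := by positivity
  rw [hs, mul_assoc]
  have : (‖x‖ ^ 2) ^ (-5 / 2 : ℝ) * ‖x‖ ^ 2 = (‖x‖ ^ 2) ^ (-3 / 2 : ℝ) := by
    nth_rewrite 2 [← Real.rpow_one (‖x‖ ^ 2)]
    rw [← Real.rpow_add hpos]; norm_num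
  rw [this]
  simp

lemma isSymbol_laplacian_newton (hχ : IsCutoff χ) {e : ℝ} (he : 0 ≤ e) :
    IsSymbol e fun x => ∑ k, sd k (sd k (newton χ)) x :=
  isSymbol_of_eq_zero
    (fun n => ContDiff.sum fun k _ => contDiff_sd (contDiff_sd (contDiff_newton hχ (n + 1 + 1)) k) k)
    (fun _ hx => laplacian_newton_eq_zero hχ hx) he

end Radial

/-! ### Recovery of a function from the decay of its gradient -/

section Rays

/-- The function `φ(s) + K/(a+s)` is nonincreasing and tends to `0`, hence is nonnegative at `s =
0`. The same holds for `-φ`. -/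
lemma abs_le_of_deriv_le_div_sq {φ φ' : ℝ → ℝ} {K a : ℝ} (ha : 0 < a)
    (hφ : ∀ s, HasDerivAt φ (φ' s) s) (h : ∀ s, 0 ≤ s → |φ' s| ≤ K / (a + s) ^ 2)
    (h0 : Tendsto φ atTop (𝓝 0)) : |φ 0| ≤ K / a := by
  have key : ∀ (ψ ψ' : ℝ → ℝ), (∀ s, HasDerivAt ψ (ψ' s) s) →
      (∀ s, 0 ≤ s → |ψ' s| ≤ K / (a + s) ^ 2) → Tendsto ψ atTop (𝓝 0) → -(K / a) ≤ ψ 0 := by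
    intro ψ ψ' hψ h h0
    have hd : ∀ s, 0 ≤ s → HasDerivAt (fun s => ψ s + K / (a + s)) (ψ' s - K / (a + s) ^ 2) s := by
      intro s hs
      have h1 : HasDerivAt (fun s => a + s) 1 s := (hasDerivAt_id s).const_add a
      have := (hψ s).add ((hasDerivAt_const s K).div h1 (by positivity))
      convert! this using 1
      ring
    have hanti : AntitoneOn (fun s => ψ s + K / (a + s)) (Set.Ici 0) := by
      refine antitoneOn_of_deriv_nonpos (convex_Ici 0)
        (fun s hs => (hd s hs).continuousAt.continuousWithinAt)
        (fun s hs => (hd s (interior_subset hs)).differentiableAt.differentiableWithinAt)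
        fun s hs => ?_
      have hs' : 0 ≤ s := interior_subset hs
      rw [(hd s hs').deriv]
      linarith [le_abs_self (ψ' s), h s hs']
    have hlim : Tendsto (fun s => ψ s + K / (a + s)) atTop (𝓝 0) := by
      have h2 : Tendsto (fun s : ℝ => K / (a + s)) atTop (𝓝 0) :=
        (tendsto_const_nhds).div_atTop (tendsto_atTop_add_const_left _ _ tendsto_id)
      simpa using h0.add h2
    have : 0 ≤ ψ 0 + K / (a + 0) := by
      refine le_of_tendsto hlim ?_
      filter_upwards [eventually_ge_atTop 0] with s hs
      exact hanti Set.self_mem_Ici hs hs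
    rw [add_zero] at this
    linarith
  rw [abs_le]
  refine ⟨key φ φ' hφ h h0, ?_⟩
  have := key (fun s => -φ s) (fun s => -φ' s) (fun s => (hφ s).neg)
    (fun s hs => by rw [abs_neg]; exact h s hs) (by simpa using h0.neg)
  linarith

/-- The data norm contains the gradient of `h̲^{(1)}` but not `h̲^{(1)}` itself, whose bound is
found by integrating the gradient along a ray that runs outward to infinity. -/
lemma abs_le_of_sd_le {f : Space → ℝ} (hf : ContDiff ℝ 1 f)
    (h0 : Tendsto f (cocompact Space) (𝓝 0)) {C : ℝ} (hC : 0 ≤ C)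
    (h : ∀ k x, |sd k f x| ≤ C * jp x ^ (-2 : ℝ)) (x : Space) :
    |f x| ≤ 12 * C * jp x ^ (-1 : ℝ) := by
  obtain ⟨v, hv, hxv⟩ : ∃ v : Space, ‖v‖ = 1 ∧ ∀ s : ℝ, 0 ≤ s → ‖x + s • v‖ = ‖x‖ + s := by
    by_cases hx : x = 0
    · refine ⟨EuclideanSpace.single 0 1, by simp, fun s hs => ?_⟩
      simp [hx, norm_smul, abs_of_nonneg hs]
    · have hx0 : ‖x‖ ≠ 0 := norm_ne_zero_iff.2 hx
      refine ⟨‖x‖⁻¹ • x, by rw [norm_smul, norm_inv, norm_norm, inv_mul_cancel₀ hx0],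
        fun s hs => ?_⟩
      have : x + s • (‖x‖⁻¹ • x) = (1 + s * ‖x‖⁻¹) • x := by
        rw [add_smul, one_smul, smul_smul]
      rw [this, norm_smul, Real.norm_of_nonneg (by positivity)]
      field_simp
  have hd : ∀ s : ℝ, HasDerivAt (fun s : ℝ => f (x + s • v)) (fderiv ℝ f (x + s • v) v) s := by
    intro s
    have h1 : HasDerivAt (fun s : ℝ => x + s • v) v s := by
      simpa using ((hasDerivAt_id s).smul_const v).const_add x
    exact ((hf.differentiable (by simp) _).hasFDerivAt).comp_hasDerivAt s h1
  -- The factor `12` is `3` components of the gradient times `4`, from `(1 + ‖x‖ + s)² ≤ 4 jp(y)²`.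
  have hb : ∀ s : ℝ, 0 ≤ s → |fderiv ℝ f (x + s • v) v| ≤ 12 * C / (1 + ‖x‖ + s) ^ 2 := by
    intro s hs
    set y := x + s • v with hy
    have hvs : v = ∑ k, v k • EuclideanSpace.single k (1 : ℝ) := by
      ext i
      simp [Finset.sum_apply, Pi.single_apply]
    have hj : (1 + ‖x‖ + s) ^ 2 ≤ 4 * jp y ^ 2 := by
      have h1 : 1 + ‖x‖ + s ≤ 2 * jp y := by
        have := one_add_le_jp y
        rw [hxv s hs] at this; linarith
      have : 0 ≤ 1 + ‖x‖ + s := by positivity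
      nlinarith
    have hjp : jp y ^ (-2 : ℝ) ≤ 4 / (1 + ‖x‖ + s) ^ 2 := by
      rw [Real.rpow_neg (jp_pos y).le, Real.rpow_two, ← one_div,
        div_le_div_iff₀ (by have := jp_pos y; positivity) (by positivity)]
      linarith
    have hk : ∀ k, |v k * sd k f y| ≤ C * (4 / (1 + ‖x‖ + s) ^ 2) := by
      intro k
      rw [abs_mul]
      have h1 : |v k| ≤ 1 := by simpa [hv] using PiLp.norm_apply_le v k
      calc |v k| * |sd k f y| ≤ 1 * (C * jp y ^ (-2 : ℝ)) :=
            mul_le_mul h1 (h k y) (abs_nonneg _) zero_le_one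
        _ ≤ _ := by rw [one_mul]; gcongr
    calc |fderiv ℝ f y v| = |∑ k, v k * sd k f y| := by
          nth_rewrite 1 [hvs]
          rw [map_sum]
          simp [sd]
      _ ≤ ∑ k : Fin 3, |v k * sd k f y| := Finset.abs_sum_le_sum_abs _ _
      _ ≤ ∑ _k : Fin 3, C * (4 / (1 + ‖x‖ + s) ^ 2) := Finset.sum_le_sum fun k _ => hk k
      _ = _ := by simp; ring
  have hco : Tendsto (fun s : ℝ => x + s • v) atTop (cocompact Space) := by
    refine tendsto_cocompact_of_tendsto_dist_comp_atTop (0 : Space) ?_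
    refine tendsto_atTop_mono' _ (f₁ := fun s : ℝ => s) ?_ tendsto_id
    filter_upwards [eventually_ge_atTop 0] with s hs
    rw [dist_zero_right, hxv s hs]
    linarith [norm_nonneg x]
  have := abs_le_of_deriv_le_div_sq (by positivity) hd hb (h0.comp hco)
  simp only [zero_smul, add_zero] at this
  refine this.trans ?_
  rw [Real.rpow_neg_one, ← div_eq_mul_inv]
  exact div_le_div_of_nonneg_left (by positivity) (jp_pos x) (jp_le_one_add x)

end Rays

end EinsteinNLEM

namespace EinsteinNLEM

/-! ### Coefficients of the system near `(m, 0)` -/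

section Coefficients

/-- Labels of the components of a pair `(g, F)`. -/
abbrev FieldIdx := (Fin 4 × Fin 4) ⊕ (Fin 4 × Fin 4)

/-- The components of `(g, F)` as a point of a finite-dimensional space. -/
abbrev FieldVal := FieldIdx → ℝ

/-- The metric part of a pair `(g, F)`. -/
def gOf (y : FieldVal) : Matrix (Fin 4) (Fin 4) ℝ := Matrix.of fun μ ν => y (Sum.inl (μ, ν))

/-- The electromagnetic part of a pair `(g, F)`. -/
def fOf (y : FieldVal) : Fin 4 → Fin 4 → ℝ := fun μ ν => y (Sum.inr (μ, ν))

/-- The pair `(m, 0)`. -/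
def vacuum : FieldVal := Sum.elim (fun i => mink i.1 i.2) fun _ => 0

/-- The invariants as a function of `(g, F)`. -/
noncomputable def inv2 (y : FieldVal) : ℝ × ℝ := invariants (gOf y) (fOf y)

/-- The spatial block of the metric. -/
def gSpace (y : FieldVal) : Matrix (Fin 3) (Fin 3) ℝ := Matrix.of fun j k => gOf y j.succ k.succ

lemma contDiff_gOf {n : WithTop ℕ∞} (μ ν : Fin 4) : ContDiff ℝ n fun y => gOf y μ ν :=
  contDiff_apply ℝ ℝ (Sum.inl (μ, ν))

lemma contDiff_fOf {n : WithTop ℕ∞} (μ ν : Fin 4) : ContDiff ℝ n fun y => fOf y μ ν :=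
  contDiff_apply ℝ ℝ (Sum.inr (μ, ν))

section Matrices

variable {E : Type*} [NormedAddCommGroup E] [NormedSpace ℝ E] {n : WithTop ℕ∞} {s : Set E}
  {q : Type*} [Fintype q] [DecidableEq q] {A : E → Matrix q q ℝ}

lemma contDiffOn_det (hA : ∀ i j, ContDiffOn ℝ n (fun y => A y i j) s) :
    ContDiffOn ℝ n (fun y => (A y).det) s := by
  simp only [Matrix.det_apply']
  exact ContDiffOn.sum fun σ _ => contDiffOn_const.mul (contDiffOn_prod fun i _ => hA _ _)

lemma contDiffOn_matrix_inv (hA : ∀ i j, ContDiffOn ℝ n (fun y => A y i j) s)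
    (hdet : ∀ y ∈ s, (A y).det ≠ 0) (i j : q) : ContDiffOn ℝ n (fun y => (A y)⁻¹ i j) s := by
  simp only [Matrix.inv_def, Ring.inverse_eq_inv', Matrix.smul_apply, Matrix.adjugate_apply,
    smul_eq_mul]
  refine ((contDiffOn_det hA).inv hdet).mul (contDiffOn_det fun a b => ?_)
  by_cases ha : a = j
  · subst ha
    simpa using contDiffOn_const
  · simpa [Matrix.updateRow_ne ha] using hA a b

end Matrices

/-- The pairs `(g, F)` with `det g < 0` whose invariants lie in `U`. -/
def regularPairs (U : Set (ℝ × ℝ)) : Set FieldVal := {y | (gOf y).det < 0 ∧ inv2 y ∈ U}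

lemma contDiff_det_gOf {n : WithTop ℕ∞} : ContDiff ℝ n fun y => (gOf y).det :=
  contDiffOn_univ.1 (contDiffOn_det fun i j => (contDiff_gOf i j).contDiffOn)

/-- The pairs `(g, F)` with `det g < 0`. -/
def lorentzPairs : Set FieldVal := {y | (gOf y).det < 0}

lemma isOpen_lorentzPairs : IsOpen lorentzPairs :=
  isOpen_lt (contDiff_det_gOf (n := 0)).continuous continuous_const

lemma contDiffOn_gInv {n : WithTop ℕ∞} (μ ν : Fin 4) :
    ContDiffOn ℝ n (fun y => (gOf y)⁻¹ μ ν) lorentzPairs :=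
  contDiffOn_matrix_inv (fun i j => (contDiff_gOf i j).contDiffOn) (fun _ hy => ne_of_lt hy) μ ν

lemma contDiffOn_sqrt_det {n : WithTop ℕ∞} :
    ContDiffOn ℝ n (fun y => Real.sqrt |(gOf y).det|) lorentzPairs := by
  have h : ContDiffOn ℝ n (fun y => Real.sqrt (-(gOf y).det)) lorentzPairs :=
    contDiff_det_gOf.neg.contDiffOn.sqrt fun y hy => (neg_pos.2 hy).ne'
  exact h.congr fun y hy => by rw [abs_of_neg hy]

lemma contDiffOn_sqrt_det_inv {n : WithTop ℕ∞} :
    ContDiffOn ℝ n (fun y => (Real.sqrt |(gOf y).det|)⁻¹) lorentzPairs :=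
  contDiffOn_sqrt_det.inv fun _ hy => (Real.sqrt_pos.2 (abs_pos.2 (ne_of_lt hy))).ne'

lemma contDiffOn_raise {n : WithTop ℕ∞} (μ ν : Fin 4) :
    ContDiffOn ℝ n (fun y => raise (gOf y) (fOf y) μ ν) lorentzPairs :=
  ContDiffOn.sum fun _ _ => ContDiffOn.sum fun _ _ =>
    ((contDiffOn_gInv _ _).mul (contDiffOn_gInv _ _)).mul (contDiff_fOf _ _).contDiffOn

lemma contDiffOn_hodgeUp {n : WithTop ℕ∞} (μ ν : Fin 4) :
    ContDiffOn ℝ n (fun y => hodgeUp (gOf y) (fOf y) μ ν) lorentzPairs :=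
  contDiffOn_const.mul (ContDiffOn.sum fun _ _ => ContDiffOn.sum fun _ _ =>
    ((contDiffOn_sqrt_det_inv.neg).mul contDiffOn_const).mul (contDiff_fOf _ _).contDiffOn)

lemma contDiffOn_hodge {n : WithTop ℕ∞} (μ ν : Fin 4) :
    ContDiffOn ℝ n (fun y => hodge (gOf y) (fOf y) μ ν) lorentzPairs :=
  ContDiffOn.sum fun _ _ => ContDiffOn.sum fun _ _ =>
    ((contDiff_gOf _ _).contDiffOn.mul (contDiff_gOf _ _).contDiffOn).mul (contDiffOn_hodgeUp _ _)

lemma contDiffOn_inv2 {n : WithTop ℕ∞} : ContDiffOn ℝ n inv2 lorentzPairs :=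
  (contDiffOn_const.mul (ContDiffOn.sum fun _ _ => ContDiffOn.sum fun _ _ =>
    (contDiff_fOf _ _).contDiffOn.mul (contDiffOn_raise _ _))).prodMk
  (contDiffOn_const.mul (ContDiffOn.sum fun _ _ => ContDiffOn.sum fun _ _ =>
    (contDiff_fOf _ _).contDiffOn.mul (contDiffOn_hodgeUp _ _)))

variable {U : Set (ℝ × ℝ)} {L : ℝ × ℝ → ℝ}

lemma regularPairs_subset : regularPairs U ⊆ lorentzPairs := fun _ hy => hy.1

lemma isOpen_regularPairs (hU : IsOpen U) : IsOpen (regularPairs U) :=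
  (contDiffOn_inv2 (n := 0)).continuousOn.isOpen_inter_preimage isOpen_lorentzPairs hU

lemma contDiffOn_comp_inv2 {n : WithTop ℕ∞} {f : ℝ × ℝ → ℝ} (hf : ContDiffOn ℝ n f U) :
    ContDiffOn ℝ n (fun y => f (inv2 y)) (regularPairs U) :=
  hf.comp (contDiffOn_inv2.mono regularPairs_subset) fun _ hy => hy.2

lemma contDiffOn_lagD1 {n : ℕ} (hU : IsOpen U) (hL : ContDiffOn ℝ ((n + 1 : ℕ) : WithTop ℕ∞) L U) :
    ContDiffOn ℝ (n : WithTop ℕ∞) (lagD1 L) U :=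
  (hL.fderiv_of_isOpen hU (by norm_cast)).clm_apply contDiffOn_const

lemma contDiffOn_lagD2 {n : ℕ} (hU : IsOpen U) (hL : ContDiffOn ℝ ((n + 1 : ℕ) : WithTop ℕ∞) L U) :
    ContDiffOn ℝ (n : WithTop ℕ∞) (lagD2 L) U :=
  (hL.fderiv_of_isOpen hU (by norm_cast)).clm_apply contDiffOn_const

lemma contDiffOn_tensorN {n : ℕ} (hU : IsOpen U)
    (hL : ContDiffOn ℝ ((n + 2 : ℕ) : WithTop ℕ∞) L U) (μ ν κ l : Fin 4) :
    ContDiffOn ℝ (n : WithTop ℕ∞) (fun y => tensorN L (gOf y) (fOf y) μ ν κ l)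
      (regularPairs U) := by
  have h1 : ContDiffOn ℝ (n : WithTop ℕ∞) (fun y => lagD1 L (inv2 y)) (regularPairs U) :=
    contDiffOn_comp_inv2 ((contDiffOn_lagD1 hU hL).of_le (by norm_cast; omega))
  have h11 : ContDiffOn ℝ (n : WithTop ℕ∞) (fun y => lagD1 (lagD1 L) (inv2 y)) (regularPairs U) :=
    contDiffOn_comp_inv2 (contDiffOn_lagD1 hU (contDiffOn_lagD1 hU hL))
  have h12 : ContDiffOn ℝ (n : WithTop ℕ∞) (fun y => lagD2 (lagD1 L) (inv2 y)) (regularPairs U) :=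
    contDiffOn_comp_inv2 (contDiffOn_lagD2 hU (contDiffOn_lagD1 hU hL))
  have h22 : ContDiffOn ℝ (n : WithTop ℕ∞) (fun y => lagD2 (lagD2 L) (inv2 y)) (regularPairs U) :=
    contDiffOn_comp_inv2 (contDiffOn_lagD2 hU (contDiffOn_lagD2 hU hL))
  have hg : ∀ a b, ContDiffOn ℝ (n : WithTop ℕ∞) (fun y => (gOf y)⁻¹ a b) (regularPairs U) :=
    fun a b => (contDiffOn_gInv a b).mono regularPairs_subset
  have hr : ∀ a b, ContDiffOn ℝ (n : WithTop ℕ∞) (fun y => raise (gOf y) (fOf y) a b)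
      (regularPairs U) := fun a b => (contDiffOn_raise a b).mono regularPairs_subset
  have hh : ∀ a b, ContDiffOn ℝ (n : WithTop ℕ∞) (fun y => hodgeUp (gOf y) (fOf y) a b)
      (regularPairs U) := fun a b => (contDiffOn_hodgeUp a b).mono regularPairs_subset
  exact (((h1.neg.mul (((hg _ _).mul (hg _ _)).sub ((hg _ _).mul (hg _ _)))).sub
    (((contDiffOn_const.mul h11).mul (hr _ _)).mul (hr _ _))).sub
    (h12.mul (((hr _ _).mul (hh _ _)).add ((hh _ _).mul (hr _ _))))).sub
    (((contDiffOn_const.mul h22).mul (hh _ _)).mul (hh _ _))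

/-- The coefficient of `∂_t F_{0k}` in the electromagnetic equations. -/
noncomputable def evolMatrix (L : ℝ × ℝ → ℝ) (y : FieldVal) : Matrix (Fin 3) (Fin 3) ℝ :=
  Matrix.of fun j k => tensorN L (gOf y) (fOf y) 0 j.succ 0 k.succ
    - tensorN L (gOf y) (fOf y) 0 j.succ k.succ 0

lemma contDiffOn_maxwellDual {n : ℕ} (hU : IsOpen U)
    (hL : ContDiffOn ℝ ((n + 1 : ℕ) : WithTop ℕ∞) L U) (μ ν : Fin 4) :
    ContDiffOn ℝ (n : WithTop ℕ∞) (fun y => maxwellDual L (gOf y) (fOf y) μ ν)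
      (regularPairs U) :=
  ((contDiffOn_const.mul (contDiffOn_comp_inv2 (contDiffOn_lagD1 hU hL))).mul
    (contDiff_fOf _ _).contDiffOn).add ((contDiffOn_comp_inv2 (contDiffOn_lagD2 hU hL)).mul
      ((contDiffOn_hodge μ ν).mono regularPairs_subset))

lemma contDiffOn_evolMatrix {n : ℕ} (hU : IsOpen U)
    (hL : ContDiffOn ℝ ((n + 2 : ℕ) : WithTop ℕ∞) L U) (j k : Fin 3) :
    ContDiffOn ℝ (n : WithTop ℕ∞) (fun y => evolMatrix L y j k) (regularPairs U) :=
  (contDiffOn_tensorN hU hL _ _ _ _).sub (contDiffOn_tensorN hU hL _ _ _ _)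

/-- The pairs `(g, F)` near `(m, 0)` for which the reduced system can be solved for the highest
derivatives with respect to time. -/
structure IsGood (U : Set (ℝ × ℝ)) (L : ℝ × ℝ → ℝ) (y : FieldVal) : Prop where
  regular : y ∈ regularPairs U
  gInv : (gOf y)⁻¹ 0 0 < 0
  g00 : gOf y 0 0 < 0
  gSpace : 0 < (gSpace y).det
  evol : (evolMatrix L y).det < 0
  lag1 : lagD1 L (inv2 y) < -1 / 4
  lag2 : |lagD2 L (inv2 y)| < 1

lemma gOf_vacuum : gOf vacuum = mink := by ext; rfl

lemma fOf_vacuum : fOf vacuum = fun _ _ => 0 := by ext; rfl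

lemma inv2_vacuum : inv2 vacuum = (0, 0) := by
  simp [inv2, fOf_vacuum, invariants]

lemma mink_inv : mink⁻¹ = mink := by
  refine Matrix.inv_eq_right_inv ?_
  rw [mink, Matrix.diagonal_mul_diagonal]
  ext i j
  by_cases h : i = j
  · subst h; by_cases h0 : i = 0 <;> simp [h0]
  · simp [h]

lemma mink_det : mink.det = -1 := by
  simp [mink, Matrix.det_diagonal]

lemma lagD_zero (hL : IsMaxwellLike U L) : lagD1 L (0, 0) = -(1 / 2) ∧ lagD2 L (0, 0) = 0 := by
  simp [lagD1, lagD2, hL.deriv.fderiv]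

lemma mink_succ_succ (j k : Fin 3) : mink j.succ k.succ = if j = k then 1 else 0 := by
  simp [mink, Matrix.diagonal_apply]

lemma mink_zero_zero : mink 0 0 = -1 := by simp [mink]

lemma mink_zero_succ (k : Fin 3) : mink 0 k.succ = 0 := by
  simp [mink, (Fin.succ_ne_zero k).symm]

lemma mink_succ_zero (k : Fin 3) : mink k.succ 0 = 0 := by
  simp [mink]

/-- For Maxwell's equations on Minkowski space the system is already solved for `∂_t F_{0k}` up to
sign. Invertibility of `evolMatrix` nearby is then an open condition. -/
lemma evolMatrix_vacuum (hL : IsMaxwellLike U L) : evolMatrix L vacuum = -1 := by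
  have hr : ∀ μ ν, raise mink (fun _ _ => 0) μ ν = 0 := by simp [raise]
  have hh : ∀ μ ν, hodgeUp mink (fun _ _ => 0) μ ν = 0 := by simp [hodgeUp]
  have hi : invariants mink (fun _ _ => 0) = (0, 0) := by simp [invariants]
  ext j k
  simp only [evolMatrix, Matrix.of_apply, tensorN, gOf_vacuum, fOf_vacuum, hr, hh, hi, mink_inv,
    (lagD_zero hL).1, mink_succ_succ, mink_zero_zero, mink_zero_succ, mink_succ_zero,
    Matrix.neg_apply, Matrix.one_apply]
  split_ifs <;> norm_num

lemma isGood_vacuum (hL : IsMaxwellLike U L) : IsGood U L vacuum where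
  regular := ⟨by rw [gOf_vacuum, mink_det]; norm_num, by rw [inv2_vacuum]; exact hL.zero_mem⟩
  gInv := by rw [gOf_vacuum, mink_inv, mink_zero_zero]; norm_num
  g00 := by rw [gOf_vacuum, mink_zero_zero]; norm_num
  gSpace := by
    have : EinsteinNLEM.gSpace vacuum = 1 := by
      ext j k; simp [EinsteinNLEM.gSpace, gOf_vacuum, mink_succ_succ, Matrix.one_apply]
    rw [this, Matrix.det_one]; norm_num
  evol := by
    rw [evolMatrix_vacuum hL, Matrix.det_neg]; simp; norm_num
  lag1 := by rw [inv2_vacuum, (lagD_zero hL).1]; norm_num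
  lag2 := by rw [inv2_vacuum, (lagD_zero hL).2]; norm_num

lemma isOpen_setOf_isGood (hU : IsOpen U) (hL : ContDiffOn ℝ 2 L U) :
    IsOpen {y | IsGood U L y} := by
  have hR := isOpen_regularPairs hU
  have h1 : ContinuousOn (fun y => (gOf y)⁻¹ 0 0) (regularPairs U) :=
    ((contDiffOn_gInv (n := 0) 0 0).mono regularPairs_subset).continuousOn
  have h2 : ContinuousOn (fun y => gOf y 0 0) (regularPairs U) :=
    (contDiff_gOf (n := 0) 0 0).continuous.continuousOn
  have h3 : ContinuousOn (fun y => (gSpace y).det) (regularPairs U) :=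
    (contDiffOn_det (n := 0) (A := gSpace)
      fun i j : Fin 3 => (contDiff_gOf i.succ j.succ).contDiffOn).continuousOn
  have h5 : ContinuousOn (fun y => (evolMatrix L y).det) (regularPairs U) :=
    (contDiffOn_det (n := (0 : ℕ)) (A := evolMatrix L)
      fun i j => contDiffOn_evolMatrix hU hL i j).continuousOn
  have h6 : ContinuousOn (fun y => lagD1 L (inv2 y)) (regularPairs U) :=
    (contDiffOn_comp_inv2 (contDiffOn_lagD1 (n := 1) hU hL)).continuousOn
  have h7 : ContinuousOn (fun y => |lagD2 L (inv2 y)|) (regularPairs U) :=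
    (contDiffOn_comp_inv2 (contDiffOn_lagD2 (n := 1) hU hL)).continuousOn.abs
  rw [isOpen_iff_mem_nhds]
  intro y hy
  have hn := hR.mem_nhds hy.regular
  filter_upwards [hn, (h1.continuousAt hn).eventually_lt_const hy.gInv,
    (h2.continuousAt hn).eventually_lt_const hy.g00,
    (h3.continuousAt hn).eventually_const_lt hy.gSpace,
    (h5.continuousAt hn).eventually_lt_const hy.evol,
    (h6.continuousAt hn).eventually_lt_const hy.lag1,
    (h7.continuousAt hn).eventually_lt_const hy.lag2] with z a b c d e f g
  exact ⟨a, b, c, d, e, f, g⟩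

/-- The inverse function theorem with one neighbourhood for all degrees of regularity: the inverse
is `C^n` wherever it is defined, `f` is `C^n` and the derivative of `f` is invertible, and this
region does not depend on `n`. A neighbourhood that shrank with `n` would make `ε₀` depend on `N`.
-/
lemma exists_local_inverse {E : Type*} [NormedAddCommGroup E] [NormedSpace ℝ E] [CompleteSpace E]
    {f : E → E} {a : E} {W : Set E} (hW : IsOpen W) (ha : a ∈ W) (hf : ContDiffOn ℝ 1 f W)
    (hf' : HasFDerivAt f (ContinuousLinearMap.id ℝ E) a) :
    ∃ V ∈ 𝓝 a, ∃ V' ∈ 𝓝 (f a), IsOpen V' ∧ ∃ g : E → E, (∀ y ∈ V, g (f y) = y) ∧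
      ∀ n : ℕ, ContDiffOn ℝ (n : WithTop ℕ∞) f W → ContDiffOn ℝ (n : WithTop ℕ∞) g V' := by
  have hf1 : HasFDerivAt f ((ContinuousLinearEquiv.refl ℝ E : E ≃L[ℝ] E) : E →L[ℝ] E) a := hf'
  have hfa : ContDiffAt ℝ 1 f a := hf.contDiffAt (hW.mem_nhds ha)
  set e := hfa.toOpenPartialHomeomorph f hf1 one_ne_zero with he
  have hea : a ∈ e.source := hfa.mem_toOpenPartialHomeomorph_source hf1 one_ne_zero
  -- The points at which the derivative is invertible; they form an open set because invertible
  -- operators do.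
  set W' := W ∩ (fderiv ℝ f) ⁻¹' Set.range ((↑) : (E ≃L[ℝ] E) → E →L[ℝ] E) with hW'
  have hoW : IsOpen W' := (hf.continuousOn_fderiv_of_isOpen hW le_rfl).isOpen_inter_preimage hW
    ContinuousLinearEquiv.isOpen
  have haW : a ∈ W' := ⟨ha, ContinuousLinearEquiv.refl ℝ E, hf1.fderiv.symm⟩
  refine ⟨e.source, e.open_source.mem_nhds hea, e.target ∩ e.symm ⁻¹' W', ?_,
    e.isOpen_inter_preimage_symm hoW, e.symm, fun y hy => e.left_inv hy, fun n hn z hz => ?_⟩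
  · refine (e.isOpen_inter_preimage_symm hoW).mem_nhds ⟨e.map_source hea, ?_⟩
    have : e.symm (f a) = a := e.left_inv hea
    rw [Set.mem_preimage, this]
    exact haW
  · obtain ⟨hz1, hz2, B, hB⟩ := hz
    have hd : ContDiffAt ℝ (n : WithTop ℕ∞) f (e.symm z) := hn.contDiffAt (hW.mem_nhds hz2)
    have hd1 : DifferentiableAt ℝ f (e.symm z) :=
      (hf.contDiffAt (hW.mem_nhds hz2)).differentiableAt (by simp)
    refine (e.contDiffAt_symm hz1 (f₀' := B) ?_ hd).contDiffWithinAt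
    rw [hB]
    exact hd1.hasFDerivAt

/-- The sum of `⋆𝓜_{j0}` and `F_{j0}`, which vanishes to second order in `F`. -/
noncomputable def dualDefect (L : ℝ × ℝ → ℝ) (j : Fin 3) (y : FieldVal) : ℝ :=
  fOf y j.succ 0 + maxwellDual L (gOf y) (fOf y) j.succ 0

/-- A local diffeomorphism that replaces the electric components of `F` by those of `-⋆𝓜`. -/
noncomputable def dualMap (L : ℝ × ℝ → ℝ) (y : FieldVal) : FieldVal :=
  y + ∑ j, dualDefect L j y •
    ((Pi.single (Sum.inr (0, j.succ)) 1 : FieldVal) - Pi.single (Sum.inr (j.succ, 0)) 1)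

lemma contDiffOn_dualMap {n : ℕ} (hU : IsOpen U)
    (hL : ContDiffOn ℝ ((n + 1 : ℕ) : WithTop ℕ∞) L U) :
    ContDiffOn ℝ (n : WithTop ℕ∞) (dualMap L) (regularPairs U) :=
  contDiffOn_id.add (ContDiffOn.sum fun _ _ =>
    ((contDiff_fOf _ _).contDiffOn.add (contDiffOn_maxwellDual hU hL _ _)).smul contDiffOn_const)

/-- In the linearization `F_{j0}` appears with coefficient `1 + 2 · (-1/2) = 0`, and the remaining
products have two factors that vanish at `(m, 0)`, or one such factor and a vanishing derivative. -/
lemma hasFDerivAt_dualDefect (hL : IsMaxwellLike U L) (hL2 : ContDiffOn ℝ 2 L U) (j : Fin 3) :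
    HasFDerivAt (dualDefect L j) (0 : FieldVal →L[ℝ] ℝ) vacuum := by
  have hv := (isGood_vacuum hL).regular
  have hR := (isOpen_regularPairs hL.isOpen).mem_nhds hv
  have h1 : DifferentiableAt ℝ (fun y => lagD1 L (inv2 y)) vacuum :=
    ((contDiffOn_comp_inv2 (contDiffOn_lagD1 (n := 1) hL.isOpen hL2)).contDiffAt
      hR).differentiableAt (by simp)
  have h2 : DifferentiableAt ℝ (fun y => lagD2 L (inv2 y)) vacuum :=
    ((contDiffOn_comp_inv2 (contDiffOn_lagD2 (n := 1) hL.isOpen hL2)).contDiffAt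
      hR).differentiableAt (by simp)
  have h3 : DifferentiableAt ℝ (fun y => hodge (gOf y) (fOf y) j.succ 0) vacuum :=
    ((contDiffOn_hodge (n := 1) j.succ 0).contDiffAt
      (isOpen_lorentzPairs.mem_nhds (regularPairs_subset hv))).differentiableAt (by simp)
  have h4 : HasFDerivAt (fun y => fOf y j.succ 0)
      (ContinuousLinearMap.proj (Sum.inr (j.succ, 0)) : FieldVal →L[ℝ] ℝ) vacuum :=
    (ContinuousLinearMap.proj (Sum.inr (j.succ, 0)) : FieldVal →L[ℝ] ℝ).hasFDerivAt
  have hh : hodge (gOf vacuum) (fOf vacuum) j.succ 0 = 0 := by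
    simp [hodge, hodgeUp, fOf_vacuum]
  have hF : fOf vacuum j.succ 0 = 0 := by rw [fOf_vacuum]
  have := h4.add (((h1.hasFDerivAt.const_mul 2).mul h4).add (h2.hasFDerivAt.mul h3.hasFDerivAt))
  convert! this using 1
  rw [hh, hF, inv2_vacuum, (lagD_zero hL).1, (lagD_zero hL).2]
  ext z
  simp

lemma dualMap_vacuum : dualMap L vacuum = vacuum := by
  have : ∀ j, dualDefect L j vacuum = 0 := fun j => by
    simp [dualDefect, maxwellDual, hodge, hodgeUp, fOf_vacuum]
  simp [dualMap, this]

lemma hasFDerivAt_dualMap (hL : IsMaxwellLike U L) (hL2 : ContDiffOn ℝ 2 L U) :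
    HasFDerivAt (dualMap L) (ContinuousLinearMap.id ℝ FieldVal) vacuum := by
  have := (hasFDerivAt_id (𝕜 := ℝ) vacuum).add (HasFDerivAt.fun_sum (u := Finset.univ) fun j _ =>
    (hasFDerivAt_dualDefect hL hL2 j).smul_const
      ((Pi.single (Sum.inr (0, j.succ)) 1 : FieldVal) - Pi.single (Sum.inr (j.succ, 0)) 1))
  convert! this using 1
  ext z
  simp

/-- A ball of pairs `(g, F)` around `(m, 0)` on which `F` is determined by `𝔇` and `𝔅`, and whose
invariants lie in a ball in `U`. -/
structure GoodBall (U : Set (ℝ × ℝ)) (L : ℝ × ℝ → ℝ) where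
  radius : ℝ
  radius_pos : 0 < radius
  good : ∀ y ∈ Metric.closedBall vacuum radius, IsGood U L y
  inverse : FieldVal → FieldVal
  domain : Set FieldVal
  isOpen_domain : IsOpen domain
  subset_domain : Metric.closedBall vacuum radius ⊆ domain
  inverse_dualMap : ∀ y ∈ Metric.closedBall vacuum radius, inverse (dualMap L y) = y
  contDiffOn_inverse : ∀ n : ℕ, ContDiffOn ℝ ((n + 1 : ℕ) : WithTop ℕ∞) L U →
    ContDiffOn ℝ (n : WithTop ℕ∞) inverse domain
  invRadius : ℝ
  invRadius_pos : 0 < invRadius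
  closedBall_subset : Metric.closedBall (0 : ℝ × ℝ) invRadius ⊆ U
  inv2_mem : ∀ y ∈ Metric.closedBall vacuum radius, inv2 y ∈ Metric.closedBall (0 : ℝ × ℝ) invRadius

/-- All the requirements are open conditions that hold at `(m, 0)`, and `L ∈ C²` suffices to see
this. The radius is therefore chosen before `N`. -/
lemma nonempty_goodBall (hL : IsMaxwellLike U L) (hL2 : ContDiffOn ℝ 2 L U) :
    Nonempty (GoodBall U L) := by
  have hg := isGood_vacuum hL
  have hR := isOpen_regularPairs hL.isOpen
  obtain ⟨r, hr, hrU⟩ := Metric.nhds_basis_closedBall.mem_iff.1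
    (hL.isOpen.mem_nhds (show (0 : ℝ × ℝ) ∈ U from hL.zero_mem))
  obtain ⟨V, hV, V', hV', hoV', g, hg1, hg2⟩ := exists_local_inverse hR hg.regular
    (contDiffOn_dualMap (n := 1) hL.isOpen hL2) (hasFDerivAt_dualMap hL hL2)
  rw [dualMap_vacuum] at hV'
  have hi : inv2 ⁻¹' Metric.closedBall (0 : ℝ × ℝ) r ∈ 𝓝 vacuum := by
    refine (((contDiffOn_inv2 (n := 0)).continuousOn).continuousAt
      (isOpen_lorentzPairs.mem_nhds (regularPairs_subset hg.regular))).preimage_mem_nhds ?_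
    rw [inv2_vacuum]
    exact Metric.closedBall_mem_nhds _ hr
  obtain ⟨ρ, hρ, hsub⟩ := Metric.nhds_basis_closedBall.mem_iff.1
    (Filter.inter_mem (Filter.inter_mem ((isOpen_setOf_isGood hL.isOpen hL2).mem_nhds hg) hi)
      (Filter.inter_mem hV hV'))
  exact ⟨⟨ρ, hρ, fun y hy => (hsub hy).1.1, g, V', hoV', fun y hy => (hsub hy).2.2,
    fun y hy => hg1 y (hsub hy).2.1, fun n hn => hg2 n (contDiffOn_dualMap hL.isOpen hn),
    r, hr, hrU, fun y hy => (hsub hy).1.2⟩⟩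

end Coefficients

end EinsteinNLEM

namespace EinsteinNLEM

/-! ### The magnetic part of `F` in terms of `𝔅` -/

section InitialFaradayAlgebra

/-- The magnetic components `F_{23}, F_{31}, F_{12}` of a two-form. -/
def magnetic (F : Fin 4 → Fin 4 → ℝ) (k : Fin 3) : ℝ := F (k + 1).succ (k + 2).succ

/-- The alternating symbol in three dimensions. -/
def rotSign (a b k : Fin 3) : ℝ :=
  if b = a + 1 ∧ k = a + 2 then 1 else if a = b + 1 ∧ k = b + 2 then -1 else 0

lemma spatial_eq_sum_magnetic {F : Fin 4 → Fin 4 → ℝ} (hF : ∀ μ ν, F μ ν = -F ν μ) (a b : Fin 3) :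
    F a.succ b.succ = ∑ k, rotSign a b k * magnetic F k := by
  have h0 : ∀ μ, F μ μ = 0 := fun μ => by linarith [hF μ μ]
  fin_cases a <;> fin_cases b <;>
    simp [rotSign, magnetic, h0] <;>
    first
      | rfl
      | exact hF _ _

lemma hodgeUp_succ_zero (g : Matrix (Fin 4) (Fin 4) ℝ) {F : Fin 4 → Fin 4 → ℝ}
    (hF : ∀ μ ν, F μ ν = -F ν μ) (k : Fin 3) :
    hodgeUp g F k.succ 0 = (Real.sqrt |g.det|)⁻¹ * magnetic F k := by
  have h1 := hF 2 1
  have h2 := hF 1 3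
  have h3 := hF 3 2
  simp only [hodgeUp, magnetic]
  generalize Real.sqrt |g.det| = c
  fin_cases k
  · simp [antisym, Fin.sum_univ_succ, Matrix.det_succ_row_zero, Fin.succAbove]
    rw [h3]; ring
  · simp [antisym, Fin.sum_univ_succ, Matrix.det_succ_row_zero, Fin.succAbove]
    rw [h2]; ring
  · simp [antisym, Fin.sum_univ_succ, Matrix.det_succ_row_zero, Fin.succAbove]
    rw [h1]; ring

lemma hodge_succ_zero {g : Matrix (Fin 4) (Fin 4) ℝ} (hg : ∀ k : Fin 3, g 0 k.succ = 0)
    (hg' : ∀ k : Fin 3, g k.succ 0 = 0) {F : Fin 4 → Fin 4 → ℝ} (hF : ∀ μ ν, F μ ν = -F ν μ)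
    (j : Fin 3) :
    hodge g F j.succ 0
      = g 0 0 * (Real.sqrt |g.det|)⁻¹ * ∑ k : Fin 3, g j.succ k.succ * magnetic F k := by
  simp only [hodge, Fin.sum_univ_succ (n := 3), hg, hg', mul_zero, zero_mul, add_zero,
    Finset.sum_const_zero, zero_add, hodgeUp_succ_zero g hF, Finset.mul_sum]
  refine Finset.sum_congr rfl fun k _ => ?_
  ring

/-- The coefficient of `𝔅_j` in the magnetic components of `F`. -/
noncomputable def magneticCoeff (k j : Fin 3) (y : FieldVal) : ℝ :=
  Real.sqrt |(gOf y).det| * (Real.sqrt (-gOf y 0 0))⁻¹ * (gSpace y)⁻¹ k j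

/-- When the shift vanishes, `⋆F_{j0}` involves the magnetic components only, through the matrix
`g_{jk}`. The relation to `𝔅` is thus linear with coefficients that depend on the metric alone, and
is inverted by the spatial inverse metric. -/
lemma magnetic_eq_of_induction {y : FieldVal} (hdet : (gOf y).det ≠ 0) (h00 : gOf y 0 0 < 0)
    (hs : (gSpace y).det ≠ 0)
    (hg : ∀ k : Fin 3, gOf y 0 k.succ = 0) (hg' : ∀ k : Fin 3, gOf y k.succ 0 = 0)
    (hF : ∀ μ ν, fOf y μ ν = -fOf y ν μ) {B : Fin 3 → ℝ}
    (hB : ∀ j, B j = -(hodge (gOf y) (fOf y) j.succ 0 * (Real.sqrt (-gOf y 0 0))⁻¹)) (k : Fin 3) :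
    magnetic (fOf y) k = ∑ j, magneticCoeff k j y * B j := by
  set A := Real.sqrt (-gOf y 0 0) with hA
  set d := Real.sqrt |(gOf y).det| with hd
  have hA0 : 0 < A := Real.sqrt_pos.2 (by linarith)
  have hd0 : 0 < d := Real.sqrt_pos.2 (abs_pos.2 hdet)
  have hA2 : gOf y 0 0 = -(A * A) := by
    rw [hA, Real.mul_self_sqrt (by linarith)]; ring
  have hB' : B = fun j => A * d⁻¹ * (gSpace y).mulVec (magnetic (fOf y)) j := by
    ext j
    rw [hB, hodge_succ_zero hg hg' hF, hA2, Matrix.mulVec, dotProduct]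
    simp only [gSpace, Matrix.of_apply]
    field_simp
    exact mul_comm _ _
  have hinv : (gSpace y)⁻¹.mulVec ((gSpace y).mulVec (magnetic (fOf y))) = magnetic (fOf y) := by
    rw [Matrix.mulVec_mulVec, Matrix.nonsing_inv_mul _ (isUnit_iff_ne_zero.2 hs),
      Matrix.one_mulVec]
  rw [hB']
  conv_lhs => rw [← hinv]
  rw [Matrix.mulVec, dotProduct]
  refine Finset.sum_congr rfl fun j _ => ?_
  simp only [magneticCoeff]
  rw [← hd, ← hA]
  field_simp

end InitialFaradayAlgebra

/-! ### From the slab of existence to the half-space -/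

section SlabToHalf

variable {T : ℝ}

lemma slab_eventuallyEq_half {p : Spacetime} (hp : p.1 < T) : slab T =ᶠ[𝓝 p] half := by
  rw [Filter.eventuallyEq_set]
  filter_upwards [(isOpen_lt continuous_fst continuous_const).mem_nhds hp] with q hq
  have hq' : q.1 < T := hq
  simp [slab, half, hq']

lemma pd_slab_eq {p : Spacetime} (hp : p.1 < T) (μ : Fin 4) (u : Spacetime → ℝ) :
    pd (slab T) μ u p = D μ u p := by
  simp only [D, pd, fderivWithin_congr_set (slab_eventuallyEq_half hp)]

lemma eventually_lt_time (hT : 0 < T) (x : Space) :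
    ∀ᶠ p in 𝓝[half] ((0, x) : Spacetime), p.1 < T :=
  mem_nhdsWithin_of_mem_nhds ((isOpen_lt continuous_fst continuous_const).mem_nhds hT)

lemma eventually_mem_slab (hT : 0 < T) (x : Space) :
    ∀ᶠ p in 𝓝[half] ((0, x) : Spacetime), p ∈ slab T := by
  filter_upwards [eventually_lt_time hT x, self_mem_nhdsWithin] with p hp hp'
  exact ⟨⟨hp'.1, hp⟩, trivial⟩

/-- Only germs at `t = 0` matter, and there the slab and the half-space coincide. The time of
existence thus disappears, and all solutions are treated on one common domain. -/
lemma germEq_pd_slab (hT : 0 < T) (μ : Fin 4) (u : Spacetime → ℝ) :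
    GermEq (pd (slab T) μ u) (D μ u) := fun x => by
  filter_upwards [eventually_lt_time hT x] with p hp using pd_slab_eq hp μ u

lemma germEq_pd_pd_slab (hT : 0 < T) (μ ν : Fin 4) (u : Spacetime → ℝ) :
    GermEq (pd (slab T) μ (pd (slab T) ν u)) (D μ (D ν u)) :=
  (germEq_pd_slab hT μ _).trans ((germEq_pd_slab hT ν u).D μ)

lemma smooth_of_contDiffOn_slab (hT : 0 < T) {n : ℕ} {u : Spacetime → ℝ}
    (h : ContDiffOn ℝ (n : WithTop ℕ∞) u (slab T)) : Smooth n u := fun x =>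
  (h (0, x) ⟨⟨le_rfl, hT⟩, trivial⟩).congr_set (slab_eventuallyEq_half (p := (0, x)) hT)

lemma germEq_sum_mul {β : Type*} {s : Finset β} {a u v : β → Spacetime → ℝ}
    (h : ∀ b ∈ s, GermEq (u b) (v b)) :
    GermEq (fun p => ∑ b ∈ s, a b p * u b p) (fun p => ∑ b ∈ s, a b p * v b p) := fun x => by
  filter_upwards [(Finset.eventually_all s).2 fun b hb => h b hb x] with p hp
  exact Finset.sum_congr rfl fun b hb => by rw [hp b hb]

lemma germEq_covZIter (hT : 0 < T) (I : List ZLabel) (U : Fin 4 → Fin 4 → Spacetime → ℝ)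
    (α β : Fin 4) :
    GermEq (I.foldr (covZ (slab T)) U α β) (I.foldr (covZ half) U α β) := by
  induction I generalizing α β with
  | nil => exact GermEq.refl _
  | cons Z I ih =>
    simp only [List.foldr_cons]
    exact germEq_sum_mul fun κ _ => (germEq_pd_slab hT κ _).trans ((ih α β).D κ)

lemma germEq_lieZIter (hT : 0 < T) (I : List ZLabel) (U : Fin 4 → Fin 4 → Spacetime → ℝ)
    (α β : Fin 4) :
    GermEq (I.foldr (lieZ (slab T)) U α β) (I.foldr (lieZ half) U α β) := by
  induction I generalizing α β with
  | nil => exact GermEq.refl _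
  | cons Z I ih =>
    intro x
    have h1 : ∀ᶠ p in 𝓝[half] ((0, x) : Spacetime), ∀ κ,
        pd (slab T) κ (I.foldr (lieZ (slab T)) U α β) p = D κ (I.foldr (lieZ half) U α β) p :=
      eventually_all.2 fun κ => (germEq_pd_slab hT κ _).trans ((ih α β).D κ) x
    have h2 : ∀ᶠ p in 𝓝[half] ((0, x) : Spacetime), ∀ κ,
        I.foldr (lieZ (slab T)) U κ β p = I.foldr (lieZ half) U κ β p :=
      eventually_all.2 fun κ => ih κ β x
    have h3 : ∀ᶠ p in 𝓝[half] ((0, x) : Spacetime), ∀ κ,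
        I.foldr (lieZ (slab T)) U α κ p = I.foldr (lieZ half) U α κ p :=
      eventually_all.2 fun κ => ih α κ x
    filter_upwards [h1, h2, h3, eventually_lt_time hT x] with p e1 e2 e3 hp
    simp only [List.foldr_cons, lieZ, e1, e2, e3, pd_slab_eq hp]

end SlabToHalf

/-! ### Reading off bounds from the data norm -/

section DataNorm

lemma lintegral_sdList_le_of_sobolevSq_le {κ : Type*} [Fintype κ] {N : ℕ} {η : ℝ}
    {u : κ → Space → ℝ} {B : ℝ≥0∞} (h : sobolevSq N η u ≤ B) (i : κ) (I : List (Fin 3))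
    (hI : I.length ≤ N) :
    ∫⁻ y, ENNReal.ofReal ((jp y ^ (η + I.length) * sdList I (u i) y) ^ 2) ≤ B := by
  have hJ : ∀ i, sdIter I.get (u i) = sdList I (u i) := fun i => by rw [sdIter, List.ofFn_get]
  refine le_trans ?_ h
  refine le_trans ?_ (Finset.single_le_sum (f := fun k => ∑ I : Fin k → Fin 3,
    ∫⁻ x : Space, ENNReal.ofReal
      ((1 + ‖x‖ ^ 2) ^ (η + (k : ℝ)) * ∑ i, (sdIter I (u i) x) ^ 2)) (fun _ _ => zero_le)
    (Finset.mem_range.2 (Nat.lt_succ_of_le hI)))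
  refine le_trans ?_ (Finset.single_le_sum (f := fun J : Fin I.length → Fin 3 =>
    ∫⁻ x : Space, ENNReal.ofReal
      ((1 + ‖x‖ ^ 2) ^ (η + (I.length : ℝ)) * ∑ i, (sdIter J (u i) x) ^ 2)) (fun _ _ => zero_le)
    (Finset.mem_univ I.get))
  refine lintegral_mono fun x => ENNReal.ofReal_le_ofReal ?_
  rw [mul_pow, ← jp_rpow_eq, mul_comm 2, Real.rpow_mul (jp_pos x).le, Real.rpow_two]
  refine mul_le_mul_of_nonneg_left ?_ (by positivity)
  rw [← hJ]
  exact Finset.single_le_sum (f := fun i => sdIter I.get (u i) x ^ 2) (fun _ _ => sq_nonneg _)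
    (Finset.mem_univ i)

lemma AbstractData.sobolev_le {N : ℕ} {γ : ℝ} {d : AbstractData} {S : ℝ} (hS : 0 ≤ S)
    (h : d.norm N γ ≤ ENNReal.ofReal S) :
    sobolevSq N (1 / 2 + γ) (fun i : Fin 3 × Fin 3 × Fin 3 => sd i.1 (d.h1 i.2.1 i.2.2))
        ≤ ENNReal.ofReal (S ^ 2)
      ∧ sobolevSq N (1 / 2 + γ) (fun i : Fin 3 × Fin 3 => d.K i.1 i.2) ≤ ENNReal.ofReal (S ^ 2)
      ∧ sobolevSq N (1 / 2 + γ) d.D ≤ ENNReal.ofReal (S ^ 2)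
      ∧ sobolevSq N (1 / 2 + γ) d.B ≤ ENNReal.ofReal (S ^ 2) := by
  rw [AbstractData.norm] at h
  have h2 := ENNReal.rpow_le_rpow h (z := 2) (by norm_num)
  rw [← ENNReal.rpow_mul, ENNReal.ofReal_rpow_of_nonneg hS (by norm_num), Real.rpow_two] at h2
  norm_num at h2
  refine ⟨?_, ?_, ?_, ?_⟩
  · exact (le_add_right (le_add_right le_self_add)).trans h2
  · exact (le_add_right (le_add_right le_add_self)).trans h2
  · exact (le_add_right le_add_self).trans h2
  · exact le_add_self.trans h2

lemma IsLittleOInfty.tendsto_sdList {n : ℕ} {a : ℝ} (ha : 0 ≤ a) {f : Space → ℝ}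
    (h : IsLittleOInfty n a f) (I : List (Fin 3)) (hI : I.length ≤ n) :
    Tendsto (sdList I f) (cocompact Space) (𝓝 0) := by
  have h1 := h.2 I.length hI I.get
  rw [sdIter, List.ofFn_get] at h1
  refine squeeze_zero_norm' ?_ h1
  have h2 : ∀ᶠ x : Space in cocompact Space, 1 ≤ ‖x‖ :=
    (tendsto_norm_cocompact_atTop (E := Space)).eventually_ge_atTop 1
  filter_upwards [h2] with x hx
  exact le_mul_of_one_le_left (abs_nonneg _) (Real.one_le_rpow hx (by positivity))

end DataNorm

end EinsteinNLEM

/-! ### Families of solutions with small data -/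

namespace EinsteinNLEM

variable {χ : ℝ → ℝ} {U : Set (ℝ × ℝ)} {L : ℝ × ℝ → ℝ} {γ δ : ℝ} {N : ℕ}

/-- A solution of the reduced system that is launched by asymptotically flat data of norm and mass
at most `size ≤ δ`. -/
structure Launch (χ : ℝ → ℝ) (U : Set (ℝ × ℝ)) (L : ℝ × ℝ → ℝ) (γ : ℝ) (N : ℕ) (δ : ℝ) where
  κ : ℝ
  d : AbstractData
  T : ℝ
  h1 : Fin 4 → Fin 4 → Spacetime → ℝ
  F : Fin 4 → Fin 4 → Spacetime → ℝ
  size : ℝ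
  κ_pos : 0 < κ
  M_nonneg : 0 ≤ d.M
  T_pos : 0 < T
  flat : d.AsymptoticallyFlat N κ
  solution : IsReducedSolution χ U L d.M N T h1 F
  launched : IsLaunchedBy χ L d T h1 F
  size_nonneg : 0 ≤ size
  size_le : size ≤ δ
  norm_le : d.norm N γ ≤ ENNReal.ofReal size
  M_le : d.M ≤ size

namespace Launch

/-- The components of `(g, F)`. -/
noncomputable def val (S : Launch χ U L γ N δ) (p : Spacetime) : FieldVal :=
  Sum.elim (fun i => spacetimeMetric χ S.d.M S.h1 p i.1 i.2) fun i => S.F i.1 i.2 p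

/-- The components of `(g, 0)`. -/
noncomputable def metricVal (S : Launch χ U L γ N δ) (p : Spacetime) : FieldVal :=
  Sum.elim (fun i => spacetimeMetric χ S.d.M S.h1 p i.1 i.2) fun _ => 0

variable (S : Launch χ U L γ N δ)

lemma gOf_val (p : Spacetime) : gOf (S.val p) = spacetimeMetric χ S.d.M S.h1 p := by ext; rfl

lemma gOf_metricVal (p : Spacetime) : gOf (S.metricVal p) = spacetimeMetric χ S.d.M S.h1 p := by
  ext; rfl

lemma metric_zero (x : Space) : spacetimeMetric χ S.d.M S.h1 (0, x) = S.d.metric4 χ x :=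
  Matrix.ext fun μ ν => S.launched.metric x μ ν

lemma smooth_F (μ ν : Fin 4) : Smooth N (S.F μ ν) :=
  smooth_of_contDiffOn_slab S.T_pos (S.solution.F_regular μ ν)

lemma smooth_h1 (μ ν : Fin 4) : Smooth (N + 1) (S.h1 μ ν) :=
  smooth_of_contDiffOn_slab S.T_pos (S.solution.h1_regular μ ν)

lemma mem_slab (x : Space) : ((0, x) : Spacetime) ∈ slab S.T := ⟨⟨le_rfl, S.T_pos⟩, trivial⟩

lemma F_antisymm (x : Space) (μ ν : Fin 4) : fOf (S.val (0, x)) μ ν = -fOf (S.val (0, x)) ν μ :=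
  S.solution.F_antisymm μ ν _ (S.mem_slab x)

lemma lintegral_h1_le (j k l : Fin 3) (I : List (Fin 3)) (hI : I.length ≤ N) :
    ∫⁻ y, ENNReal.ofReal ((jp y ^ (1 / 2 + γ + I.length) * sdList I (sd j (S.d.h1 k l)) y) ^ 2)
      ≤ ENNReal.ofReal (S.size ^ 2) :=
  lintegral_sdList_le_of_sobolevSq_le (AbstractData.sobolev_le S.size_nonneg S.norm_le).1
    (j, k, l) I hI

lemma lintegral_K_le (j k : Fin 3) (I : List (Fin 3)) (hI : I.length ≤ N) :
    ∫⁻ y, ENNReal.ofReal ((jp y ^ (1 / 2 + γ + I.length) * sdList I (S.d.K j k) y) ^ 2)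
      ≤ ENNReal.ofReal (S.size ^ 2) :=
  lintegral_sdList_le_of_sobolevSq_le (AbstractData.sobolev_le S.size_nonneg S.norm_le).2.1
    (j, k) I hI

lemma lintegral_D_le (j : Fin 3) (I : List (Fin 3)) (hI : I.length ≤ N) :
    ∫⁻ y, ENNReal.ofReal ((jp y ^ (1 / 2 + γ + I.length) * sdList I (S.d.D j) y) ^ 2)
      ≤ ENNReal.ofReal (S.size ^ 2) :=
  lintegral_sdList_le_of_sobolevSq_le (AbstractData.sobolev_le S.size_nonneg S.norm_le).2.2.1
    j I hI

lemma lintegral_B_le (j : Fin 3) (I : List (Fin 3)) (hI : I.length ≤ N) :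
    ∫⁻ y, ENNReal.ofReal ((jp y ^ (1 / 2 + γ + I.length) * sdList I (S.d.B j) y) ^ 2)
      ≤ ENNReal.ofReal (S.size ^ 2) :=
  lintegral_sdList_le_of_sobolevSq_le (AbstractData.sobolev_le S.size_nonneg S.norm_le).2.2.2
    j I hI

lemma tendsto_sdList_sd_h1 (j k l : Fin 3) (I : List (Fin 3)) (hI : I.length ≤ N) :
    Tendsto (sdList I (sd j (S.d.h1 k l))) (cocompact Space) (𝓝 0) := by
  rw [← sdList_append]
  exact (S.flat.h1 k l).tendsto_sdList (by linarith [S.κ_pos]) _ (by simpa using hI)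

end Launch

lemma lapse_sq_eq {d : AbstractData} {x : Space} (h : 2 * d.M * newton χ x ≤ 1) :
    d.lapse χ x ^ 2 = 1 - 2 * d.M * newton χ x := by
  have : 1 - 2 * d.M / ‖x‖ * χ ‖x‖ = 1 - 2 * d.M * newton χ x := by
    rw [newton]; ring
  rw [AbstractData.lapse, this, Real.sq_sqrt (by linarith)]

lemma metric_apply (d : AbstractData) (x : Space) (j k : Fin 3) :
    d.metric χ x j k = (if j = k then 1 else 0) + (if j = k then 2 * d.M * newton χ x else 0)
      + d.h1 j k x := by
  simp only [AbstractData.metric, Matrix.of_apply, newton]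
  split_ifs <;> ring

/-! ### Pointwise bounds on the data -/

section PointwiseBounds

/-- Only the first three derivatives of the norm enter, so the constant is chosen before `N`. For
`h̲^{(1)}` the decay `r^{-2}` of the gradient is integrated along rays. -/
lemma exists_data_bound (hχ : IsCutoff χ) (hγ : 0 < γ) :
    ∃ C : ℝ, 0 ≤ C ∧ ∀ (U : Set (ℝ × ℝ)) (L : ℝ × ℝ → ℝ) (N : ℕ) (δ : ℝ), 3 ≤ N →
      ∀ (S : Launch χ U L γ N δ) (x : Space),
      (∀ j k, |S.d.h1 j k x| ≤ C * S.size * jp x ^ (-1 : ℝ)) ∧ (∀ j, |S.d.D j x| ≤ C * S.size) ∧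
      (∀ j, |S.d.B j x| ≤ C * S.size) ∧ |2 * S.d.M * newton χ x| ≤ C * S.size := by
  obtain ⟨C₀, hC₀, h₀⟩ := exists_pointwise_bound hγ
  obtain ⟨C₁, hC₁, h₁⟩ := (isSymbol_newton hχ).bound []
  refine ⟨12 * C₀ + 2 * C₁, by positivity, fun U L N δ hN S x => ?_⟩
  have hs := S.size_nonneg
  have hκ := S.κ_pos
  have hj : jp x ^ (-2 : ℝ) ≤ 1 := Real.rpow_le_one_of_one_le_of_nonpos (one_le_jp x) (by norm_num)
  have hj1 : jp x ^ (-1 : ℝ) ≤ 1 :=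
    Real.rpow_le_one_of_one_le_of_nonpos (one_le_jp x) (by norm_num)
  have key : ∀ a : ℝ, |a| ≤ C₀ * S.size * jp x ^ (-2 : ℝ) → |a| ≤ (12 * C₀ + 2 * C₁) * S.size := by
    intro a ha
    have h1 : 0 ≤ C₀ * S.size := by positivity
    have h2 : 0 ≤ C₁ * S.size := by positivity
    nlinarith
  refine ⟨fun j k => ?_, fun j => key _ ?_, fun j => key _ ?_, ?_⟩
  · have hd : ∀ l y, |sd l (S.d.h1 j k) y| ≤ C₀ * S.size * jp y ^ (-2 : ℝ) := fun l y => by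
      simpa [sdList] using h₀ N (sd l (S.d.h1 j k)) S.size hs (contDiff_sd (S.flat.h1 j k).1 l)
        (fun I hI => S.tendsto_sdList_sd_h1 l j k I hI.le) (S.lintegral_h1_le l j k) []
        (by simpa using hN) y
    have := abs_le_of_sd_le ((S.flat.h1 j k).1.of_le (by norm_cast; omega))
      ((S.flat.h1 j k).tendsto_sdList (by linarith) [] (by simp)) (by positivity) hd x
    refine this.trans (mul_le_mul_of_nonneg_right ?_ (jp_rpow_pos x _).le)
    nlinarith [mul_nonneg hC₁ hs]
  · simpa [sdList] using h₀ N (S.d.D j) S.size hs (S.flat.D j).1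
      (fun I hI => (S.flat.D j).tendsto_sdList (by linarith) I hI.le) (S.lintegral_D_le j) []
      (by simpa using hN) x
  · simpa [sdList] using h₀ N (S.d.B j) S.size hs (S.flat.B j).1
      (fun I hI => (S.flat.B j).tendsto_sdList (by linarith) I hI.le) (S.lintegral_B_le j) []
      (by simpa using hN) x
  · have h2 := h₁ x
    simp only [sdList, List.length_nil, Nat.cast_zero, add_zero] at h2
    have h3 : |newton χ x| ≤ C₁ := h2.trans (by nlinarith)
    rw [abs_mul, abs_of_nonneg (by linarith [S.M_nonneg])]
    have h4 : S.d.M * |newton χ x| ≤ S.size * C₁ :=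
      mul_le_mul S.M_le h3 (abs_nonneg _) hs
    nlinarith [mul_nonneg hC₀ hs]

end PointwiseBounds

/-! ### Smallness of the initial Faraday tensor -/

section InitialFaraday

lemma contDiffOn_sqrt_g00 {n : WithTop ℕ∞} :
    ContDiffOn ℝ n (fun y => Real.sqrt (-gOf y 0 0)) {y | IsGood U L y} :=
  (contDiff_gOf 0 0).neg.contDiffOn.sqrt fun _ hy => (neg_pos.2 (IsGood.g00 hy)).ne'

lemma contDiffOn_gSpaceInv {n : WithTop ℕ∞} (j k : Fin 3) :
    ContDiffOn ℝ n (fun y => (gSpace y)⁻¹ j k) {y | IsGood U L y} :=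
  contDiffOn_matrix_inv (A := gSpace) (fun i j => (contDiff_gOf i.succ j.succ).contDiffOn)
    (fun _ hy => (IsGood.gSpace hy).ne') j k

lemma contDiffOn_magneticCoeff {n : WithTop ℕ∞} (k j : Fin 3) :
    ContDiffOn ℝ n (magneticCoeff k j) {y | IsGood U L y} :=
  ((contDiffOn_sqrt_det.mono fun _ hy => (IsGood.regular hy).1).mul
    (contDiffOn_sqrt_g00.inv fun _ hy =>
      (Real.sqrt_pos.2 (neg_pos.2 (IsGood.g00 hy))).ne')).mul (contDiffOn_gSpaceInv k j)

/-- The definition of `⋆𝓜` is solved for `F_{j0}`, with `⋆F_{j0}` replaced by `𝔅`. The right side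
still contains `F` in the arguments of the derivatives of `L`, but it is linear in the data, and so
inherits their decay. -/
lemma electric_eq {y : FieldVal} (hy : IsGood U L y) {j : Fin 3} {a b : ℝ}
    (ha : a = -(maxwellDual L (gOf y) (fOf y) j.succ 0 * (Real.sqrt (-gOf y 0 0))⁻¹))
    (hb : b = -(hodge (gOf y) (fOf y) j.succ 0 * (Real.sqrt (-gOf y 0 0))⁻¹)) :
    fOf y j.succ 0 = Real.sqrt (-gOf y 0 0) * (2 * lagD1 L (inv2 y))⁻¹
      * (lagD2 L (inv2 y) * b - a) := by
  have hA : 0 < Real.sqrt (-gOf y 0 0) := Real.sqrt_pos.2 (neg_pos.2 hy.g00)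
  have hl : lagD1 L (inv2 y) ≠ 0 := by linarith [hy.lag1]
  rw [ha, hb, maxwellDual, ← inv2]
  field_simp
  ring

lemma dualMap_inl (y : FieldVal) (i : Fin 4 × Fin 4) :
    dualMap L y (Sum.inl i) = y (Sum.inl i) := by
  simp [dualMap]

lemma dualMap_magnetic (y : FieldVal) (a b : Fin 3) :
    dualMap L y (Sum.inr (a.succ, b.succ)) = fOf y a.succ b.succ := by
  simp [dualMap, fOf, (Fin.succ_ne_zero _)]

lemma dualMap_zero_zero (y : FieldVal) :
    dualMap L y (Sum.inr (0, 0)) = fOf y 0 0 := by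
  simp [dualMap, fOf, (Fin.succ_ne_zero _).symm]

lemma dualMap_succ_zero (y : FieldVal) (j : Fin 3) :
    dualMap L y (Sum.inr (j.succ, 0)) = -maxwellDual L (gOf y) (fOf y) j.succ 0 := by
  simp [dualMap, Pi.single_apply, (Fin.succ_ne_zero _), dualDefect, fOf]

lemma dualMap_zero_succ {y : FieldVal} (hF : ∀ μ ν, fOf y μ ν = -fOf y ν μ) (j : Fin 3) :
    dualMap L y (Sum.inr (0, j.succ)) = maxwellDual L (gOf y) (fOf y) j.succ 0 := by
  have := hF 0 j.succ
  simp [dualMap, Pi.single_apply, (Fin.succ_ne_zero _).symm, dualDefect, fOf] at this ⊢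
  linarith

namespace Launch

variable (S : Launch χ U L γ N δ)

lemma lapse_eq (x : Space) : S.d.lapse χ x = Real.sqrt (-gOf (S.val (0, x)) 0 0) := by
  rw [gOf_val, metric_zero]
  simp [AbstractData.metric4, Real.sqrt_sq (Real.sqrt_nonneg _), AbstractData.lapse]

lemma displacement (x : Space) (j : Fin 3) :
    S.d.D j x = -(maxwellDual L (gOf (S.val (0, x))) (fOf (S.val (0, x))) j.succ 0
      * (Real.sqrt (-gOf (S.val (0, x)) 0 0))⁻¹) := by
  rw [← lapse_eq, gOf_val, metric_zero]
  exact S.launched.faraday.displacement x j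

lemma induction (x : Space) (j : Fin 3) :
    S.d.B j x = -(hodge (gOf (S.val (0, x))) (fOf (S.val (0, x))) j.succ 0
      * (Real.sqrt (-gOf (S.val (0, x)) 0 0))⁻¹) := by
  rw [← lapse_eq, gOf_val, metric_zero]
  exact S.launched.faraday.induction x j

lemma maxwellDual_eq {x : Space} (h : gOf (S.val (0, x)) 0 0 < 0) (j : Fin 3) :
    maxwellDual L (gOf (S.val (0, x))) (fOf (S.val (0, x))) j.succ 0
      = -(Real.sqrt (-gOf (S.val (0, x)) 0 0) * S.d.D j x) := by
  have hA : 0 < Real.sqrt (-gOf (S.val (0, x)) 0 0) := Real.sqrt_pos.2 (neg_pos.2 h)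
  rw [displacement]
  field_simp

lemma magnetic_eq {x : Space} (h : IsGood U L (S.val (0, x))) (k : Fin 3) :
    magnetic (fOf (S.val (0, x))) k = ∑ j, magneticCoeff k j (S.val (0, x)) * S.d.B j x := by
  refine magnetic_eq_of_induction h.regular.1.ne h.g00 h.gSpace.ne' ?_ ?_ (S.F_antisymm x)
    (S.induction x) k
  · intro k; rw [gOf_val, metric_zero]; simp [AbstractData.metric4]
  · intro k; rw [gOf_val, metric_zero]; simp [AbstractData.metric4]

end Launch

lemma abs_rotSign_le (a b k : Fin 3) : |rotSign a b k| ≤ 1 := by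
  rw [rotSign]; split_ifs <;> simp

/-- The smallness of `(g, F)` along `{t = 0}`. -/
structure Launch.IsSmall (S : Launch χ U L γ N δ) (ρ : ℝ) : Prop where
  val_mem : ∀ x, S.val (0, x) ∈ Metric.closedBall vacuum ρ
  metricVal_mem : ∀ x, S.metricVal (0, x) ∈ Metric.closedBall vacuum ρ
  dualMap_mem : ∀ x, dualMap L (S.val (0, x)) ∈ Metric.closedBall vacuum ρ
  mass : ∀ x, 2 * S.d.M * newton χ x ≤ 1 / 2

lemma mem_closedBall_vacuum {y : FieldVal} {ρ : ℝ} (hρ : 0 ≤ ρ) :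
    y ∈ Metric.closedBall vacuum ρ ↔
      (∀ i, |y (Sum.inl i) - mink i.1 i.2| ≤ ρ) ∧ ∀ i, |y (Sum.inr i)| ≤ ρ := by
  rw [Metric.mem_closedBall, dist_pi_le_iff hρ]
  simp [Sum.forall, vacuum, Real.dist_eq]

lemma metric4_sub_mink_le {d : AbstractData} {x : Space} {C : ℝ} (hC : 0 ≤ C)
    (h1 : ∀ j k, |d.h1 j k x| ≤ C) (hM : |2 * d.M * newton χ x| ≤ C)
    (hM' : 2 * d.M * newton χ x ≤ 1) (μ ν : Fin 4) : |d.metric4 χ x μ ν - mink μ ν| ≤ 2 * C := by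
  refine Fin.cases ?_ (fun j => ?_) μ
  · refine Fin.cases ?_ (fun k => ?_) ν
    · simp only [AbstractData.metric4, Matrix.of_apply, Fin.cases_zero, lapse_sq_eq hM',
        mink_zero_zero]
      rw [show -(1 - 2 * d.M * newton χ x) - -1 = 2 * d.M * newton χ x by ring]
      linarith
    · simpa [AbstractData.metric4, mink_zero_succ] using hC
  · refine Fin.cases ?_ (fun k => ?_) ν
    · simpa [AbstractData.metric4, mink_succ_zero] using hC
    · simp only [AbstractData.metric4, Matrix.of_apply, Fin.cases_succ, metric_apply,
        mink_succ_succ]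
      have := h1 j k
      rw [abs_le] at this hM ⊢
      split_ifs <;> constructor <;> linarith [this.1, this.2, hM.1, hM.2]

/-- The relations between `F` and `𝔇, 𝔅` determine `F` only among weak fields, so smallness cannot
be read off pointwise. The set of points where `|F| ≤ ρ` is closed by continuity and nonempty
because `F` vanishes at infinity. On this set the relations improve the bound to `|F| < ρ`, so it is
open as well, and hence is all of `ℝ³`. -/
lemma exists_isSmall (hχ : IsCutoff χ) (hγ : 0 < γ) (G : GoodBall U L) :
    ∃ δ : ℝ, 0 < δ ∧ δ ≤ 1 ∧ ∀ N : ℕ, 3 ≤ N → ∀ S : Launch χ U L γ N δ, S.IsSmall G.radius := by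
  obtain ⟨C, hC, hdata⟩ := exists_data_bound hχ hγ
  have hρ := G.radius_pos
  obtain ⟨K, hK, hKb⟩ : ∃ K : ℝ, 0 ≤ K ∧ ∀ k j, ∀ y ∈ Metric.closedBall vacuum G.radius,
      |magneticCoeff k j y| ≤ K := by
    have : ∀ k j, ∃ K : ℝ, ∀ y ∈ Metric.closedBall vacuum G.radius, |magneticCoeff k j y| ≤ K :=
      fun k j => (isCompact_closedBall vacuum G.radius).exists_bound_of_continuousOn
        ((contDiffOn_magneticCoeff (U := U) (L := L) (n := 0) k j).continuousOn.mono G.good)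
    choose K hK using this
    refine ⟨∑ k, ∑ j, |K k j|, by positivity, fun k j y hy => (hK k j y hy).trans ?_⟩
    refine (le_abs_self _).trans (le_trans ?_ (Finset.single_le_sum (f := fun k => ∑ j, |K k j|)
      (fun _ _ => by positivity) (Finset.mem_univ k)))
    exact Finset.single_le_sum (f := fun j => |K k j|) (fun _ _ => abs_nonneg _)
      (Finset.mem_univ j)
  -- The sum collects the bound `8C` on the electric part and `9KC` on the magnetic part; the
  -- summand `1` keeps the denominator positive.
  set Q := 8 * C + 9 * (K * C) + 1 with hQ
  have hKC : 0 ≤ K * C := by positivity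
  have hQs : ∀ s, 2 * Q * s = 2 * (8 * (C * s) + 9 * (K * C * s) + s) := fun s => by
    rw [hQ]; ring
  refine ⟨min 1 (min (1 / 2) G.radius / (2 * Q)), by positivity, min_le_left _ _,
    fun N hN S => ?_⟩
  have hs := S.size_nonneg
  have hsQ : 2 * Q * S.size ≤ min (1 / 2) G.radius := by
    have := S.size_le.trans (min_le_right _ _)
    rwa [le_div_iff₀ (by positivity), mul_comm] at this
  have hs1 := hsQ.trans (min_le_left _ _)
  have hs2 := hsQ.trans (min_le_right _ _)
  have hsum := hQs S.size
  have hCs : 0 ≤ C * S.size := by positivity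
  have hKCs : 0 ≤ K * C * S.size := by positivity
  have hjp : ∀ x, jp x ^ (-1 : ℝ) ≤ 1 := fun x =>
    Real.rpow_le_one_of_one_le_of_nonpos (one_le_jp x) (by norm_num)
  have hh1 : ∀ x j k, |S.d.h1 j k x| ≤ C * S.size := fun x j k =>
    ((hdata U L N _ hN S x).1 j k).trans (mul_le_of_le_one_right hCs (hjp x))
  have hM : ∀ x, 2 * S.d.M * newton χ x ≤ 1 / 2 := fun x => by
    have := (le_abs_self _).trans (hdata U L N _ hN S x).2.2.2
    linarith
  have hmet : ∀ x μ ν, |spacetimeMetric χ S.d.M S.h1 (0, x) μ ν - mink μ ν| ≤ G.radius := by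
    intro x μ ν
    rw [S.launched.metric]
    have := metric4_sub_mink_le hCs (hh1 x) (hdata U L N _ hN S x).2.2.2 ((hM x).trans (by norm_num))
      μ ν
    linarith
  have hA : ∀ x, Real.sqrt (-gOf (S.val (0, x)) 0 0) ≤ 2 := fun x => by
    rw [← S.lapse_eq]
    have h1 := lapse_sq_eq (d := S.d) (χ := χ) (x := x) ((hM x).trans (by norm_num))
    have h2 := neg_abs_le (2 * S.d.M * newton χ x)
    have h3 := (hdata U L N _ hN S x).2.2.2
    have h4 : 0 ≤ S.d.lapse χ x := Real.sqrt_nonneg _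
    nlinarith
  have hmem : ∀ x, (∀ α β, |S.F α β (0, x)| ≤ G.radius) →
      S.val (0, x) ∈ Metric.closedBall vacuum G.radius := fun x hx =>
    (mem_closedBall_vacuum hρ.le).2 ⟨fun i => hmet x i.1 i.2, fun i => hx i.1 i.2⟩
  -- The improvement: the weak bound by the radius puts `(g, F)` in the good ball, where `F` is
  -- bounded by a small multiple of the data.
  have himp : ∀ x, (∀ α β, |S.F α β (0, x)| ≤ G.radius) → ∀ α β, |S.F α β (0, x)| < G.radius := by
    intro x hx
    have hy := hmem x hx
    have hg := G.good _ hy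
    obtain ⟨-, hD, hB, -⟩ := hdata U L N _ hN S x
    have hmag : ∀ k, |magnetic (fOf (S.val (0, x))) k| ≤ 3 * (K * C * S.size) := fun k => by
      rw [S.magnetic_eq hg]
      calc |∑ j, magneticCoeff k j (S.val (0, x)) * S.d.B j x|
          ≤ ∑ j, |magneticCoeff k j (S.val (0, x)) * S.d.B j x| := Finset.abs_sum_le_sum_abs _ _
        _ ≤ ∑ _j : Fin 3, K * (C * S.size) := Finset.sum_le_sum fun j _ => by
            rw [abs_mul]
            exact mul_le_mul (hKb k j _ hy) (hB j) (abs_nonneg _) hK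
        _ = _ := by simp; ring
    -- The constant is `2 · 2 · 2`: bounds for the lapse, for `|2 ∂L/∂s₁|⁻¹`, and for the two data
    -- terms.
    have hele : ∀ j : Fin 3, |S.F j.succ 0 (0, x)| ≤ 8 * (C * S.size) := fun j => by
      have h1 := electric_eq hg (S.displacement x j) (S.induction x j)
      change S.F j.succ 0 (0, x) = _ at h1
      rw [h1, abs_mul, abs_mul, abs_of_nonneg (Real.sqrt_nonneg _), abs_inv]
      have h2 : |2 * lagD1 L (inv2 (S.val (0, x)))|⁻¹ ≤ 2 := by
        have := hg.lag1
        rw [abs_of_neg (by linarith)]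
        rw [inv_le_comm₀ (by linarith) (by norm_num)]
        linarith
      have h3 : |lagD2 L (inv2 (S.val (0, x))) * S.d.B j x - S.d.D j x| ≤ 2 * (C * S.size) := by
        refine (abs_sub _ _).trans ?_
        rw [abs_mul]
        nlinarith [hg.lag2, hB j, hD j, abs_nonneg (S.d.B j x), abs_nonneg (S.d.D j x)]
      calc _ ≤ 2 * 2 * (2 * (C * S.size)) := by
            refine mul_le_mul (mul_le_mul (hA x) h2 (by positivity) (by norm_num)) h3
              (abs_nonneg _) (by norm_num)
        _ = _ := by ring
    have hanti := S.F_antisymm x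
    intro α β
    have hlt : 8 * (C * S.size) + 9 * (K * C * S.size) < G.radius := by
      rcases hs.eq_or_lt with h | h
      · rw [← h]; simpa using hρ
      · linarith
    refine lt_of_le_of_lt ?_ hlt
    change |fOf (S.val (0, x)) α β| ≤ _
    refine Fin.cases ?_ (fun a => ?_) α
    · refine Fin.cases ?_ (fun b => ?_) β
      · have : fOf (S.val (0, x)) 0 0 = 0 := by linarith [hanti 0 0]
        rw [this, abs_zero]; positivity
      · rw [hanti, abs_neg]
        exact (hele b).trans (by linarith)
    · refine Fin.cases ?_ (fun b => ?_) β
      · exact (hele a).trans (by linarith)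
      · rw [spatial_eq_sum_magnetic hanti]
        calc |∑ k, rotSign a b k * magnetic (fOf (S.val (0, x))) k|
            ≤ ∑ k, |rotSign a b k * magnetic (fOf (S.val (0, x))) k| :=
              Finset.abs_sum_le_sum_abs _ _
          _ ≤ ∑ _k : Fin 3, 1 * (3 * (K * C * S.size)) := Finset.sum_le_sum fun k _ => by
              rw [abs_mul]
              exact mul_le_mul (abs_rotSign_le a b k) (hmag k) (abs_nonneg _) zero_le_one
          _ ≤ _ := by simp; linarith
  have hcont : ∀ α β, Continuous fun x => S.F α β (0, x) := fun α β =>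
    (S.smooth_F α β).continuous_slice
  have hclosed : IsClosed {x : Space | ∀ α β, |S.F α β (0, x)| ≤ G.radius} := by
    simp only [Set.ofPred_forall]
    exact isClosed_iInter fun α => isClosed_iInter fun β =>
      isClosed_le (hcont α β).abs continuous_const
  have hopen : IsOpen {x : Space | ∀ α β, |S.F α β (0, x)| ≤ G.radius} := by
    have : {x : Space | ∀ α β, |S.F α β (0, x)| ≤ G.radius}
        = {x : Space | ∀ α β, |S.F α β (0, x)| < G.radius} :=
      Set.ext fun x => ⟨fun h => himp x h, fun h α β => (h α β).le⟩
    rw [this]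
    simp only [Set.ofPred_forall]
    exact isOpen_iInter_of_finite fun α => isOpen_iInter_of_finite fun β =>
      isOpen_lt (hcont α β).abs continuous_const
  -- The condition of vanishing at infinity selects the weak branch of solutions.
  have hne : {x : Space | ∀ α β, |S.F α β (0, x)| ≤ G.radius}.Nonempty := by
    have : ∀ᶠ x in cocompact Space, ∀ α β, |S.F α β (0, x)| ≤ G.radius :=
      eventually_all.2 fun α => eventually_all.2 fun β => by
        have h1 := (S.launched.faraday.vanishing α β).abs
        rw [abs_zero] at h1
        filter_upwards [h1.eventually_lt_const hρ] with x hx using hx.le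
    exact this.exists
  have huniv := IsClopen.eq_univ ⟨hclosed, hopen⟩ hne
  have hF : ∀ x α β, |S.F α β (0, x)| ≤ G.radius := fun x => by
    have : x ∈ {x : Space | ∀ α β, |S.F α β (0, x)| ≤ G.radius} := huniv ▸ Set.mem_univ x
    exact this
  refine ⟨fun x => hmem x (hF x), fun x => (mem_closedBall_vacuum hρ.le).2
    ⟨fun i => hmet x i.1 i.2, fun i => by simpa [Launch.metricVal] using hρ.le⟩, fun x => ?_, hM⟩
  have hg := G.good _ (hmem x (hF x))
  have hdual : ∀ j : Fin 3,
      |maxwellDual L (gOf (S.val (0, x))) (fOf (S.val (0, x))) j.succ 0| ≤ G.radius := fun j => by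
    rw [S.maxwellDual_eq hg.g00, abs_neg, abs_mul, abs_of_nonneg (Real.sqrt_nonneg _)]
    have := mul_le_mul (hA x) ((hdata U L N _ hN S x).2.1 j) (abs_nonneg _) (by norm_num)
    linarith
  refine (mem_closedBall_vacuum hρ.le).2 ⟨fun i => ?_, fun i => ?_⟩
  · rw [dualMap_inl]; exact hmet x i.1 i.2
  · obtain ⟨α, β⟩ := i
    refine Fin.cases ?_ (fun a => ?_) α
    · refine Fin.cases ?_ (fun b => ?_) β
      · rw [dualMap_zero_zero]; exact hF x 0 0
      · rw [dualMap_zero_succ (S.F_antisymm x)]; exact hdual b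
    · refine Fin.cases ?_ (fun b => ?_) β
      · rw [dualMap_succ_zero, abs_neg]; exact hdual a
      · rw [dualMap_magnetic]; exact hF x _ _

end InitialFaraday

end EinsteinNLEM

/-! ### Control of the initial values -/

namespace EinsteinNLEM

lemma Ctl.D {ι : Type*} {θ : ι → ℝ} {r n m j : ℕ} {w e : ℝ} {u : ι → Spacetime → ℝ}
    (hu : Ctl θ (r + 1) n m (j + 1) w e u) (μ : Fin 4) :
    Ctl θ r (n - 1) (m - 1) j (w + 1) (e + 1) fun i => D μ (u i) :=
  Fin.cases hu.D_zero (fun k => (hu.mono_time (Nat.le_succ j)).D_succ k) μ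

variable {χ : ℝ → ℝ} {U : Set (ℝ × ℝ)} {L : ℝ × ℝ → ℝ} {γ δ : ℝ} {N : ℕ}

/-- The assumptions under which the solutions launched by small data are controlled. -/
structure Setting (χ : ℝ → ℝ) (U : Set (ℝ × ℝ)) (L : ℝ × ℝ → ℝ) (γ : ℝ) (N : ℕ) (δ : ℝ) where
  cutoff : IsCutoff χ
  γ_pos : 0 < γ
  γ_lt : γ < 1 / 2
  N_ge : 8 ≤ N
  δ_le : δ ≤ 1
  maxwell : IsMaxwellLike U L
  regular : ContDiffOn ℝ ((N + 2 : ℕ) : WithTop ℕ∞) L U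
  ball : GoodBall U L
  small : ∀ S : Launch χ U L γ N δ, S.IsSmall ball.radius

/-- The cut-off Newtonian part of the metric. -/
noncomputable def Launch.tail (S : Launch χ U L γ N δ) (α β : Fin 4) : Spacetime → ℝ :=
  schwarzschildTail χ S.d.M α β

/-- The deviation of the metric from the Minkowski metric. -/
noncomputable def Launch.dev (S : Launch χ U L γ N δ) (α β : Fin 4) (p : Spacetime) : ℝ :=
  S.tail α β p + S.h1 α β p

lemma Launch.metric_eq (S : Launch χ U L γ N δ) (p : Spacetime) (α β : Fin 4) :
    spacetimeMetric χ S.d.M S.h1 p α β = mink α β + S.dev α β p := by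
  simp [spacetimeMetric, Launch.dev, Launch.tail, add_assoc]

/-- Near `t = 0` the factor `χ(r/t)` equals `1` on the support of `χ(r)`, so the tail is static
there and has no time derivatives. -/
lemma germEq_schwarzschildTail (hχ : IsCutoff χ) (M : ℝ) (α β : Fin 4) :
    GermEq (schwarzschildTail χ M α β)
      (lift fun x => (if α = β then 2 * M else 0) * newton χ x) := by
  intro x
  -- Where `χ(r)` does not vanish one has `r > 1/2`, so that `r/t > 3/4` as long as `t < 2/3`.
  have h1 : ∀ᶠ p : Spacetime in 𝓝[half] (0, x), p.1 < 2 / 3 :=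
    eventually_lt_time (by norm_num) x
  filter_upwards [h1] with p hp
  simp only [schwarzschildTail, lift, newton]
  by_cases hαβ : α = β
  · simp only [hαβ, if_true]
    rcases le_or_gt ‖p.2‖ (1 / 2) with h | h
    · simp [hχ.eq_zero _ h]
    · have : (if p.1 ≤ 0 then 1 else χ (‖p.2‖ / p.1)) = 1 := by
        split_ifs with h0
        · rfl
        · push Not at h0
          refine hχ.eq_one _ ?_
          rw [le_div_iff₀ h0]
          linarith
      rw [this]
      ring
  · simp [hαβ]

namespace Setting

variable (H : Setting χ U L γ N δ)
include H

lemma size_mem (S : Launch χ U L γ N δ) : S.size ∈ Set.Icc (0 : ℝ) 1 :=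
  ⟨S.size_nonneg, S.size_le.trans H.δ_le⟩

lemma isOpen_good : IsOpen {y | IsGood U L y} :=
  isOpen_setOf_isGood H.maxwell.isOpen (H.regular.of_le (by norm_cast; omega))

lemma isGood_val (S : Launch χ U L γ N δ) (x : Space) : IsGood U L (S.val (0, x)) :=
  H.ball.good _ ((H.small S).val_mem x)

lemma ctl_tail (α β : Fin 4) {r n m j : ℕ} (hn : n ≤ r + 1) (hm : m ≤ r + 1) :
    Ctl Launch.size r n m j (-1) 1 fun S : Launch χ U L γ N δ => S.tail α β := by
  refine (IsSymbol.ctl (c := fun S : Launch χ U L γ N δ => if α = β then 2 * S.d.M else 0)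
    (A := 2) (fun S => S.size_nonneg) (by norm_num) (fun S => ?_) (isSymbol_newton H.cutoff)
    (by norm_num) hn hm).congr fun S => (germEq_schwarzschildTail H.cutoff S.d.M α β).symm
  have h1 := S.M_nonneg
  have h2 := S.M_le
  have h3 := S.size_nonneg
  split_ifs
  · rw [abs_of_nonneg (by linarith)]; linarith
  · simpa using h3

lemma ctl_D_tail (μ α β : Fin 4) {r n m j : ℕ} (hn : n ≤ r + 1) (hm : m ≤ r + 1) :
    Ctl Launch.size r n m j 0 2 fun S : Launch χ U L γ N δ => D μ (S.tail α β) := by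
  have := (H.ctl_tail α β (r := r + 1) (n := n + 1) (m := m + 1) (j := j + 1) (by omega)
    (by omega)).D μ
  norm_num at this
  exact this

lemma smooth_tail (S : Launch χ U L γ N δ) (α β : Fin 4) (n : ℕ) : Smooth n (S.tail α β) :=
  (H.ctl_tail α β (r := n) (n := 0) (m := 0) (j := 0) (by omega) (by omega)).smooth S

lemma smooth_dev (S : Launch χ U L γ N δ) (α β : Fin 4) : Smooth (N + 1) (S.dev α β) :=
  (H.smooth_tail S α β _).add (S.smooth_h1 α β)

lemma D_metric (S : Launch χ U L γ N δ) (μ α β : Fin 4) :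
    GermEq (EinsteinNLEM.D μ fun q => spacetimeMetric χ S.d.M S.h1 q α β)
      (EinsteinNLEM.D μ (S.dev α β)) := by
  have h1 : GermEq (fun q => spacetimeMetric χ S.d.M S.h1 q α β) fun q => mink α β + S.dev α β q :=
    GermEq.of_eq fun p => S.metric_eq p α β
  refine (h1.D μ).trans ((D_add (Smooth.const _) ((H.smooth_dev S α β).mono (by omega)) μ).trans ?_)
  intro x
  filter_upwards [D_const (mink α β) μ x] with p hp
  rw [hp, zero_add]

lemma D_dev (S : Launch χ U L γ N δ) (μ α β : Fin 4) :
    GermEq (EinsteinNLEM.D μ (S.dev α β))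
      (fun p => EinsteinNLEM.D μ (S.tail α β) p + EinsteinNLEM.D μ (S.h1 α β) p) :=
  D_add (H.smooth_tail S α β 1) ((S.smooth_h1 α β).mono (by omega)) μ

lemma D_zero_tail (S : Launch χ U L γ N δ) (α β : Fin 4) :
    GermEq (EinsteinNLEM.D 0 (S.tail α β)) fun _ => 0 :=
  ((germEq_schwarzschildTail H.cutoff S.d.M α β).D 0).trans
    (D_zero_lift (contDiff_const.mul (contDiff_newton H.cutoff 1)))

/-- The closed ball is compact and convex, as `Ctl.comp` demands. In the hypothesis on `k`, the
first alternative implies the second because `n` and `m` are at most `r + 1`. -/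
lemma near {r n m j : ℕ} {v : Launch χ U L γ N δ → Spacetime → FieldVal}
    (hv : ∀ b, Ctl Launch.size r n m j (-1) 1 fun S p => v S p b - vacuum b)
    (hmem : ∀ S x, v S (0, x) ∈ Metric.closedBall vacuum H.ball.radius)
    (hnm : n ≤ 2 * m) {k : ℕ} (hk : r + 1 ≤ k ∨ (r ≤ k ∧ n ≤ k ∧ m ≤ k)) {V : Set FieldVal}
    (hV : IsOpen V) (hBV : Metric.closedBall vacuum H.ball.radius ⊆ V) {Φ : FieldVal → ℝ}
    (hΦ : ContDiffOn ℝ (k : WithTop ℕ∞) Φ V) :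
    Near Launch.size r n m j (Φ vacuum) fun S p => Φ (v S p) := by
  have h2 := (hv (Sum.inl 0)).2
  have h3 := (hv (Sum.inl 0)).3
  exact Ctl.comp (u := fun b S p => v S p b) H.size_mem hV (isCompact_closedBall _ _)
    (convex_closedBall _ _) hBV
    (Metric.mem_closedBall_self H.ball.radius_pos.le) hmem (by norm_num) hv hnm h2 h3
    (by omega) (by omega) (by omega) hΦ

lemma near_good {r n m j : ℕ} {v : Launch χ U L γ N δ → Spacetime → FieldVal}
    (hv : ∀ b, Ctl Launch.size r n m j (-1) 1 fun S p => v S p b - vacuum b)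
    (hmem : ∀ S x, v S (0, x) ∈ Metric.closedBall vacuum H.ball.radius)
    (hnm : n ≤ 2 * m) {k : ℕ} (hk : r + 1 ≤ k ∨ (r ≤ k ∧ n ≤ k ∧ m ≤ k)) {Φ : FieldVal → ℝ}
    (hΦ : ContDiffOn ℝ (k : WithTop ℕ∞) Φ {y | IsGood U L y}) :
    Near Launch.size r n m j (Φ vacuum) fun S p => Φ (v S p) :=
  H.near hv hmem hnm hk H.isOpen_good H.ball.good hΦ

lemma ctl_coeff_mul {r n m j : ℕ} {v : Launch χ U L γ N δ → Spacetime → FieldVal}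
    (hv : ∀ b, Ctl Launch.size r n m j (-1) 1 fun S p => v S p b - vacuum b)
    (hmem : ∀ S x, v S (0, x) ∈ Metric.closedBall vacuum H.ball.radius)
    (hnm : n ≤ 2 * m) {k : ℕ} (hk : r + 1 ≤ k ∨ (r ≤ k ∧ n ≤ k ∧ m ≤ k)) {Φ : FieldVal → ℝ}
    (hΦ : ContDiffOn ℝ (k : WithTop ℕ∞) Φ {y | IsGood U L y}) {w e : ℝ}
    {u : Launch χ U L γ N δ → Spacetime → ℝ} (hu : Ctl Launch.size r n m j w e u)
    (hw : w + 1 ≤ e) : Ctl Launch.size r n m j w e fun S p => Φ (v S p) * u S p :=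
  (H.near_good hv hmem hnm hk hΦ).near_mul H.size_mem hu hnm hw

/-! ### The data at `t = 0` -/

/-- The lapse is chosen so that `-A² = -1 + 2Mχ(r)/r`; the tail accounts for all of `g_{00}`, and
only the spatial components of `h^{(1)}` survive. -/
lemma h1_slice (S : Launch χ U L γ N δ) (x : Space) :
    S.h1 0 0 (0, x) = 0 ∧ (∀ k : Fin 3, S.h1 0 k.succ (0, x) = 0) ∧
      (∀ k : Fin 3, S.h1 k.succ 0 (0, x) = 0) ∧
      ∀ j k : Fin 3, S.h1 j.succ k.succ (0, x) = S.d.h1 j k x := by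
  have hm := fun α β => (S.metric_eq (0, x) α β).symm.trans (S.launched.metric x α β)
  have ht := fun α β => (germEq_schwarzschildTail H.cutoff S.d.M α β).eq x
  have hM := (H.small S).mass x
  simp only [Launch.dev, Launch.tail, ht, lift] at hm
  refine ⟨?_, fun k => ?_, fun k => ?_, fun j k => ?_⟩
  · have := hm 0 0
    simp only [AbstractData.metric4, Matrix.of_apply, Fin.cases_zero,
      lapse_sq_eq (hM.trans (by norm_num)), mink_zero_zero, if_true] at this
    linarith
  · have := hm 0 k.succ
    simpa [AbstractData.metric4, mink_zero_succ, (Fin.succ_ne_zero k).symm] using this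
  · have := hm k.succ 0
    simpa [AbstractData.metric4, mink_succ_zero, Fin.succ_ne_zero k] using this
  · have := hm j.succ k.succ
    simp only [AbstractData.metric4, Matrix.of_apply, Fin.cases_succ, metric_apply,
      mink_succ_succ, Fin.succ_inj] at this
    split_ifs at this <;> linarith

lemma D_zero_h1_slice (S : Launch χ U L γ N δ) (x : Space) (α β : Fin 4) :
    EinsteinNLEM.D 0 (S.h1 α β) (0, x) = S.d.dtmetric4 χ x α β := by
  have h1 := S.launched.dtmetric x α β
  rw [pd_slab_eq (by exact S.T_pos), (H.D_metric S 0 α β).eq x, (H.D_dev S 0 α β).eq x,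
    (H.D_zero_tail S α β).eq x, zero_add] at h1
  exact h1

lemma ctl_lift_sd_h1 (l j k : Fin 3) :
    Ctl Launch.size N (N + 1) (N - 2) 0 (1 / 2 + γ) 2
      fun S : Launch χ U L γ N δ => lift (sd l (S.d.h1 j k)) :=
  ctl_lift_of_sobolev H.γ_pos (fun S => S.size_nonneg) (by have := H.N_ge; omega)
    (fun S => contDiff_sd (S.flat.h1 j k).1 l)
    (fun S I hI => S.tendsto_sdList_sd_h1 l j k I hI.le) fun S I hI => S.lintegral_h1_le l j k I hI

lemma ctl_lift_K (j k : Fin 3) :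
    Ctl Launch.size N (N + 1) (N - 2) 0 (1 / 2 + γ) 2
      fun S : Launch χ U L γ N δ => lift (S.d.K j k) :=
  ctl_lift_of_sobolev H.γ_pos (fun S => S.size_nonneg) (by have := H.N_ge; omega)
    (fun S => (S.flat.K j k).1)
    (fun S I hI => (S.flat.K j k).tendsto_sdList (by linarith [S.κ_pos]) I hI.le)
    fun S I hI => S.lintegral_K_le j k I hI

lemma ctl_lift_D (j : Fin 3) :
    Ctl Launch.size N (N + 1) (N - 2) 0 (1 / 2 + γ) 2
      fun S : Launch χ U L γ N δ => lift (S.d.D j) :=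
  ctl_lift_of_sobolev H.γ_pos (fun S => S.size_nonneg) (by have := H.N_ge; omega)
    (fun S => (S.flat.D j).1)
    (fun S I hI => (S.flat.D j).tendsto_sdList (by linarith [S.κ_pos]) I hI.le)
    fun S I hI => S.lintegral_D_le j I hI

lemma ctl_lift_B (j : Fin 3) :
    Ctl Launch.size N (N + 1) (N - 2) 0 (1 / 2 + γ) 2
      fun S : Launch χ U L γ N δ => lift (S.d.B j) :=
  ctl_lift_of_sobolev H.γ_pos (fun S => S.size_nonneg) (by have := H.N_ge; omega)
    (fun S => (S.flat.B j).1)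
    (fun S I hI => (S.flat.B j).tendsto_sdList (by linarith [S.κ_pos]) I hI.le)
    fun S I hI => S.lintegral_B_le j I hI

lemma ctl_D_succ_h1_initial (l : Fin 3) (α β : Fin 4) :
    Ctl Launch.size N (N + 1) (N - 2) 0 (1 / 2 + γ) 2
      fun S : Launch χ U L γ N δ => D l.succ (S.h1 α β) := by
  have hsm : ∀ S : Launch χ U L γ N δ, Smooth N (EinsteinNLEM.D l.succ (S.h1 α β)) :=
    fun S => (S.smooth_h1 α β).D _
  have hsl : ∀ (S : Launch χ U L γ N δ) (x : Space), EinsteinNLEM.D l.succ (S.h1 α β) (0, x)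
      = sd l (fun y => S.h1 α β (0, y)) x :=
    fun S x => D_slice ((S.smooth_h1 α β).mono (by omega)) l x
  have hzero : (∀ (S : Launch χ U L γ N δ) x, S.h1 α β (0, x) = 0) →
      Ctl Launch.size N (N + 1) (N - 2) 0 (1 / 2 + γ) 2
        fun S : Launch χ U L γ N δ => EinsteinNLEM.D l.succ (S.h1 α β) := fun h =>
    Ctl.congr_slice hsm (fun S x => by rw [hsl]; simp [h, sd])
      (Ctl.zero H.size_mem le_rfl (by omega))
  revert hsm hsl hzero
  refine Fin.cases ?_ (fun j => ?_) α
  · refine Fin.cases ?_ (fun k => ?_) β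
    · exact fun _ _ h => h fun S x => (H.h1_slice S x).1
    · exact fun _ _ h => h fun S x => (H.h1_slice S x).2.1 k
  · refine Fin.cases ?_ (fun k => ?_) β
    · exact fun _ _ h => h fun S x => (H.h1_slice S x).2.2.1 j
    · intro hsm hsl _
      refine Ctl.congr_slice hsm (fun S x => ?_) (H.ctl_lift_sd_h1 l j k)
      rw [hsl]
      simp only [(H.h1_slice S _).2.2.2, lift]

lemma ptBd_h1 (α β : Fin 4) :
    PtBd Launch.size 1 fun (S : Launch χ U L γ N δ) x => S.h1 α β (0, x) := by
  obtain ⟨C, hC, h⟩ := exists_data_bound H.cutoff H.γ_pos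
  refine ⟨C, hC, fun S x => ?_⟩
  have hs := S.size_nonneg
  have hj := jp_rpow_pos x (-1)
  have h0 : |(0 : ℝ)| ≤ C * S.size * jp x ^ (-1 : ℝ) := by rw [abs_zero]; positivity
  obtain ⟨h1, h2, h3, h4⟩ := H.h1_slice S x
  have h5 := (h U L N δ (by have := H.N_ge; omega) S x).1
  change |S.h1 α β (0, x)| ≤ _
  refine Fin.cases ?_ (fun j => ?_) α
  · refine Fin.cases ?_ (fun k => ?_) β
    · rwa [h1]
    · rwa [h2]
  · refine Fin.cases ?_ (fun k => ?_) β
    · rwa [h3]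
    · rw [h4]; exact h5 j k

/-- Control of `h^{(1)}` in terms of its gradient. -/
lemma ctl_h1 {j : ℕ} (h : ∀ (k : Fin 3) (α β : Fin 4),
      Ctl Launch.size N (N + 1) (N - 2) j (1 / 2 + γ) 2
        fun S : Launch χ U L γ N δ => D k.succ (S.h1 α β))
    (h0 : 1 ≤ j → ∀ α β : Fin 4, Ctl Launch.size N (N + 1) (N - 2) (j - 1) (1 / 2 + γ) 2
        fun S : Launch χ U L γ N δ => D 0 (S.h1 α β)) (α β : Fin 4) :
    Ctl Launch.size N (N + 1) (N - 2) j (-1) 1 fun S : Launch χ U L γ N δ => S.h1 α β := by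
  have hγ := H.γ_pos
  -- At order zero only decay like `1/r` is known, which lies in `L²` with weight `-1` since `-1 +
  -- 3/2 < 1`; the gradient bounds are weakened to match.
  have := Ctl.of_D (fun S : Launch χ U L γ N δ => S.smooth_h1 α β) (H.ptBd_h1 α β)
    ((H.ptBd_h1 α β).l2Bd (w := -1) (by norm_num))
    (fun k => (h k α β).anti H.size_mem (by linarith) (by norm_num))
    (fun hj => (h0 hj α β).anti H.size_mem (by linarith) (by norm_num))
  exact this.mono (by omega) (by omega) (by omega) le_rfl le_rfl (by omega)

lemma ctl_dev {j : ℕ} {α β : Fin 4}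
    (h : Ctl Launch.size N (N + 1) (N - 2) j (-1) 1 fun S : Launch χ U L γ N δ => S.h1 α β) :
    Ctl Launch.size N (N + 1) (N - 2) j (-1) 1 fun S : Launch χ U L γ N δ => S.dev α β :=
  (H.ctl_tail α β le_rfl (by omega)).add H.size_mem h

lemma ctl_dev_initial (α β : Fin 4) :
    Ctl Launch.size N (N + 1) (N - 2) 0 (-1) 1 fun S : Launch χ U L γ N δ => S.dev α β :=
  H.ctl_dev (H.ctl_h1 H.ctl_D_succ_h1_initial (fun h => absurd h (by norm_num)) α β)

/-- The pair `(g, 0)` is used because derivatives of `F` are not yet controlled, while the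
coefficients needed first depend on the metric alone. -/
lemma ctl_metricVal_initial (b : FieldIdx) :
    Ctl Launch.size N (N + 1) (N - 2) 0 (-1) 1
      fun (S : Launch χ U L γ N δ) p => S.metricVal p b - vacuum b := by
  rcases b with b | b
  · refine (H.ctl_dev_initial b.1 b.2).congr fun S => GermEq.of_eq fun p => ?_
    simp [Launch.metricVal, S.metric_eq, vacuum]
  · refine (Ctl.zero H.size_mem le_rfl (by omega)).congr fun S => GermEq.of_eq fun p => ?_
    simp [Launch.metricVal, vacuum]

lemma ctl_metricCoeff_mul {Φ : FieldVal → ℝ}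
    (hΦ : ContDiffOn ℝ ((N + 1 : ℕ) : WithTop ℕ∞) Φ {y | IsGood U L y}) {w e : ℝ}
    {u : Launch χ U L γ N δ → Spacetime → ℝ} (hu : Ctl Launch.size N (N + 1) (N - 2) 0 w e u)
    (hw : w + 1 ≤ e) :
    Ctl Launch.size N (N + 1) (N - 2) 0 w e fun S p => Φ (S.metricVal p) * u S p :=
  H.ctl_coeff_mul H.ctl_metricVal_initial (fun S => (H.small S).metricVal_mem)
    (by have := H.N_ge; omega) (Or.inl le_rfl) hΦ hu hw

lemma near_metricCoeff {Φ : FieldVal → ℝ}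
    (hΦ : ContDiffOn ℝ ((N + 1 : ℕ) : WithTop ℕ∞) Φ {y | IsGood U L y}) :
    Near Launch.size N (N + 1) (N - 2) 0 (Φ vacuum)
      fun (S : Launch χ U L γ N δ) p => Φ (S.metricVal p) :=
  H.near_good H.ctl_metricVal_initial (fun S => (H.small S).metricVal_mem)
    (by have := H.N_ge; omega) (Or.inl le_rfl) hΦ

end Setting

end EinsteinNLEM

/-! ### The time derivative of the metric and `F` along the initial surface -/

namespace EinsteinNLEM

variable {χ : ℝ → ℝ} {U : Set (ℝ × ℝ)} {L : ℝ × ℝ → ℝ} {γ δ : ℝ} {N : ℕ}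

/-- The coefficients `A² (g̲⁻¹)^{ab}`. -/
noncomputable def shiftCoeff (a b : Fin 3) (y : FieldVal) : ℝ := -gOf y 0 0 * (gSpace y)⁻¹ a b

lemma contDiffOn_shiftCoeff {n : WithTop ℕ∞} (a b : Fin 3) :
    ContDiffOn ℝ n (shiftCoeff a b) {y | IsGood U L y} :=
  (contDiff_gOf 0 0).neg.contDiffOn.mul (contDiffOn_gSpaceInv a b)

lemma gSpace_vacuum : gSpace vacuum = 1 := by
  ext j k; simp [gSpace, gOf_vacuum, mink_succ_succ, Matrix.one_apply]

namespace Launch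

variable (S : Launch χ U L γ N δ)

lemma gSpace_metricVal (x : Space) : gSpace (S.metricVal (0, x)) = S.d.metric χ x := by
  ext j k
  simp [gSpace, gOf_metricVal, metric_zero, AbstractData.metric4]

lemma g00_metricVal (x : Space) : -gOf (S.metricVal (0, x)) 0 0 = S.d.lapse χ x ^ 2 := by
  simp [gOf_metricVal, metric_zero, AbstractData.metric4]

lemma sqrt_g00_metricVal (x : Space) :
    Real.sqrt (-gOf (S.metricVal (0, x)) 0 0) = S.d.lapse χ x := by
  have : 0 ≤ S.d.lapse χ x := Real.sqrt_nonneg _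
  rw [g00_metricVal, Real.sqrt_sq this]

end Launch

namespace Setting

variable (H : Setting χ U L γ N δ)
include H

lemma dmetric_eq (S : Launch χ U L γ N δ) (x : Space) (a j k : Fin 3) :
    S.d.dmetric χ x a j k
      = (if j = k then 2 * S.d.M * sd a (newton χ) x else 0) + sd a (S.d.h1 j k) x := by
  have h1 : (fun y => S.d.metric χ y j k) = fun y =>
      (if j = k then 1 else 0) + ((if j = k then 2 * S.d.M else 0) * newton χ y
        + S.d.h1 j k y) := by
    ext y; rw [metric_apply]; split_ifs <;> ring
  have h2 : DifferentiableAt ℝ (newton χ) x :=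
    (contDiff_newton H.cutoff 1).differentiable (by simp) x
  have h3 : DifferentiableAt ℝ (S.d.h1 j k) x :=
    ((S.flat.h1 j k).1.differentiable (by norm_cast)) x
  have h4 : HasFDerivAt (fun y => (if j = k then 1 else 0) +
      ((if j = k then 2 * S.d.M else 0) * newton χ y + S.d.h1 j k y)) _ x :=
    ((h2.hasFDerivAt.const_mul _).add h3.hasFDerivAt).const_add _
  rw [AbstractData.dmetric, h1]
  simp only [sd, h4.fderiv]
  split_ifs <;> simp

/-- Half of the derivative of `A² = 1 - 2Mχ(r)/r`. -/
lemma lapse_mul_sd_lapse (S : Launch χ U L γ N δ) (x : Space) (j : Fin 3) :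
    S.d.lapse χ x * sd j (S.d.lapse χ) x = -(S.d.M * sd j (newton χ) x) := by
  have h1 : S.d.lapse χ = fun y => Real.sqrt (1 - 2 * S.d.M * newton χ y) := by
    ext y
    rw [AbstractData.lapse, newton]
    congr 1; ring
  have hM := (H.small S).mass x
  have hpos : 0 < 1 - 2 * S.d.M * newton χ x := by linarith
  have h2 : DifferentiableAt ℝ (newton χ) x :=
    (contDiff_newton H.cutoff 1).differentiable (by simp) x
  have h3 := ((h2.hasFDerivAt.const_mul (2 * S.d.M)).const_sub 1).sqrt hpos.ne'
  have hs := Real.sqrt_pos.2 hpos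
  rw [h1]
  simp only [sd, h3.fderiv]
  simp
  field_simp

/-- The terms linear in `M`, each of the form `M ∂_k(χ(r)/r)`, have coefficients `2`, `-3` and `1`
from the three parts of the formula and cancel. Hence in the terms with `M` the coefficients appear
only through their difference from the values at `(m, 0)`. Without this cancellation a term `M/r²`
would remain, which is not in the weighted space. -/
lemma dtmetric_shift_eq (S : Launch χ U L γ N δ) (x : Space) (k : Fin 3) :
    S.d.dtmetric4 χ x 0 k.succ
      = (∑ a, ∑ b, shiftCoeff a b (S.metricVal (0, x))
          * (sd a (S.d.h1 b k) x - 1 / 2 * sd k (S.d.h1 a b) x))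
        + ((∑ a, (shiftCoeff a k (S.metricVal (0, x)) - shiftCoeff a k vacuum)
            * (2 * S.d.M * sd a (newton χ) x))
          - ∑ a, (shiftCoeff a a (S.metricVal (0, x)) - shiftCoeff a a vacuum)
            * (S.d.M * sd k (newton χ) x)) := by
  have h0 : S.d.dtmetric4 χ x 0 k.succ
      = S.d.lapse χ x ^ 2 * (∑ a, ∑ b, (S.d.metric χ x)⁻¹ a b * S.d.dmetric χ x a b k)
        - (1 / 2) * S.d.lapse χ x ^ 2
          * (∑ a, ∑ b, (S.d.metric χ x)⁻¹ a b * S.d.dmetric χ x k a b)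
        - S.d.lapse χ x * sd k (S.d.lapse χ) x := rfl
  rw [h0, H.lapse_mul_sd_lapse S x k]
  simp only [H.dmetric_eq S, shiftCoeff, S.gSpace_metricVal, S.g00_metricVal, gOf_vacuum,
    gSpace_vacuum, mink_zero_zero]
  generalize (S.d.metric χ x)⁻¹ = m
  fin_cases k <;> simp [Fin.sum_univ_three] <;> ring

/-- The terms with `K` and `∂h̲^{(1)}` inherit the class of the data. Those with the mass are
products of `g - m`, of order `1/r`, with `M/r²`; they belong to the weight `1`, which exceeds `1/2
+ γ`. -/
lemma ctl_D_zero_h1_initial (α β : Fin 4) :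
    Ctl Launch.size N (N + 1) (N - 2) 0 (1 / 2 + γ) 2
      fun S : Launch χ U L γ N δ => D 0 (S.h1 α β) := by
  have hN := H.N_ge
  have hγ := H.γ_pos
  have hγ' := H.γ_lt
  have hm : N - 2 ≤ N + 1 := by omega
  have hsm : ∀ S : Launch χ U L γ N δ, ∀ α β, Smooth N (EinsteinNLEM.D 0 (S.h1 α β)) :=
    fun S α β => (S.smooth_h1 α β).D _
  have hK : ∀ {Φ : FieldVal → ℝ}, (ContDiffOn ℝ ((N + 1 : ℕ) : WithTop ℕ∞) Φ {y | IsGood U L y}) →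
      ∀ j k, Ctl Launch.size N (N + 1) (N - 2) 0 (1 / 2 + γ) 2
        fun (S : Launch χ U L γ N δ) p => Φ (S.metricVal p) * lift (S.d.K j k) p :=
    fun hΦ j k => H.ctl_metricCoeff_mul hΦ (H.ctl_lift_K j k) (by linarith)
  have hshift : ∀ (α β : Fin 4) (k : Fin 3), (∀ (S : Launch χ U L γ N δ) x,
      EinsteinNLEM.D 0 (S.h1 α β) (0, x) = S.d.dtmetric4 χ x 0 k.succ) →
      Ctl Launch.size N (N + 1) (N - 2) 0 (1 / 2 + γ) 2
        fun S : Launch χ U L γ N δ => EinsteinNLEM.D 0 (S.h1 α β) := by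
    intro α β k hval
    have hdn : ∀ l : Fin 3, ∀ c : Launch χ U L γ N δ → ℝ, (∀ S, |c S| ≤ 2 * S.size) →
        Ctl Launch.size N (N + 1) (N - 2) 0 0 2
          fun S : Launch χ U L γ N δ => lift fun x => c S * sd l (newton χ) x := by
      intro l c hc
      have := (isSymbol_newton H.cutoff).sd l
      norm_num at this
      exact IsSymbol.ctl (fun S => S.size_nonneg) (by norm_num) hc this (by norm_num) le_rfl hm
    have hnear : ∀ a b, Near Launch.size N (N + 1) (N - 2) 0 (shiftCoeff a b vacuum)
        fun (S : Launch χ U L γ N δ) p => shiftCoeff a b (S.metricVal p) :=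
      fun a b => H.near_metricCoeff (contDiffOn_shiftCoeff a b)
    refine Ctl.congr_slice (fun S => hsm S α β) (fun S x => ?_)
      (Ctl.add H.size_mem
        (Ctl.sum H.size_mem (s := Finset.univ) le_rfl hm fun a _ =>
          Ctl.sum H.size_mem (s := Finset.univ) le_rfl hm fun b _ =>
          H.ctl_metricCoeff_mul (contDiffOn_shiftCoeff a b)
            ((H.ctl_lift_sd_h1 a b k).sub H.size_mem
              ((H.ctl_lift_sd_h1 k a b).const_mul H.size_mem (1 / 2))) (by linarith))
        (Ctl.sub H.size_mem
          (Ctl.sum H.size_mem (s := Finset.univ) le_rfl hm fun a _ => (hnear a k).mul H.size_mem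
            (hdn a (fun S => 2 * S.d.M) fun S => ?_) (by omega) (by linarith) (by linarith)
            (by norm_num))
          (Ctl.sum H.size_mem (s := Finset.univ) le_rfl hm fun a _ => (hnear a a).mul H.size_mem
            (hdn k (fun S => S.d.M) fun S => ?_) (by omega) (by linarith) (by linarith)
            (by norm_num))))
    · rw [hval, H.dtmetric_shift_eq]
      simp only [lift]
    · have := S.M_nonneg
      rw [abs_of_nonneg (by linarith)]; linarith [S.M_le]
    · rw [abs_of_nonneg S.M_nonneg]; linarith [S.M_le, S.size_nonneg]
  refine Fin.cases ?_ (fun j => ?_) α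
  · refine Fin.cases ?_ (fun k => ?_) β
    · refine Ctl.congr_slice (fun S => hsm S 0 0) (fun S x => ?_)
        (Ctl.const_mul H.size_mem (-2)
          (Ctl.sum H.size_mem (s := Finset.univ) le_rfl hm fun a _ =>
            Ctl.sum H.size_mem (s := Finset.univ) le_rfl hm fun b _ =>
              hK ((contDiffOn_sqrt_g00.pow 3).mul (contDiffOn_gSpaceInv a b)) a b))
      rw [H.D_zero_h1_slice]
      have : S.d.dtmetric4 χ x 0 0 = -2 * S.d.lapse χ x ^ 3 * S.d.trK χ x := rfl
      rw [this, AbstractData.trK]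
      simp only [S.sqrt_g00_metricVal, S.gSpace_metricVal, lift, Finset.mul_sum]
      refine Finset.sum_congr rfl fun a _ => Finset.sum_congr rfl fun b _ => ?_
      ring
    · exact hshift 0 k.succ k fun S x => H.D_zero_h1_slice S x _ _
  · refine Fin.cases ?_ (fun k => ?_) β
    · exact hshift j.succ 0 j fun S x => H.D_zero_h1_slice S x _ _
    · refine Ctl.congr_slice (fun S => hsm S j.succ k.succ) (fun S x => ?_)
        (Ctl.const_mul H.size_mem 2 (hK contDiffOn_sqrt_g00 j k))
      rw [H.D_zero_h1_slice]
      have : S.d.dtmetric4 χ x j.succ k.succ = 2 * S.d.lapse χ x * S.d.K j k x := rfl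
      rw [this, S.sqrt_g00_metricVal, lift]
      ring

/-! ### The Faraday tensor at `t = 0` -/

omit H in
lemma magneticCoeff_metricVal (S : Launch χ U L γ N δ) (p : Spacetime) (k j : Fin 3) :
    magneticCoeff k j (S.val p) = magneticCoeff k j (S.metricVal p) := rfl

omit H in
/-- The values of the pair `(g, -⋆𝓜)` in terms of the data. -/
noncomputable def dualVal (S : Launch χ U L γ N δ) (p : Spacetime) : FieldVal :=
  Sum.elim (fun i => spacetimeMetric χ S.d.M S.h1 p i.1 i.2) fun i =>
    Fin.cases (Fin.cases 0 (fun j => -(Real.sqrt (-gOf (S.metricVal p) 0 0) * lift (S.d.D j) p)) i.2)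
      (fun a => Fin.cases (Real.sqrt (-gOf (S.metricVal p) 0 0) * lift (S.d.D a) p)
        (fun b => ∑ k, rotSign a b k * ∑ j, magneticCoeff k j (S.metricVal p) * lift (S.d.B j) p)
        i.2) i.1

/-- After the change of variables `dualMap`, the electric and magnetic components are explicit in
the data, with coefficients that depend on the metric only. -/
lemma dualVal_slice (S : Launch χ U L γ N δ) (x : Space) :
    dualVal S (0, x) = dualMap L (S.val (0, x)) := by
  have hg := H.isGood_val S x
  have hE : ∀ j : Fin 3, Real.sqrt (-gOf (S.metricVal (0, x)) 0 0) * lift (S.d.D j) (0, x)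
      = -maxwellDual L (gOf (S.val (0, x))) (fOf (S.val (0, x))) j.succ 0 := fun j => by
    rw [S.maxwellDual_eq hg.g00, neg_neg]; rfl
  ext i
  rcases i with i | i
  · rw [dualMap_inl]; rfl
  · obtain ⟨α, β⟩ := i
    refine Fin.cases ?_ (fun a => ?_) α
    · refine Fin.cases ?_ (fun b => ?_) β
      · rw [dualMap_zero_zero]
        have := S.F_antisymm x 0 0
        simp only [dualVal, Sum.elim_inr, Fin.cases_zero]
        linarith
      · rw [dualMap_zero_succ (S.F_antisymm x)]
        simp only [dualVal, Sum.elim_inr, Fin.cases_zero, Fin.cases_succ]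
        rw [hE, neg_neg]
    · refine Fin.cases ?_ (fun b => ?_) β
      · rw [dualMap_succ_zero]
        simp only [dualVal, Sum.elim_inr, Fin.cases_zero, Fin.cases_succ]
        rw [hE]
      · rw [dualMap_magnetic, spatial_eq_sum_magnetic (S.F_antisymm x)]
        simp only [dualVal, Sum.elim_inr, Fin.cases_succ, S.magnetic_eq hg,
          magneticCoeff_metricVal]
        rfl

lemma ctl_dualVal_inr (i : Fin 4 × Fin 4) :
    Ctl Launch.size N (N + 1) (N - 2) 0 (1 / 2 + γ) 2
      fun (S : Launch χ U L γ N δ) p => dualVal S p (Sum.inr i) := by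
  have hγ' := H.γ_lt
  have hm : N - 2 ≤ N + 1 := by omega
  have hD : ∀ j, Ctl Launch.size N (N + 1) (N - 2) 0 (1 / 2 + γ) 2
      fun (S : Launch χ U L γ N δ) p =>
        Real.sqrt (-gOf (S.metricVal p) 0 0) * lift (S.d.D j) p := fun j =>
    H.ctl_metricCoeff_mul contDiffOn_sqrt_g00 (H.ctl_lift_D j) (by linarith)
  obtain ⟨α, β⟩ := i
  refine Fin.cases ?_ (fun a => ?_) α
  · refine Fin.cases ?_ (fun b => ?_) β
    · exact Ctl.zero H.size_mem le_rfl hm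
    · exact (hD b).neg H.size_mem
  · refine Fin.cases ?_ (fun b => ?_) β
    · exact hD a
    · exact Ctl.sum (s := Finset.univ) (u := fun k (S : Launch χ U L γ N δ) p => rotSign a b k
          * ∑ j, magneticCoeff k j (S.metricVal p) * lift (S.d.B j) p) H.size_mem le_rfl hm
        fun k _ => Ctl.const_mul H.size_mem _ (Ctl.sum H.size_mem le_rfl hm fun j _ =>
          H.ctl_metricCoeff_mul (contDiffOn_magneticCoeff k j) (H.ctl_lift_B j) (by linarith))

/-- Regularity comes first: `F` is a smooth function of quantities that are already controlled.
Viewed as a general smooth function of `(g, -⋆𝓜)` it inherits only the slow decay of `g - m`. -/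
lemma ctl_F_initial_weak (α β : Fin 4) :
    Ctl Launch.size N (N + 1) (N - 2) 0 (-1) 1 fun S : Launch χ U L γ N δ => S.F α β := by
  have hγ := H.γ_pos
  have hv : ∀ b, Ctl Launch.size N (N + 1) (N - 2) 0 (-1) 1
      fun (S : Launch χ U L γ N δ) p => dualVal S p b - vacuum b := by
    rintro (b | b)
    · exact H.ctl_metricVal_initial (Sum.inl b)
    · refine ((H.ctl_dualVal_inr b).anti H.size_mem (w' := -1) (e' := 1) (by linarith)
        (by norm_num)).congr fun S => GermEq.of_eq fun p => ?_
      simp [vacuum]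
  have hinv : H.ball.inverse vacuum = vacuum := by
    have := H.ball.inverse_dualMap vacuum (Metric.mem_closedBall_self H.ball.radius_pos.le)
    rwa [dualMap_vacuum] at this
  have := H.near hv (fun S x => by rw [H.dualVal_slice]; exact (H.small S).dualMap_mem x)
    (by have := H.N_ge; omega) (Or.inl le_rfl) H.ball.isOpen_domain H.ball.subset_domain
    (contDiffOn_pi.1 (H.ball.contDiffOn_inverse (N + 1) H.regular) (Sum.inr (α, β)))
  refine this.congr_slice (fun S => S.smooth_F α β) fun S x => ?_
  beta_reduce
  rw [H.dualVal_slice, H.ball.inverse_dualMap _ ((H.small S).val_mem x), hinv]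
  simp [vacuum, Launch.val]

lemma ctl_val {j : ℕ}
    (hh : ∀ α β, Ctl Launch.size N (N + 1) (N - 2) j (-1) 1
      fun S : Launch χ U L γ N δ => S.h1 α β)
    (hF : ∀ α β, Ctl Launch.size N (N + 1) (N - 2) j (-1) 1
      fun S : Launch χ U L γ N δ => S.F α β) (b : FieldIdx) :
    Ctl Launch.size N (N + 1) (N - 2) j (-1) 1
      fun (S : Launch χ U L γ N δ) p => S.val p b - vacuum b := by
  rcases b with b | b
  · refine (H.ctl_dev (hh b.1 b.2)).congr fun S => GermEq.of_eq fun p => ?_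
    simp [Launch.val, S.metric_eq, vacuum]
  · refine (hF b.1 b.2).congr fun S => GermEq.of_eq fun p => ?_
    simp [Launch.val, vacuum]

lemma contDiffOn_lag1_val :
    ContDiffOn ℝ ((N + 1 : ℕ) : WithTop ℕ∞) (fun y => lagD1 L (inv2 y)) {y | IsGood U L y} :=
  (contDiffOn_comp_inv2 (contDiffOn_lagD1 H.maxwell.isOpen H.regular)).mono
    fun _ hy => IsGood.regular hy

lemma contDiffOn_lag2_val :
    ContDiffOn ℝ ((N + 1 : ℕ) : WithTop ℕ∞) (fun y => lagD2 L (inv2 y)) {y | IsGood U L y} :=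
  (contDiffOn_comp_inv2 (contDiffOn_lagD2 H.maxwell.isOpen H.regular)).mono
    fun _ hy => IsGood.regular hy

/-- With the coefficients controlled by the weak bound, `electric_eq` exhibits the electric
components as coefficients times `𝔇` and `𝔅`, which restores the full decay. The magnetic components
are linear in `𝔅` from the outset. -/
lemma ctl_F_initial (α β : Fin 4) :
    Ctl Launch.size N (N + 1) (N - 2) 0 (1 / 2 + γ) 2
      fun S : Launch χ U L γ N δ => S.F α β := by
  have hγ' := H.γ_lt
  have hm : N - 2 ≤ N + 1 := by omega
  have hval := H.ctl_val (fun α β => H.ctl_h1 H.ctl_D_succ_h1_initial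
    (fun h => absurd h (by norm_num)) α β) H.ctl_F_initial_weak
  have hmul : ∀ {Φ : FieldVal → ℝ},
      (ContDiffOn ℝ ((N + 1 : ℕ) : WithTop ℕ∞) Φ {y | IsGood U L y}) →
      ∀ {u : Launch χ U L γ N δ → Spacetime → ℝ},
        Ctl Launch.size N (N + 1) (N - 2) 0 (1 / 2 + γ) 2 u →
      Ctl Launch.size N (N + 1) (N - 2) 0 (1 / 2 + γ) 2 fun S p => Φ (S.val p) * u S p :=
    fun hΦ _ hu => H.ctl_coeff_mul hval (fun S => (H.small S).val_mem)
      (by have := H.N_ge; omega) (Or.inl le_rfl) hΦ hu (by linarith)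
  have hE : ∀ j : Fin 3, Ctl Launch.size N (N + 1) (N - 2) 0 (1 / 2 + γ) 2
      fun S : Launch χ U L γ N δ => S.F j.succ 0 := by
    intro j
    have hc : ContDiffOn ℝ ((N + 1 : ℕ) : WithTop ℕ∞)
        (fun y => Real.sqrt (-gOf y 0 0) * (2 * lagD1 L (inv2 y))⁻¹) {y | IsGood U L y} :=
      contDiffOn_sqrt_g00.mul ((contDiffOn_const.mul H.contDiffOn_lag1_val).inv fun y hy => by
        have := IsGood.lag1 hy
        exact (by linarith : 2 * lagD1 L (inv2 y) < 0).ne)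
    refine Ctl.congr_slice (fun S => S.smooth_F j.succ 0) (fun S x => ?_)
      (hmul hc ((hmul H.contDiffOn_lag2_val (H.ctl_lift_B j)).sub H.size_mem (H.ctl_lift_D j)))
    exact (electric_eq (H.isGood_val S x) (S.displacement x j) (S.induction x j)).symm
  refine Fin.cases ?_ (fun a => ?_) α
  · refine Fin.cases ?_ (fun b => ?_) β
    · refine Ctl.congr_slice (fun S => S.smooth_F 0 0) (fun S x => ?_)
        (Ctl.zero H.size_mem le_rfl hm)
      have : S.F 0 0 (0, x) = -S.F 0 0 (0, x) := S.F_antisymm x 0 0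
      linarith
    · exact Ctl.congr_slice (fun S => S.smooth_F 0 b.succ)
        (fun S x => (S.F_antisymm x 0 b.succ).symm) ((hE b).neg H.size_mem)
  · refine Fin.cases ?_ (fun b => ?_) β
    · exact hE a
    · refine Ctl.congr_slice (fun S => S.smooth_F a.succ b.succ) (fun S x => ?_)
        (H.ctl_dualVal_inr (a.succ, b.succ))
      rw [H.dualVal_slice, dualMap_magnetic]
      rfl

end Setting

end EinsteinNLEM

/-! ### The terms of the equations, with a given number of time derivatives -/

namespace EinsteinNLEM

variable {χ : ℝ → ℝ} {U : Set (ℝ × ℝ)} {L : ℝ × ℝ → ℝ} {γ δ : ℝ} {N : ℕ}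

/-- The derivatives of `∂h^{(1)}` and `F` at `t = 0` with at most `j` of them in the direction of
time are controlled by the data. -/
structure Level (χ : ℝ → ℝ) (U : Set (ℝ × ℝ)) (L : ℝ × ℝ → ℝ) (γ : ℝ) (N : ℕ) (δ : ℝ) (j : ℕ) :
    Prop where
  dh1 : ∀ μ α β, Ctl Launch.size N (N + 1) (N - 2) j (1 / 2 + γ) 2
    fun S : Launch χ U L γ N δ => D μ (S.h1 α β)
  F : ∀ α β, Ctl Launch.size N (N + 1) (N - 2) j (1 / 2 + γ) 2
    fun S : Launch χ U L γ N δ => S.F α β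

/-- Control of all derivatives but those of the highest order. -/
abbrev Mid (j : ℕ) (w e : ℝ) (u : Launch χ U L γ N δ → Spacetime → ℝ) : Prop :=
  Ctl Launch.size (N - 1) N (N - 3) j w e u

lemma Setting.level_zero (H : Setting χ U L γ N δ) : Level χ U L γ N δ 0 where
  dh1 := fun μ α β => Fin.cases (H.ctl_D_zero_h1_initial α β)
    (fun l => H.ctl_D_succ_h1_initial l α β) μ
  F := H.ctl_F_initial

namespace Setting

variable (H : Setting χ U L γ N δ) {j : ℕ} {w e w₁ e₁ w₂ e₂ : ℝ}
  {u v : Launch χ U L γ N δ → Spacetime → ℝ}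
include H

lemma mid_of_ctl (hu : Ctl Launch.size N (N + 1) (N - 2) j w e u) : Mid j w e u := by
  have := H.N_ge
  exact hu.mono (by omega) (by omega) (by omega) le_rfl (by omega) (by omega)

lemma mid_D_succ (hu : Ctl Launch.size N (N + 1) (N - 2) j w e u) (k : Fin 3) :
    Mid j (w + 1) (e + 1) fun S => D k.succ (u S) := by
  have hN := H.N_ge
  obtain ⟨K, rfl⟩ : ∃ K, N = K + 1 := ⟨N - 1, by omega⟩
  exact hu.D_succ k

lemma mid_zero : Mid j w e fun (_ : Launch χ U L γ N δ) _ => 0 :=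
  Ctl.zero H.size_mem (by have := H.N_ge; omega) (by have := H.N_ge; omega)

lemma mid_sum {β : Type*} {s : Finset β} {u : β → Launch χ U L γ N δ → Spacetime → ℝ}
    (h : ∀ b ∈ s, Mid j w e (u b)) : Mid j w e fun S p => ∑ b ∈ s, u b S p :=
  Ctl.sum H.size_mem (by have := H.N_ge; omega) (by have := H.N_ge; omega) h

lemma mid_mul (hu : Mid j w₁ e₁ u) (hv : Mid j w₂ e₂ v) (h₁ : w ≤ w₁ + e₂) (h₂ : w ≤ w₂ + e₁)
    (he : e ≤ e₁ + e₂) : Mid j w e fun S p => u S p * v S p :=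
  hu.mul H.size_mem hv (by have := H.N_ge; omega) h₁ h₂ he

omit H in
lemma contDiffOn_gInv_good {n : WithTop ℕ∞} (μ ν : Fin 4) :
    ContDiffOn ℝ n (fun y => (gOf y)⁻¹ μ ν) {y | IsGood U L y} :=
  (contDiffOn_gInv μ ν).mono fun _ hy => (IsGood.regular hy).1

lemma contDiffOn_tensorN_good (μ ν κ l : Fin 4) :
    ContDiffOn ℝ (N : WithTop ℕ∞) (fun y => tensorN L (gOf y) (fOf y) μ ν κ l)
      {y | IsGood U L y} :=
  (contDiffOn_tensorN H.maxwell.isOpen H.regular μ ν κ l).mono fun _ hy => IsGood.regular hy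

/-- The equations have to be solved for the highest time derivatives as identities of germs, not
only at `t = 0`, since the results are differentiated further. -/
lemma eventually_isGood (S : Launch χ U L γ N δ) (x : Space) :
    ∀ᶠ p in 𝓝[half] ((0, x) : Spacetime), IsGood U L (S.val p) := by
  have h : Tendsto S.val (𝓝[half] (0, x)) (𝓝 (S.val (0, x))) := by
    refine tendsto_pi_nhds.2 fun b => ?_
    rcases b with b | b
    · have h1 : (fun p => S.val p (Sum.inl b)) = fun p => mink b.1 b.2 + S.dev b.1 b.2 p :=
        funext fun p => S.metric_eq p b.1 b.2
      have h2 : ContinuousWithinAt (fun p => S.val p (Sum.inl b)) half (0, x) := by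
        rw [h1]
        exact ((Smooth.const _).add ((H.smooth_dev S b.1 b.2)) x).continuousWithinAt
      exact h2
    · exact (S.smooth_F b.1 b.2 x).continuousWithinAt
  exact h.eventually (H.isOpen_good.mem_nhds (H.isGood_val S x))

section LevelConsequences

variable (hj : Level χ U L γ N δ j)
include hj

lemma ctl_val_of_level (b : FieldIdx) :
    Ctl Launch.size N (N + 1) (N - 2) j (-1) 1
      fun (S : Launch χ U L γ N δ) p => S.val p b - vacuum b := by
  have hγ := H.γ_pos
  refine H.ctl_val (fun α β => H.ctl_h1 (fun k α β => hj.dh1 k.succ α β)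
    (fun _ α β => (hj.dh1 0 α β).mono_time (Nat.sub_le j 1)) α β)
    (fun α β => (hj.F α β).anti H.size_mem (by linarith) (by norm_num)) b

lemma mid_near {Φ : FieldVal → ℝ} (hΦ : ContDiffOn ℝ (N : WithTop ℕ∞) Φ {y | IsGood U L y}) :
    Mid j (-1) 1 fun (S : Launch χ U L γ N δ) p => Φ (S.val p) - Φ vacuum :=
  H.near_good (fun b => H.mid_of_ctl (H.ctl_val_of_level hj b)) (fun S => (H.small S).val_mem)
    (by have := H.N_ge; omega) (Or.inr (by omega)) hΦ

lemma mid_coeff {Φ : FieldVal → ℝ} (hΦ : ContDiffOn ℝ (N : WithTop ℕ∞) Φ {y | IsGood U L y})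
    (hu : Mid j w e u) (hw : w + 1 ≤ e) : Mid j w e fun S p => Φ (S.val p) * u S p :=
  (H.mid_near hj hΦ).near_mul H.size_mem hu (by have := H.N_ge; omega) hw

lemma mid_mul_coeff {Φ : FieldVal → ℝ} (hΦ : ContDiffOn ℝ (N : WithTop ℕ∞) Φ {y | IsGood U L y})
    (hu : Mid j w e u) (hw : w + 1 ≤ e) : Mid j w e fun S p => u S p * Φ (S.val p) :=
  (H.mid_coeff hj hΦ hu hw).congr fun _ => GermEq.of_eq fun _ => mul_comm _ _

/-- The gradient of the tail is of size `M/r²`, which is in weighted `L²` only for weights below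
`1/2`; hence the weight `0` in place of `1/2 + γ`. -/
lemma mid_D_dev (μ α β : Fin 4) :
    Mid j 0 2 fun S : Launch χ U L γ N δ => D μ (S.dev α β) := by
  have hγ := H.γ_pos
  have hN := H.N_ge
  exact (Ctl.add H.size_mem (H.ctl_D_tail μ α β (by omega) (by omega))
    ((H.mid_of_ctl (hj.dh1 μ α β)).anti H.size_mem (by linarith) le_rfl)).congr
    fun S => (H.D_dev S μ α β).symm

lemma mid_F (α β : Fin 4) : Mid j (1 / 2 + γ) 2 fun S : Launch χ U L γ N δ => S.F α β :=
  H.mid_of_ctl (hj.F α β)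

lemma mid_D_D_h1 (μ ν α β : Fin 4) (h : ¬(μ = 0 ∧ ν = 0)) :
    Mid j (1 / 2 + γ + 1) 3 fun S : Launch χ U L γ N δ => D μ (D ν (S.h1 α β)) := by
  have hN := H.N_ge
  have key : ∀ (k : Fin 3) ν, Mid j (1 / 2 + γ + 1) 3
      fun S : Launch χ U L γ N δ => EinsteinNLEM.D k.succ (EinsteinNLEM.D ν (S.h1 α β)) :=
    fun k ν => by
      have := H.mid_D_succ (hj.dh1 ν α β) k
      norm_num at this ⊢
      exact this
  revert h
  refine Fin.cases ?_ (fun k _ => key k ν) μ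
  refine Fin.cases (fun h => absurd ⟨rfl, rfl⟩ h) (fun k _ => ?_) ν
  exact (key k 0).congr fun S => D_comm ((S.smooth_h1 α β).mono (by omega)) k.succ 0

lemma mid_D_succ_F (k : Fin 3) (α β : Fin 4) :
    Mid j (1 / 2 + γ + 1) 3 fun S : Launch χ U L γ N δ => D k.succ (S.F α β) := by
  have := H.mid_D_succ (hj.F α β) k
  norm_num at this ⊢
  exact this

omit hj in
lemma D_D_tail_eq_zero (S : Launch χ U L γ N δ) (μ ν α β : Fin 4) (h : μ = 0 ∨ ν = 0) :
    GermEq (EinsteinNLEM.D μ (EinsteinNLEM.D ν (S.tail α β))) fun _ => 0 := by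
  have key : ∀ μ, GermEq (EinsteinNLEM.D μ (EinsteinNLEM.D 0 (S.tail α β))) fun _ => 0 := fun μ =>
    ((H.D_zero_tail S α β).D μ).trans (D_const 0 μ)
  rcases h with rfl | rfl
  · exact (D_comm (H.smooth_tail S α β 2) 0 ν).trans (key ν)
  · exact key μ

omit hj in
lemma mid_D_D_tail (μ ν α β : Fin 4) :
    Mid j 1 3 fun S : Launch χ U L γ N δ => D μ (D ν (S.tail α β)) := by
  have hN := H.N_ge
  have := (H.ctl_D_tail ν α β (r := N - 1 + 1) (n := N + 1) (m := N - 3 + 1) (j := j + 1) (by omega)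
    (by omega)).D μ
  norm_num at this
  exact this

omit hj in
lemma mid_laplacian_tail (α β : Fin 4) :
    Mid j (1 / 2 + γ + 1) 3
      fun (S : Launch χ U L γ N δ) p => ∑ k : Fin 3, D k.succ (D k.succ (S.tail α β)) p := by
  have hN := H.N_ge
  have hγ := H.γ_lt
  have hs := contDiff_newton H.cutoff
  -- The Laplacian has compact support, so the decay exponent `10` is arbitrary; any exponent that
  -- is at least `3` and exceeds `3 + γ` would do.
  have h1 : Mid j (1 / 2 + γ + 1) 10 fun (S : Launch χ U L γ N δ) => lift fun x =>
      (if α = β then 2 * S.d.M else 0) * ∑ k, sd k (sd k (newton χ)) x := by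
    refine IsSymbol.ctl (A := 2) (fun S => S.size_nonneg) (by norm_num) (fun S => ?_)
      (isSymbol_laplacian_newton H.cutoff (by norm_num)) (by linarith) (by omega) (by omega)
    have h1 := S.M_nonneg
    have h2 := S.M_le
    have h3 := S.size_nonneg
    split_ifs
    · rw [abs_of_nonneg (by linarith)]; linarith
    · simpa using h3
  refine (h1.anti H.size_mem le_rfl (by norm_num)).congr fun S x => ?_
  have h2 : ∀ k : Fin 3, GermEq (EinsteinNLEM.D k.succ (EinsteinNLEM.D k.succ (S.tail α β)))
      (lift fun x => (if α = β then 2 * S.d.M else 0) * sd k (sd k (newton χ)) x) := by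
    intro k
    have e1 : ∀ c : ℝ, ∀ f : Space → ℝ, ContDiff ℝ 1 f → sd k (fun x => c * f x)
        = fun x => c * sd k f x := fun c f hf => by
      ext x
      have := (hf.differentiable (by simp)) x
      simp [sd, fderiv_const_mul this]
    have e2 := ((germEq_schwarzschildTail H.cutoff S.d.M α β).D k.succ).trans
      (D_succ_lift (contDiff_const.mul (hs 1)) k)
    rw [e1 _ _ (hs 1)] at e2
    have hc : ContDiff ℝ 1 (sd k (newton χ)) := contDiff_sd (hs 2) k
    have e3 := (e2.D k.succ).trans (D_succ_lift (contDiff_const.mul hc) k)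
    rw [e1 _ _ hc] at e3
    exact e3
  filter_upwards [eventually_all.2 fun k => h2 k x] with p hp
  simp only [hp, lift, Finset.mul_sum]

/-- The tail is static, so only spatial second derivatives occur. Splitting `g⁻¹` into `m⁻¹` and a
deviation leaves the Laplacian, which has compact support, and products of size `r^{-1} · M r^{-3}`.
Their weight `2` exceeds `3/2 + γ` because `γ < 1/2`. -/
lemma mid_box_tail (α β : Fin 4) :
    Mid j (1 / 2 + γ + 1) 3 fun (S : Launch χ U L γ N δ) p =>
      ∑ κ, ∑ l, (gOf (S.val p))⁻¹ κ l * D κ (D l (S.tail α β)) p := by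
  have hγ := H.γ_lt
  have h1 : Mid j (1 / 2 + γ + 1) 3 fun (S : Launch χ U L γ N δ) p =>
      (∑ κ : Fin 3, ∑ l : Fin 3, ((gOf (S.val p))⁻¹ κ.succ l.succ
        - (gOf vacuum)⁻¹ κ.succ l.succ) * EinsteinNLEM.D κ.succ (EinsteinNLEM.D l.succ (S.tail α β)) p)
      + ∑ k : Fin 3, EinsteinNLEM.D k.succ (EinsteinNLEM.D k.succ (S.tail α β)) p :=
    Ctl.add H.size_mem (H.mid_sum fun κ _ => H.mid_sum fun l _ =>
      H.mid_mul (H.mid_near hj (contDiffOn_gInv_good κ.succ l.succ)) (H.mid_D_D_tail _ _ α β)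
        (by linarith) (by linarith) (by linarith)) (H.mid_laplacian_tail α β)
  refine h1.congr fun S x => ?_
  have h2 : ∀ᶠ p in 𝓝[half] ((0, x) : Spacetime), ∀ μ ν, μ = 0 ∨ ν = 0 →
      EinsteinNLEM.D μ (EinsteinNLEM.D ν (S.tail α β)) p = 0 :=
    eventually_all.2 fun μ => eventually_all.2 fun ν => by
      by_cases h : μ = 0 ∨ ν = 0
      · filter_upwards [H.D_D_tail_eq_zero S μ ν α β h x] with p hp _ using hp
      · exact Eventually.of_forall fun p h' => absurd h' h
  filter_upwards [h2] with p hp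
  simp only [Fin.sum_univ_succ (n := 3), hp 0 _ (Or.inl rfl), hp _ 0 (Or.inr rfl), mul_zero,
    Finset.sum_const_zero, zero_add, gOf_vacuum, mink_inv, mink_succ_succ, sub_mul,
    Finset.sum_sub_distrib, ite_mul, one_mul, zero_mul, Finset.sum_ite_eq, Finset.mem_univ, if_true]
  simp

/-- A product of two gradients gains the decay `r^{-2}` of the factor that carries fewer
derivatives, hence the weight `0 + 2`. At the initial time no null structure is needed. -/
lemma mid_quadP (μ ν : Fin 4) :
    Mid j 2 4 fun (S : Launch χ U L γ N δ) p =>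
      quadP (gOf (S.val p))⁻¹ (fun l α β => D l (S.dev α β) p) μ ν := by
  have hd := H.mid_D_dev hj
  have htr : ∀ μ, Mid j 0 2 fun (S : Launch χ U L γ N δ) p =>
      ∑ κ, ∑ l, (gOf (S.val p))⁻¹ κ l * EinsteinNLEM.D μ (S.dev κ l) p := fun μ =>
    H.mid_sum fun κ _ => H.mid_sum fun l _ =>
      H.mid_coeff hj (contDiffOn_gInv_good κ l) (hd μ κ l) (by norm_num)
  refine Ctl.sub H.size_mem (H.mid_mul ((htr μ).const_mul H.size_mem (1 / 4)) (htr ν) (by norm_num)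
    (by norm_num) (by norm_num)) (Ctl.const_mul H.size_mem (1 / 2) (H.mid_sum fun κ _ =>
      H.mid_sum fun κ' _ => H.mid_sum fun l _ => H.mid_sum fun l' _ =>
      H.mid_mul (H.mid_coeff hj ((contDiffOn_gInv_good κ κ').mul (contDiffOn_gInv_good l l'))
        (hd μ κ l) (by norm_num)) (hd ν κ' l') (by norm_num) (by norm_num) (by norm_num)))

lemma mid_quadQ (μ ν : Fin 4) :
    Mid j 2 4 fun (S : Launch χ U L γ N δ) p =>
      quadQ (gOf (S.val p))⁻¹ (fun l α β => D l (S.dev α β) p) μ ν := by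
  have hd := H.mid_D_dev hj
  have hdd : ∀ a b c a' b' c', Mid j 2 4 fun (S : Launch χ U L γ N δ) p =>
      EinsteinNLEM.D a (S.dev b c) p * EinsteinNLEM.D a' (S.dev b' c') p := fun a b c a' b' c' =>
    H.mid_mul (hd a b c) (hd a' b' c') (by norm_num) (by norm_num) (by norm_num)
  have hn : ∀ a a' b c b' c', Mid j 2 4 fun (S : Launch χ U L γ N δ) p =>
      nullForm a a' (fun i => EinsteinNLEM.D i (S.dev b c) p)
        (fun i => EinsteinNLEM.D i (S.dev b' c') p) := fun a a' b c b' c' =>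
    Ctl.sub H.size_mem (hdd _ _ _ _ _ _) (hdd _ _ _ _ _ _)
  have hn0 : ∀ b c b' c', Mid j 2 4 fun (S : Launch χ U L γ N δ) p =>
      nullForm0 (gOf (S.val p))⁻¹ (fun i => EinsteinNLEM.D i (S.dev b c) p)
        (fun i => EinsteinNLEM.D i (S.dev b' c') p) := fun b c b' c' =>
    H.mid_sum fun κ _ => H.mid_sum fun l _ => H.mid_mul
      (H.mid_coeff hj (contDiffOn_gInv_good κ l) (hd κ b c) (by norm_num)) (hd l b' c')
      (by norm_num) (by norm_num) (by norm_num)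
  refine Ctl.add H.size_mem (H.mid_sum fun l _ => H.mid_sum fun l' _ =>
      H.mid_coeff hj (contDiffOn_gInv_good l l') (hn0 l μ l' ν) (by norm_num))
    (H.mid_sum fun κ _ => H.mid_sum fun κ' _ => H.mid_sum fun l _ => H.mid_sum fun l' _ =>
      H.mid_coeff hj ((contDiffOn_gInv_good κ κ').mul (contDiffOn_gInv_good l l')) ?_
        (by norm_num))
  exact Ctl.add H.size_mem (Ctl.add H.size_mem (Ctl.add H.size_mem (Ctl.add H.size_mem
    ((hn _ _ _ _ _ _).neg H.size_mem) (hn _ _ _ _ _ _)) (hn _ _ _ _ _ _))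
    ((hn _ _ _ _ _ _).const_mul H.size_mem _)) ((hn _ _ _ _ _ _).const_mul H.size_mem _)

lemma mid_F_mul_F (α β α' β' : Fin 4) {Φ : FieldVal → ℝ}
    (hΦ : ContDiffOn ℝ (N : WithTop ℕ∞) Φ {y | IsGood U L y}) :
    Mid j (1 / 2 + γ + 1) 3
      fun (S : Launch χ U L γ N δ) p => Φ (S.val p) * S.F α β p * S.F α' β' p := by
  have hγ := H.γ_lt
  exact H.mid_mul (H.mid_coeff hj hΦ (H.mid_F hj α β) (by linarith)) (H.mid_F hj α' β')
    (by linarith) (by linarith) (by linarith)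

lemma mid_inv2 :
    (Mid j (1 / 2 + γ + 1) 3 fun (S : Launch χ U L γ N δ) p => (inv2 (S.val p)).1) ∧
      Mid j (1 / 2 + γ + 1) 3 fun (S : Launch χ U L γ N δ) p => (inv2 (S.val p)).2 := by
  have hγ := H.γ_lt
  have hF := H.mid_F hj
  have hmul : ∀ {u : Launch χ U L γ N δ → Spacetime → ℝ} (α β : Fin 4), Mid j (1 / 2 + γ) 2 u →
      Mid j (1 / 2 + γ + 1) 3 fun S p => S.F α β p * u S p := fun α β hu =>
    H.mid_mul (hF α β) hu (by linarith) (by linarith) (by linarith)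
  have hs : ContDiffOn ℝ (N : WithTop ℕ∞) (fun y => -(Real.sqrt |(gOf y).det|)⁻¹)
      {y | IsGood U L y} :=
    (contDiffOn_sqrt_det_inv.mono fun _ hy => (IsGood.regular hy).1).neg
  refine ⟨Ctl.const_mul H.size_mem _ (H.mid_sum fun κ _ => H.mid_sum fun l _ => hmul κ l ?_),
    Ctl.const_mul H.size_mem _ (H.mid_sum fun κ _ => H.mid_sum fun l _ => hmul κ l ?_)⟩
  · exact H.mid_sum fun a _ => H.mid_sum fun b _ => H.mid_coeff hj
      ((contDiffOn_gInv_good κ a).mul (contDiffOn_gInv_good l b)) (hF a b) (by linarith)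
  · exact Ctl.const_mul H.size_mem _ (H.mid_sum fun a _ => H.mid_sum fun b _ => H.mid_coeff hj
      (hs.mul contDiffOn_const) (hF a b) (by linarith))

/-- As a general function of `(g, F)` this would decay only like `g - m`. It is instead composed as
a function of the two invariants, which are quadratic in `F`, and `L(0,0) = 0`. -/
lemma mid_lagrangian :
    Mid j (1 / 2 + γ + 1) 3 fun (S : Launch χ U L γ N δ) p => L (inv2 (S.val p)) := by
  have hN := H.N_ge
  obtain ⟨h1, h2⟩ := H.mid_inv2 hj
  set i : (Fin 2 → ℝ) → ℝ × ℝ := fun z => (z 0, z 1) with hi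
  have hci : ∀ n : WithTop ℕ∞, ContDiff ℝ n i := fun n =>
    (contDiff_apply ℝ ℝ (0 : Fin 2)).prodMk (contDiff_apply ℝ ℝ (1 : Fin 2))
  have hnorm : ∀ z ∈ Metric.closedBall (0 : Fin 2 → ℝ) H.ball.invRadius,
      i z ∈ Metric.closedBall (0 : ℝ × ℝ) H.ball.invRadius := by
    intro z hz
    rw [mem_closedBall_zero_iff] at hz ⊢
    exact max_le ((norm_le_pi_norm z 0).trans hz) ((norm_le_pi_norm z 1).trans hz)
  have := Ctl.comp (u := fun (b : Fin 2) (S : Launch χ U L γ N δ) p =>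
      ![(inv2 (S.val p)).1, (inv2 (S.val p)).2] b) (c := 0) (V := i ⁻¹' U)
    (B := Metric.closedBall 0 H.ball.invRadius) (Φ := fun z => L (i z)) (k := N)
    (w := 1 / 2 + γ + 1) (e := 3) (r := N - 1) (n := N) (m := N - 3) (j := j) H.size_mem
    (H.maxwell.isOpen.preimage (hci 0).continuous) (isCompact_closedBall _ _)
    (convex_closedBall _ _) (fun z hz => H.ball.closedBall_subset (hnorm z hz))
    (Metric.mem_closedBall_self H.ball.invRadius_pos.le) (fun S x => ?_) (by norm_num)
    (fun b => ?_) (by omega) (by omega) (by omega) le_rfl (by omega) (by omega)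
    ((H.regular.of_le (by norm_cast; omega)).comp (hci _).contDiffOn fun z hz => hz)
  · have h0 : L (0, 0) = 0 := H.maxwell.value
    refine this.congr fun S => GermEq.of_eq fun p => ?_
    simp [hi, h0]
  · have := H.ball.inv2_mem _ ((H.small S).val_mem x)
    rw [mem_closedBall_zero_iff] at this ⊢
    refine (pi_norm_le_iff_of_nonneg H.ball.invRadius_pos.le).2 fun b => ?_
    fin_cases b
    · exact (le_max_left _ _).trans this
    · exact (le_max_right _ _).trans this
  · fin_cases b
    · simpa using h1
    · simpa using h2

lemma mid_energyMomentum (μ ν : Fin 4) :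
    Mid j (1 / 2 + γ + 1) 3 fun (S : Launch χ U L γ N δ) p =>
      energyMomentum L (gOf (S.val p)) (fOf (S.val p)) μ ν := by
  have hγ := H.γ_lt
  have hg : ContDiffOn ℝ (N : WithTop ℕ∞) (fun y => gOf y μ ν) {y | IsGood U L y} :=
    (contDiff_gOf μ ν).contDiffOn
  refine Ctl.add H.size_mem (Ctl.sub H.size_mem (H.mid_coeff hj (Φ := fun y => -2 * lagD1 L (inv2 y))
    (contDiffOn_const.mul (H.contDiffOn_lag1_val.of_le (by norm_cast; omega))) (H.mid_sum fun κ _ =>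
      H.mid_sum fun l _ => H.mid_F_mul_F hj μ κ ν l (contDiffOn_gInv_good κ l)) (by linarith))
    (H.mid_mul_coeff hj hg (H.mid_mul_coeff hj (Φ := fun y => lagD2 L (inv2 y))
      (H.contDiffOn_lag2_val.of_le (by norm_cast; omega)) (H.mid_inv2 hj).2 (by linarith))
      (by linarith))) (H.mid_coeff hj hg (H.mid_lagrangian hj) (by linarith))

lemma mid_waveSource (μ ν : Fin 4) :
    Mid j (1 / 2 + γ + 1) 3 fun (S : Launch χ U L γ N δ) p =>
      waveSource L (gOf (S.val p)) (fun l α β => D l (S.dev α β) p) (fOf (S.val p)) μ ν := by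
  have hγ := H.γ_lt
  have hT := H.mid_energyMomentum hj
  refine Ctl.sub H.size_mem ((Ctl.add H.size_mem (H.mid_quadP hj μ ν) (H.mid_quadQ hj μ ν)).anti
    H.size_mem (by linarith) (by norm_num)) (Ctl.const_mul H.size_mem 2 (Ctl.sub H.size_mem (hT μ ν)
      (H.mid_coeff hj (Φ := fun y => 1 / 2 * gOf y μ ν)
        (contDiffOn_const.mul (contDiff_gOf μ ν).contDiffOn) (H.mid_sum fun κ _ => H.mid_sum fun l _ =>
          H.mid_coeff hj (contDiffOn_gInv_good κ l) (hT κ l) (by linarith)) (by linarith))))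

end LevelConsequences

end Setting

end EinsteinNLEM

/-! ### Induction on the number of time derivatives -/

namespace EinsteinNLEM

variable {χ : ℝ → ℝ} {U : Set (ℝ × ℝ)} {L : ℝ × ℝ → ℝ} {γ δ : ℝ} {N : ℕ}

lemma D_neg (u : Spacetime → ℝ) (μ : Fin 4) (p : Spacetime) (hp : p ∈ half) :
    D μ (fun q => -u q) p = -D μ u p := by
  simp only [D, pd]
  rw [fderivWithin_fun_neg (uniqueDiffOn_half p hp)]
  rfl

namespace Setting

variable (H : Setting χ U L γ N δ) {j : ℕ}
include H

lemma eventually_metric_eq (S : Launch χ U L γ N δ) (x : Space) :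
    ∀ᶠ p in 𝓝[half] ((0, x) : Spacetime), (fun l α β =>
        pd (slab S.T) l (fun q => spacetimeMetric χ S.d.M S.h1 q α β) p)
      = fun l α β => D l (S.dev α β) p := by
  have h : ∀ᶠ p in 𝓝[half] ((0, x) : Spacetime), ∀ l α β,
      pd (slab S.T) l (fun q => spacetimeMetric χ S.d.M S.h1 q α β) p = D l (S.dev α β) p :=
    eventually_all.2 fun l => eventually_all.2 fun α => eventually_all.2 fun β =>
      (germEq_pd_slab S.T_pos l _).trans (H.D_metric S l α β) x
  filter_upwards [h] with p hp
  funext l α β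
  exact hp l α β

lemma eventually_wave (S : Launch χ U L γ N δ) (x : Space) (μ ν : Fin 4) :
    ∀ᶠ p in 𝓝[half] ((0, x) : Spacetime),
      ∑ κ, ∑ l, (gOf (S.val p))⁻¹ κ l * D κ (D l (S.h1 μ ν)) p
        = waveSource L (gOf (S.val p)) (fun l α β => D l (S.dev α β) p) (fOf (S.val p)) μ ν
          - ∑ κ, ∑ l, (gOf (S.val p))⁻¹ κ l * D κ (D l (S.tail μ ν)) p := by
  have h2 : ∀ u : Spacetime → ℝ, ∀ᶠ p in 𝓝[half] ((0, x) : Spacetime), ∀ κ l,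
      pd (slab S.T) κ (pd (slab S.T) l u) p = D κ (D l u) p := fun u =>
    eventually_all.2 fun κ => eventually_all.2 fun l => germEq_pd_pd_slab S.T_pos κ l u x
  filter_upwards [eventually_mem_slab S.T_pos x, H.eventually_metric_eq S x, h2 (S.h1 μ ν),
    h2 (S.tail μ ν)] with p hp hm h1 ht
  have := S.solution.wave p hp μ ν
  rw [hm] at this
  simp only [reducedBox, h1, ← S.gOf_val] at this
  rw [this]
  simp only [← ht]
  rfl

lemma eventually_maxwell (S : Launch χ U L γ N δ) (x : Space) (ν : Fin 4) :
    ∀ᶠ p in 𝓝[half] ((0, x) : Spacetime),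
      ∑ μ, ∑ κ, ∑ l, tensorN L (gOf (S.val p)) (fOf (S.val p)) μ ν κ l * D μ (S.F κ l) p
        = maxwellSource L (gOf (S.val p)) (fun l α β => D l (S.dev α β) p) (fOf (S.val p)) ν := by
  have h2 : ∀ᶠ p in 𝓝[half] ((0, x) : Spacetime), ∀ μ κ l,
      pd (slab S.T) μ (S.F κ l) p = D μ (S.F κ l) p :=
    eventually_all.2 fun μ => eventually_all.2 fun κ => eventually_all.2 fun l =>
      germEq_pd_slab S.T_pos μ (S.F κ l) x
  filter_upwards [eventually_mem_slab S.T_pos x, H.eventually_metric_eq S x, h2] with p hp hm h1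
  have := S.solution.maxwell p hp ν
  rw [hm] at this
  simp only [h1, ← S.gOf_val] at this
  exact this

omit H in
lemma eventually_faraday (S : Launch χ U L γ N δ) (x : Space) (l μ ν : Fin 4) :
    ∀ᶠ p in 𝓝[half] ((0, x) : Spacetime),
      D l (S.F μ ν) p + D μ (S.F ν l) p + D ν (S.F l μ) p = 0 := by
  filter_upwards [eventually_mem_slab S.T_pos x, germEq_pd_slab S.T_pos l (S.F μ ν) x,
    germEq_pd_slab S.T_pos μ (S.F ν l) x, germEq_pd_slab S.T_pos ν (S.F l μ) x] with p hp h1 h2 h3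
  rw [← h1, ← h2, ← h3]
  exact S.solution.faraday p hp l μ ν

omit H in
lemma eventually_D_F_antisymm (S : Launch χ U L γ N δ) (x : Space) :
    ∀ᶠ p in 𝓝[half] ((0, x) : Spacetime), ∀ μ κ l, D μ (S.F κ l) p = -D μ (S.F l κ) p := by
  refine eventually_all.2 fun μ => eventually_all.2 fun κ => eventually_all.2 fun l => ?_
  have h1 : GermEq (S.F κ l) fun p => -S.F l κ p := fun y => by
    filter_upwards [eventually_mem_slab S.T_pos y] with p hp
    exact S.solution.F_antisymm κ l p hp
  filter_upwards [h1.D μ x, self_mem_nhdsWithin] with p hp hp'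
  rw [hp, D_neg _ _ _ hp']

section LevelStep

variable (hj : Level χ U L γ N δ j)
include hj

/-- The wave equation is solved for the term with two time derivatives. All other second derivatives
contain a spatial one and are controlled at the present level. -/
lemma mid_D_zero_D_zero_h1 (α β : Fin 4) :
    Mid j (1 / 2 + γ + 1) 3 fun S : Launch χ U L γ N δ => D 0 (D 0 (S.h1 α β)) := by
  have hγ := H.γ_lt
  have hrest : Mid j (1 / 2 + γ + 1) 3 fun (S : Launch χ U L γ N δ) p =>
      ∑ κ, ∑ l, if κ = 0 ∧ l = 0 then 0
        else (gOf (S.val p))⁻¹ κ l * EinsteinNLEM.D κ (EinsteinNLEM.D l (S.h1 α β)) p := by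
    refine H.mid_sum fun κ _ => H.mid_sum fun l _ => ?_
    by_cases h : κ = 0 ∧ l = 0
    · simp only [h, and_self, if_true]; exact H.mid_zero
    · simp only [h, if_false]
      exact H.mid_coeff hj (contDiffOn_gInv_good κ l) (H.mid_D_D_h1 hj κ l α β h) (by linarith)
  have hinv : ContDiffOn ℝ (N : WithTop ℕ∞) (fun y => ((gOf y)⁻¹ 0 0)⁻¹) {y | IsGood U L y} :=
    (contDiffOn_gInv_good 0 0).inv fun _ hy => (IsGood.gInv hy).ne
  refine (H.mid_coeff hj hinv (Ctl.sub H.size_mem (Ctl.sub H.size_mem (H.mid_waveSource hj α β)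
    (H.mid_box_tail hj α β)) hrest) (by linarith)).congr fun S x => ?_
  filter_upwards [H.eventually_wave S x α β, H.eventually_isGood S x] with p hp hg
  rw [← hp]
  have hsplit : ∑ κ, ∑ l, (gOf (S.val p))⁻¹ κ l
        * EinsteinNLEM.D κ (EinsteinNLEM.D l (S.h1 α β)) p
      - (∑ κ, ∑ l, if κ = 0 ∧ l = 0 then 0
        else (gOf (S.val p))⁻¹ κ l * EinsteinNLEM.D κ (EinsteinNLEM.D l (S.h1 α β)) p)
      = (gOf (S.val p))⁻¹ 0 0 * EinsteinNLEM.D 0 (EinsteinNLEM.D 0 (S.h1 α β)) p := by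
    rw [← Finset.sum_sub_distrib, Finset.sum_eq_single 0]
    · rw [← Finset.sum_sub_distrib, Finset.sum_eq_single 0]
      · simp
      · intro l _ hl; simp [hl]
      · simp
    · intro κ _ hκ; simp [hκ]
    · simp
  rw [hsplit, inv_mul_cancel_left₀ hg.gInv.ne]

lemma mid_christoffel (κ μ ν : Fin 4) :
    Mid j 0 2 fun (S : Launch χ U L γ N δ) p =>
      christoffel (gOf (S.val p)) (fun l α β => D l (S.dev α β) p) κ μ ν := by
  have hd := H.mid_D_dev hj
  exact Ctl.const_mul H.size_mem _ (H.mid_sum fun l _ => H.mid_coeff hj (contDiffOn_gInv_good κ l)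
    (Ctl.sub H.size_mem (Ctl.add H.size_mem (hd _ _ _) (hd _ _ _)) (hd _ _ _)) (by norm_num))

lemma mid_maxwellSource (ν : Fin 4) :
    Mid j (1 / 2 + γ + 1) 3 fun (S : Launch χ U L γ N δ) p =>
      maxwellSource L (gOf (S.val p)) (fun l α β => D l (S.dev α β) p) (fOf (S.val p)) ν := by
  have hγ := H.γ_lt
  have hγ0 := H.γ_pos
  have hmul : ∀ {u : Launch χ U L γ N δ → Spacetime → ℝ} (α β : Fin 4), Mid j 0 2 u →
      Mid j (1 / 2 + γ + 1) 3 fun S p => u S p * S.F α β p := fun α β hu =>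
    H.mid_mul hu (H.mid_F hj α β) (by linarith) (by linarith) (by linarith)
  have hc := H.mid_christoffel hj
  refine Ctl.sub H.size_mem (H.mid_sum fun μ _ => H.mid_sum fun κ _ => H.mid_sum fun l _ =>
    H.mid_coeff hj (H.contDiffOn_tensorN_good μ ν κ l) (H.mid_sum fun a _ => Ctl.add H.size_mem
      (hmul a l (hc a μ κ)) (hmul κ a (hc a μ l))) (by linarith))
    (H.mid_sum fun κ _ => H.mid_sum fun l _ => hmul κ l (H.mid_mul_coeff hj
      (contDiffOn_gInv_good ν l) (H.mid_sum fun a _ => H.mid_sum fun b _ =>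
        H.mid_coeff hj (contDiffOn_gInv_good a b) (hc κ a b) (by norm_num)) (by norm_num)))

/-- The equation `dF = 0` expresses `∂_t F_{ab}` by spatial derivatives of `F`. -/
lemma mid_D_F_of_spatial (μ κ l : Fin 4) (h : ¬(μ = 0 ∧ (κ = 0 ∨ l = 0))) :
    Mid j (1 / 2 + γ + 1) 3 fun S : Launch χ U L γ N δ => D μ (S.F κ l) := by
  revert h
  refine Fin.cases ?_ (fun k _ => H.mid_D_succ_F hj k κ l) μ
  refine Fin.cases (fun h => absurd ⟨rfl, Or.inl rfl⟩ h) (fun a => ?_) κ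
  refine Fin.cases (fun h => absurd ⟨rfl, Or.inr rfl⟩ h) (fun b _ => ?_) l
  refine (Ctl.neg H.size_mem (Ctl.add H.size_mem (H.mid_D_succ_F hj a b.succ 0)
    (H.mid_D_succ_F hj b 0 a.succ))).congr fun S x => ?_
  filter_upwards [eventually_faraday S x 0 a.succ b.succ] with p hp
  linarith

/-- In the equations with a spatial index `ν`, everything except `∂_t F_{0k}` is moved to the right
side, and the remaining `3 × 3` system is inverted. -/
lemma mid_D_zero_F_electric (k : Fin 3) :
    Mid j (1 / 2 + γ + 1) 3 fun S : Launch χ U L γ N δ => D 0 (S.F 0 k.succ) := by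
  have hγ := H.γ_lt
  have hrest : ∀ ν : Fin 4, Mid j (1 / 2 + γ + 1) 3 fun (S : Launch χ U L γ N δ) p =>
      ∑ μ, ∑ κ, ∑ l, if μ = 0 ∧ (κ = 0 ∨ l = 0) then 0
        else tensorN L (gOf (S.val p)) (fOf (S.val p)) μ ν κ l * EinsteinNLEM.D μ (S.F κ l) p := by
    refine fun ν => H.mid_sum fun μ _ => H.mid_sum fun κ _ => H.mid_sum fun l _ => ?_
    by_cases h : μ = 0 ∧ (κ = 0 ∨ l = 0)
    · simp only [if_pos h]; exact H.mid_zero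
    · simp only [if_neg h]
      exact H.mid_coeff hj (H.contDiffOn_tensorN_good μ ν κ l) (H.mid_D_F_of_spatial hj μ κ l h)
        (by linarith)
  have hinv : ∀ i, ContDiffOn ℝ (N : WithTop ℕ∞) (fun y => (evolMatrix L y)⁻¹ k i)
      {y | IsGood U L y} := fun i =>
    contDiffOn_matrix_inv (fun a b => (contDiffOn_evolMatrix H.maxwell.isOpen H.regular a b).mono
      fun _ hy => IsGood.regular hy) (fun _ hy => (IsGood.evol hy).ne) k i
  refine (H.mid_sum (s := Finset.univ) fun i : Fin 3 => fun _ => H.mid_coeff hj (hinv i)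
    (Ctl.sub H.size_mem (H.mid_maxwellSource hj i.succ) (hrest i.succ)) (by linarith)).congr
    fun S x => ?_
  filter_upwards [eventually_all.2 fun i : Fin 3 => H.eventually_maxwell S x i.succ,
    H.eventually_isGood S x, eventually_D_F_antisymm S x] with p hp hg ha
  have hsplit : ∀ i : Fin 3,
      (∑ μ, ∑ κ, ∑ l, tensorN L (gOf (S.val p)) (fOf (S.val p)) μ i.succ κ l
          * EinsteinNLEM.D μ (S.F κ l) p)
        - (∑ μ, ∑ κ, ∑ l, if μ = 0 ∧ (κ = 0 ∨ l = 0) then 0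
          else tensorN L (gOf (S.val p)) (fOf (S.val p)) μ i.succ κ l
            * EinsteinNLEM.D μ (S.F κ l) p)
        = (evolMatrix L (S.val p)).mulVec (fun k => EinsteinNLEM.D 0 (S.F 0 k.succ) p) i := by
    intro i
    -- Antisymmetry merges the coefficients of `∂_t F_{0k}` and `∂_t F_{k0}` into the difference
    -- that defines `evolMatrix`.
    have h00 : EinsteinNLEM.D 0 (S.F 0 0) p = 0 := by linarith [ha 0 0 0]
    rw [← Finset.sum_sub_distrib, Finset.sum_eq_single 0]
    · simp only [true_and]
      rw [← Finset.sum_sub_distrib]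
      simp only [Fin.sum_univ_succ (n := 3), Fin.succ_ne_zero, or_false,
        if_true, or_true, sub_zero, h00, mul_zero, zero_add, if_false, Finset.sum_const_zero]
      rw [← Finset.sum_add_distrib, Matrix.mulVec, dotProduct]
      refine Finset.sum_congr rfl fun l _ => ?_
      rw [ha 0 l.succ 0]
      simp only [evolMatrix, Matrix.of_apply]
      ring
    · intro μ _ hμ; simp [hμ]
    · simp
  simp only [← hp, hsplit]
  have hdet : IsUnit (evolMatrix L (S.val p)).det := isUnit_iff_ne_zero.2 hg.evol.ne
  have := congrFun (Matrix.mulVec_mulVec (fun k : Fin 3 => EinsteinNLEM.D 0 (S.F 0 k.succ) p)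
    (evolMatrix L (S.val p))⁻¹ (evolMatrix L (S.val p))) k
  rw [Matrix.nonsing_inv_mul _ hdet, Matrix.one_mulVec] at this
  rw [← this]
  rfl

lemma mid_D_zero_F (α β : Fin 4) :
    Mid j (1 / 2 + γ + 1) 3 fun S : Launch χ U L γ N δ => D 0 (S.F α β) := by
  refine Fin.cases ?_ (fun a => ?_) α
  · refine Fin.cases ?_ (fun b => H.mid_D_zero_F_electric hj b) β
    refine H.mid_zero.congr fun S x => ?_
    filter_upwards [eventually_D_F_antisymm S x] with p hp
    linarith [hp 0 0 0]
  · refine Fin.cases ?_ (fun b => ?_) β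
    · refine ((H.mid_D_zero_F_electric hj a).neg H.size_mem).congr fun S x => ?_
      filter_upwards [eventually_D_F_antisymm S x] with p hp
      linarith [hp 0 a.succ 0]
    · exact H.mid_D_F_of_spatial hj 0 _ _ (by simp)

lemma ctl_time_succ {u : Launch χ U L γ N δ → Spacetime → ℝ}
    (hu : Ctl Launch.size N (N + 1) (N - 2) j (1 / 2 + γ) 2 u)
    (h : Mid j (1 / 2 + γ + 1) 3 fun S => D 0 (u S)) :
    Ctl Launch.size N (N + 1) (N - 2) (j + 1) (1 / 2 + γ) 2 u := by
  have hN := H.N_ge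
  obtain ⟨K, rfl⟩ : ∃ K, N = K + 1 := ⟨N - 1, by omega⟩
  refine hu.of_time ?_
  norm_num at h ⊢
  exact h

/-- Only `∂_t h^{(1)}` and `F` need the equations; for spatial gradients a further time derivative
is obtained by commutation, from `∂_k ∂_t h^{(1)}`. -/
lemma level_succ : Level χ U L γ N δ (j + 1) where
  dh1 := by
    have hN := H.N_ge
    have h0 : ∀ α β, Ctl Launch.size N (N + 1) (N - 2) (j + 1) (1 / 2 + γ) 2
        fun S : Launch χ U L γ N δ => EinsteinNLEM.D 0 (S.h1 α β) := fun α β =>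
      H.ctl_time_succ hj (hj.dh1 0 α β) (H.mid_D_zero_D_zero_h1 hj α β)
    refine fun μ α β => Fin.cases (h0 α β) (fun k => ?_) μ
    refine H.ctl_time_succ hj (hj.dh1 k.succ α β)
      ((H.mid_D_D_h1 hj k.succ 0 α β (by simp)).congr fun S =>
        D_comm ((S.smooth_h1 α β).mono (by omega)) k.succ 0)
  F := fun α β => H.ctl_time_succ hj (hj.F α β) (H.mid_D_zero_F hj α β)

end LevelStep

lemma level (j : ℕ) : Level χ U L γ N δ j := by
  induction j with
  | zero => exact H.level_zero
  | succ j ih => exact H.level_succ ih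

end Setting

end EinsteinNLEM

namespace EinsteinNLEM

/-! ### Covariant and Lie derivatives along the fields in `𝒵` -/

section VectorFields

/-- The coordinate `x^μ` as a continuous linear form. -/
noncomputable def coordCLM (μ : Fin 4) : Spacetime →L[ℝ] ℝ :=
  Fin.cases (ContinuousLinearMap.fst ℝ ℝ Space)
    (fun j => (EuclideanSpace.proj j).comp (ContinuousLinearMap.snd ℝ ℝ Space)) μ

lemma coord_eq_coordCLM (μ : Fin 4) (p : Spacetime) : coord μ p = coordCLM μ p := by
  refine Fin.cases ?_ (fun j => ?_) μ <;> rfl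

lemma exists_zComp_eq (Z : ZLabel) (κ : Fin 4) :
    ∃ (c : ℝ) (ℓ : Spacetime →L[ℝ] ℝ), zComp Z κ = fun p => c + ℓ p := by
  rcases Z with μ | i | _
  · exact ⟨if κ = μ then 1 else 0, 0, by ext p; simp [zComp]⟩
  · refine ⟨0, (if κ = i.1.2 then (1 : ℝ) else 0) • (∑ l, mink i.1.1 l • coordCLM l)
      - (if κ = i.1.1 then (1 : ℝ) else 0) • (∑ l, mink i.1.2 l • coordCLM l), ?_⟩
    ext p
    simp only [zComp, coordLow, coord_eq_coordCLM, zero_add, sub_apply,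
      smul_apply, sum_apply, smul_eq_mul]
    ring
  · exact ⟨0, coordCLM κ, by ext p; simp [zComp, coord_eq_coordCLM]⟩

lemma smooth_zComp (n : ℕ) (Z : ZLabel) (κ : Fin 4) : Smooth n (zComp Z κ) := by
  obtain ⟨c, ℓ, h⟩ := exists_zComp_eq Z κ
  rw [h]
  exact fun x => (contDiff_const.add ℓ.contDiff).contDiffAt.contDiffWithinAt

lemma exists_germEq_D_zComp (μ : Fin 4) (Z : ZLabel) (κ : Fin 4) :
    ∃ a : ℝ, GermEq (D μ (zComp Z κ)) fun _ => a := by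
  obtain ⟨c, ℓ, h⟩ := exists_zComp_eq Z κ
  rw [h]
  refine ⟨ℓ (coordVec μ), fun x => ?_⟩
  filter_upwards [self_mem_nhdsWithin] with p hp
  rw [D, pd, fderivWithin_const_add, ℓ.fderivWithin (uniqueDiffOn_half p hp)]

variable {ι : Type*} {n j : ℕ} {θ : ι → ℝ} {w : ℝ}

lemma Jet.ptBd_const (c : ℝ) : Jet (PtBd fun _ : ι => 1) n j 0 fun _ _ => c := by
  rcases n with _ | n
  · trivial
  have h0 : ∀ μ, Jet (PtBd fun _ : ι => 1) n (if μ = 0 then j - 1 else j) (0 + 1)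
      fun _ => D μ fun _ => c := fun μ =>
    Jet.congr (fun _ => (D_const c μ).symm) (Jet.zero (boundScale_ptBd fun _ => zero_le_one))
  exact ⟨⟨|c|, abs_nonneg c, fun _ x => by simp⟩, fun k => by simpa using h0 k.succ,
    fun _ => by simpa using h0 0⟩

lemma jet_D_zComp (μ : Fin 4) (Z : ZLabel) (κ : Fin 4) :
    Jet (PtBd fun _ : ι => 1) n j 0 fun _ => D μ (zComp Z κ) := by
  obtain ⟨a, ha⟩ := exists_germEq_D_zComp μ Z κ
  exact Jet.congr (fun _ => ha.symm) (Jet.ptBd_const a)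

/-- The components are affine in the coordinates: they grow at most like `r`, their first
derivatives are constant and the higher ones vanish. This is the exponent pattern `-1, 0, 1, …` of a
jet. -/
lemma jet_zComp (Z : ZLabel) (κ : Fin 4) :
    Jet (PtBd fun _ : ι => 1) n j (-1) fun _ => zComp Z κ := by
  rcases n with _ | n
  · trivial
  refine ⟨?_, fun k => ?_, fun _ => ?_⟩
  · obtain ⟨c, ℓ, h⟩ := exists_zComp_eq Z κ
    refine ⟨|c| + ‖ℓ‖, by positivity, fun _ x => ?_⟩
    have h1 : |ℓ (0, x)| ≤ ‖ℓ‖ * ‖x‖ := by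
      simpa [Prod.norm_def] using ℓ.le_opNorm (0, x)
    simp only [h, neg_neg, Real.rpow_one, mul_one]
    calc |c + ℓ (0, x)| ≤ |c| + |ℓ (0, x)| := abs_add_le _ _
      _ ≤ |c| * jp x + ‖ℓ‖ * jp x := by
        gcongr
        · exact le_mul_of_one_le_right (abs_nonneg c) (one_le_jp x)
        · exact h1.trans (mul_le_mul_of_nonneg_left (norm_le_jp x) (norm_nonneg ℓ))
      _ = _ := by ring
  · simpa using jet_D_zComp (ι := ι) (n := n) (j := j) k.succ Z κ
  · simpa using jet_D_zComp (ι := ι) (n := n) (j := j - 1) 0 Z κ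

lemma Jet.D {u : ι → Spacetime → ℝ} {P : ℝ → (ι → Space → ℝ) → Prop} {e : ℝ}
    (hu : Jet P (n + 1) (j + 1) e u) (μ : Fin 4) : Jet P n j (e + 1) fun i => D μ (u i) :=
  Fin.cases (hu.tail_time (Nat.le_add_left 1 j))
    (fun k => (hu.tail k).mono_time (Nat.le_succ j)) μ

/-- The components of a tensorfield are smooth and their gradients are controlled in `L²`. -/
def GradientJet (θ : ι → ℝ) (w : ℝ) (n j : ℕ) (u : ι → Fin 4 → Fin 4 → Spacetime → ℝ) : Prop :=
  ∀ α β, (∀ i, Smooth n (u i α β)) ∧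
    ∀ μ, Jet (L2Bd θ) n j w fun i => EinsteinNLEM.D μ (u i α β)

/-- The components of a tensorfield are smooth and controlled in `L²`. -/
def TensorJet (θ : ι → ℝ) (w : ℝ) (n j : ℕ) (u : ι → Fin 4 → Fin 4 → Spacetime → ℝ) : Prop :=
  ∀ α β, (∀ i, Smooth n (u i α β)) ∧ Jet (L2Bd θ) (n + 1) j w fun i => u i α β

/-- In `∂(Z^κ ∂_κ u) = ∂Z^κ ∂_κ u + Z^κ ∂∂_κ u` the growth of `Z` in the second term is offset by
the power gained from the additional derivative. The weight is kept, at the price of one order. -/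
lemma GradientJet.covZ {u : ι → Fin 4 → Fin 4 → Spacetime → ℝ}
    (hu : GradientJet θ w (n + 1) (j + 1) u) (Z : ZLabel) :
    GradientJet θ w n j fun i => covZ half Z (u i) := by
  intro α β
  obtain ⟨hs, hj⟩ := hu α β
  have hsm : ∀ κ i, Smooth n fun p => zComp Z κ p * EinsteinNLEM.D κ (u i α β) p := fun κ i =>
    (smooth_zComp n Z κ).mul ((hs i).D κ)
  refine ⟨fun i => Smooth.sum fun κ _ => hsm κ i, fun μ => ?_⟩
  rcases n with _ | n
  · trivial
  have hP := boundScale_l2Bd θ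
  have h1 : ∀ κ, Jet (L2Bd θ) (n + 1) j w fun i p =>
      EinsteinNLEM.D μ (zComp Z κ) p * EinsteinNLEM.D κ (u i α β) p
        + zComp Z κ p * EinsteinNLEM.D μ (EinsteinNLEM.D κ (u i α β)) p := by
    intro κ
    have hs1 : ∀ i, Smooth n (EinsteinNLEM.D κ (u i α β)) := fun i =>
      ((hs i).D κ).mono (Nat.le_succ n)
    have hs2 : ∀ i, Smooth n (EinsteinNLEM.D μ (EinsteinNLEM.D κ (u i α β))) := fun i =>
      ((hs i).D κ).D μ
    have hz := (smooth_zComp (n + 1) Z κ).D μ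
    refine Jet.add hP (fun i => hz.mul (hs1 i)) (fun i => (smooth_zComp n Z κ).mul (hs2 i)) ?_ ?_
    · have := Jet.pt_mul_l2 (n := n + 1) (fun _ => hz) hs1 (jet_D_zComp μ Z κ)
        (((hj κ).mono_order (Nat.le_succ (n + 1))).mono_time (Nat.le_succ j))
      simpa using this
    · have := Jet.pt_mul_l2 (n := n + 1) (fun _ => smooth_zComp n Z κ) hs2 (jet_zComp Z κ) ((hj κ).D μ)
      simpa using this
  refine Jet.congr (fun i => ?_) (Jet.sum hP (s := Finset.univ) (fun κ _ i => ?_) fun κ _ => h1 κ)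
  · refine GermEq.symm fun x => ?_
    have h2 : ∀ᶠ p in 𝓝[half] ((0, x) : Spacetime), ∀ κ,
        EinsteinNLEM.D μ (fun p => zComp Z κ p * EinsteinNLEM.D κ (u i α β) p) p = _ :=
      eventually_all.2 fun κ => D_mul (smooth_zComp 1 Z κ)
        (((hs i).D κ).mono (by omega)) μ x
    filter_upwards [D_sum (s := Finset.univ) (fun κ _ => (hsm κ i).mono (m := 1) (by omega)) μ x, h2]
      with p hp hp'
    refine hp.trans (Finset.sum_congr rfl fun κ _ => hp' κ)
  · exact (((smooth_zComp (n + 1) Z κ).D μ).mul (((hs i).D κ).mono (Nat.le_succ n))).add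
      ((smooth_zComp n Z κ).mul (((hs i).D κ).D μ))

/-- The same balance holds for `Z^κ ∂_κ u`; the additional terms of the Lie derivative are `u` times
constants. -/
lemma TensorJet.lieZ {u : ι → Fin 4 → Fin 4 → Spacetime → ℝ}
    (hu : TensorJet θ w (n + 1) (j + 1) u) (Z : ZLabel) :
    TensorJet θ w n j fun i => lieZ half Z (u i) := by
  intro α β
  have hP := boundScale_l2Bd θ
  have hz := fun μ κ => (smooth_zComp (n + 1) Z κ).D μ
  have hs0 : ∀ α β i, Smooth n (u i α β) := fun α β i => ((hu α β).1 i).mono (Nat.le_succ n)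
  have hs1 : ∀ κ i, Smooth n fun p => zComp Z κ p * EinsteinNLEM.D κ (u i α β) p := fun κ i =>
    (smooth_zComp n Z κ).mul (((hu α β).1 i).D κ)
  have hs2 : ∀ κ i, Smooth n fun p => u i κ β p * EinsteinNLEM.D α (zComp Z κ) p := fun κ i =>
    (hs0 κ β i).mul (hz α κ)
  have hs3 : ∀ κ i, Smooth n fun p => u i α κ p * EinsteinNLEM.D β (zComp Z κ) p := fun κ i =>
    (hs0 α κ i).mul (hz β κ)
  have hc : ∀ α β κ ν, Jet (L2Bd θ) (n + 1) j w fun i p =>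
      u i α β p * EinsteinNLEM.D ν (zComp Z κ) p := fun α β κ ν => by
    have := Jet.pt_mul_l2 (n := n + 1) (fun _ => hz ν κ) (hs0 α β) (jet_D_zComp ν Z κ)
      (((hu α β).2.mono_order (Nat.le_succ (n + 1))).mono_time (Nat.le_succ j))
    simpa [mul_comm] using this
  refine ⟨fun i => Smooth.sum fun κ _ => ((hs1 κ i).add (hs2 κ i)).add (hs3 κ i),
    Jet.sum hP (fun κ _ i => ((hs1 κ i).add (hs2 κ i)).add (hs3 κ i)) fun κ _ =>
      Jet.add hP (fun i => (hs1 κ i).add (hs2 κ i)) (hs3 κ)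
        (Jet.add hP (hs1 κ) (hs2 κ) ?_ (hc κ β κ α)) (hc α κ κ β)⟩
  have := Jet.pt_mul_l2 (n := n + 1) (fun _ => smooth_zComp n Z κ) (fun i => ((hu α β).1 i).D κ)
    (jet_zComp Z κ) ((hu α β).2.D κ)
  simpa using this

lemma GradientJet.foldr_covZ {u : ι → Fin 4 → Fin 4 → Spacetime → ℝ} (I : List ZLabel)
    (hu : GradientJet θ w (n + I.length) (j + I.length) u) :
    GradientJet θ w n j fun i => I.foldr (EinsteinNLEM.covZ half) (u i) := by
  induction I generalizing n j with
  | nil => exact hu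
  | cons Z I ih =>
    refine GradientJet.covZ (ih ?_) Z
    simpa only [List.length_cons, add_assoc, add_comm] using hu

lemma TensorJet.foldr_lieZ {u : ι → Fin 4 → Fin 4 → Spacetime → ℝ} (I : List ZLabel)
    (hu : TensorJet θ w (n + I.length) (j + I.length) u) :
    TensorJet θ w n j fun i => I.foldr (EinsteinNLEM.lieZ half) (u i) := by
  induction I generalizing n j with
  | nil => exact hu
  | cons Z I ih =>
    refine TensorJet.lieZ (ih ?_) Z
    simpa only [List.length_cons, add_assoc, add_comm] using hu

lemma GradientJet.mono {u : ι → Fin 4 → Fin 4 → Spacetime → ℝ} {n' j' : ℕ}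
    (hu : GradientJet θ w n j u) (hn : n' ≤ n) (hj : j' ≤ j) : GradientJet θ w n' j' u :=
  fun α β => ⟨fun i => ((hu α β).1 i).mono hn,
    fun μ => (((hu α β).2 μ).mono_order hn).mono_time hj⟩

lemma TensorJet.mono {u : ι → Fin 4 → Fin 4 → Spacetime → ℝ} {n' j' : ℕ}
    (hu : TensorJet θ w n j u) (hn : n' ≤ n) (hj : j' ≤ j) : TensorJet θ w n' j' u :=
  fun α β => ⟨fun i => ((hu α β).1 i).mono hn,
    ((hu α β).2.mono_order (Nat.succ_le_succ hn)).mono_time hj⟩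

end VectorFields

/-! ### The energy at the initial time -/

section Energy

/-- At `t = 0` one has `q = r ≥ 0`, so only the exterior branch of the weight occurs. The factor `5`
is `1 + 4`, from `(1 + r)^{1+2γ} ≤ (2 jp)^{1+2γ}` and `1 + 2γ ≤ 2`. -/
lemma weight_le {γ μ : ℝ} (hγ : 0 < γ) (hγ' : γ < 1 / 2) (x : Space) :
    weight γ μ ‖x‖ ≤ 5 * (jp x ^ (1 / 2 + γ)) ^ 2 := by
  have h1 : (jp x ^ (1 / 2 + γ)) ^ 2 = jp x ^ (1 + 2 * γ) := by
    rw [← Real.rpow_natCast, ← Real.rpow_mul (jp_pos x).le]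
    congr 1; push_cast; ring
  have h2 : 1 ≤ jp x ^ (1 + 2 * γ) := Real.one_le_rpow (one_le_jp x) (by linarith)
  have h3 : (2 : ℝ) ^ (1 + 2 * γ) ≤ 4 := by
    calc (2 : ℝ) ^ (1 + 2 * γ) ≤ 2 ^ (2 : ℝ) :=
          Real.rpow_le_rpow_of_exponent_le one_le_two (by linarith)
      _ = 4 := by norm_num
  have h4 : (1 + ‖x‖) ^ (1 + 2 * γ) ≤ 4 * jp x ^ (1 + 2 * γ) := by
    calc (1 + ‖x‖) ^ (1 + 2 * γ) ≤ (2 * jp x) ^ (1 + 2 * γ) :=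
          Real.rpow_le_rpow (by positivity) (one_add_le_jp x) (by linarith)
      _ = 2 ^ (1 + 2 * γ) * jp x ^ (1 + 2 * γ) :=
          Real.mul_rpow zero_le_two (jp_pos x).le
      _ ≤ _ := mul_le_mul_of_nonneg_right h3 (by linarith)
  rw [weight, if_pos (norm_nonneg x), abs_norm, h1]
  linarith

lemma exists_lintegral_sum_sq_le {ι κ : Type*} [Fintype κ] {θ : ι → ℝ} {γ μ : ℝ} (hγ : 0 < γ)
    (hγ' : γ < 1 / 2) {a : κ → ι → Space → ℝ} (h : ∀ b, L2Bd θ (1 / 2 + γ) (a b)) :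
    ∃ C : ℝ, 0 ≤ C ∧ ∀ i, ∫⁻ x, ENNReal.ofReal ((∑ b, a b i x ^ 2) * weight γ μ ‖x‖)
      ≤ ENNReal.ofReal (C * θ i ^ 2) := by
  have hP := boundScale_l2Bd θ
  obtain ⟨C, hC, c, hc⟩ := hP.sum (s := Finset.univ) fun b _ => hP.abs (h b)
  refine ⟨5 * C, by positivity, fun i => ?_⟩
  obtain ⟨-, h2, h3⟩ := hc i
  calc ∫⁻ x, ENNReal.ofReal ((∑ b, a b i x ^ 2) * weight γ μ ‖x‖)
      ≤ ∫⁻ x, ENNReal.ofReal 5 * ENNReal.ofReal ((jp x ^ (1 / 2 + γ) * c i x) ^ 2) := by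
        refine lintegral_mono fun x => ?_
        rw [← ENNReal.ofReal_mul (by norm_num)]
        refine ENNReal.ofReal_le_ofReal ?_
        have hs : ∑ b, a b i x ^ 2 ≤ c i x ^ 2 := by
          calc ∑ b, a b i x ^ 2 = ∑ b, |a b i x| ^ 2 := by simp only [sq_abs]
            _ ≤ (∑ b, |a b i x|) ^ 2 :=
              Finset.sum_sq_le_sq_sum_of_nonneg fun b _ => abs_nonneg _
            _ ≤ c i x ^ 2 := pow_le_pow_left₀ (Finset.sum_nonneg fun _ _ => abs_nonneg _)
              ((le_abs_self _).trans (h2 x)) 2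
        calc (∑ b, a b i x ^ 2) * weight γ μ ‖x‖
            ≤ c i x ^ 2 * (5 * (jp x ^ (1 / 2 + γ)) ^ 2) :=
              mul_le_mul_of_nonneg hs (weight_le hγ hγ' x)
                (Finset.sum_nonneg fun _ _ => sq_nonneg _) (by positivity)
          _ = _ := by ring
    _ = ENNReal.ofReal 5 * ∫⁻ x, ENNReal.ofReal ((jp x ^ (1 / 2 + γ) * c i x) ^ 2) :=
        lintegral_const_mul' _ _ (by simp)
    _ ≤ ENNReal.ofReal 5 * ENNReal.ofReal (C * θ i ^ 2) := by gcongr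
    _ = _ := by rw [← ENNReal.ofReal_mul (by norm_num)]; congr 1; ring

variable {χ : ℝ → ℝ} {U : Set (ℝ × ℝ)} {L : ℝ × ℝ → ℝ} {γ δ : ℝ} {N : ℕ}

lemma Setting.exists_lintegral_le (H : Setting χ U L γ N δ) (μ : ℝ) {k : ℕ} (hk : k ≤ N)
    (I : Fin k → ZLabel) :
    ∃ C : ℝ, 0 ≤ C ∧ ∀ S : Launch χ U L γ N δ,
      ∫⁻ x : Space, ENNReal.ofReal
        (((∑ l, ∑ α, ∑ β, (pd (slab S.T) l (covZIter (slab S.T) I S.h1 α β) (0, x)) ^ 2)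
          + ∑ α, ∑ β, (lieZIter (slab S.T) I S.F α β (0, x)) ^ 2) * weight γ μ (‖x‖ - 0))
        ≤ ENNReal.ofReal (C * S.size ^ 2) := by
  have hN := H.level N
  have hl : (List.ofFn I).length = k := List.length_ofFn
  -- After `k` fields one order has to remain, as a jet of order `1` is the bound on the value
  -- itself; `1 + k ≤ N + 1` is the available order. For `F` this extra order is built into
  -- `TensorJet`.
  have hh : GradientJet Launch.size (1 / 2 + γ) (1 + k) (0 + k)
      fun S : Launch χ U L γ N δ => S.h1 :=
    GradientJet.mono (n := N + 1) (j := N)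
      (fun α β => ⟨fun S => S.smooth_h1 α β, fun μ => (hN.dh1 μ α β).l2⟩) (by omega) (by omega)
  have hf : TensorJet Launch.size (1 / 2 + γ) (0 + k) (0 + k)
      fun S : Launch χ U L γ N δ => S.F :=
    TensorJet.mono (n := N) (j := N)
      (fun α β => ⟨fun S => S.smooth_F α β, (hN.F α β).l2⟩) (by omega) (by omega)
  have hh' := GradientJet.foldr_covZ (n := 1) (j := 0) (List.ofFn I) (by rw [hl]; exact hh)
  have hf' := TensorJet.foldr_lieZ (n := 0) (j := 0) (List.ofFn I) (by rw [hl]; exact hf)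
  obtain ⟨C, hC, h⟩ := exists_lintegral_sum_sq_le (μ := μ) H.γ_pos H.γ_lt
    (κ := (Fin 4 × Fin 4 × Fin 4) ⊕ (Fin 4 × Fin 4)) (θ := Launch.size)
    (a := Sum.elim
      (fun i (S : Launch χ U L γ N δ) x =>
        D i.1 ((List.ofFn I).foldr (covZ half) S.h1 i.2.1 i.2.2) (0, x))
      fun i S x => (List.ofFn I).foldr (lieZ half) S.F i.1 i.2 (0, x))
    (by
      rintro (i | i)
      · exact ((hh' i.2.1 i.2.2).2 i.1).1
      · exact (hf' i.1 i.2).2.1)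
  refine ⟨C, hC, fun S => le_of_eq_of_le (lintegral_congr fun x => ?_) (h S)⟩
  have e1 : ∀ l α β, pd (slab S.T) l (covZIter (slab S.T) I S.h1 α β) (0, x)
      = D l ((List.ofFn I).foldr (covZ half) S.h1 α β) (0, x) := fun l α β =>
    ((germEq_pd_slab S.T_pos l _).trans ((germEq_covZIter S.T_pos _ _ α β).D l)).eq x
  have e2 : ∀ α β, lieZIter (slab S.T) I S.F α β (0, x)
      = (List.ofFn I).foldr (lieZ half) S.F α β (0, x) := fun α β =>
    (germEq_lieZIter S.T_pos _ _ α β).eq x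
  simp only [e1, e2, sub_zero, Fintype.sum_sum_type, Fintype.sum_prod_type, Sum.elim_inl,
    Sum.elim_inr]

lemma Setting.exists_energy_le (H : Setting χ U L γ N δ) (μ : ℝ) :
    ∃ C : ℝ, 0 < C ∧ ∀ S : Launch χ U L γ N δ,
      energy (slab S.T) N γ μ S.h1 S.F 0 ≤ ENNReal.ofReal (C * S.size) := by
  have h : ∀ k (I : Fin k → ZLabel), ∃ C : ℝ, 0 ≤ C ∧ (k ≤ N → ∀ S : Launch χ U L γ N δ,
      ∫⁻ x : Space, ENNReal.ofReal
        (((∑ l, ∑ α, ∑ β, (pd (slab S.T) l (covZIter (slab S.T) I S.h1 α β) (0, x)) ^ 2)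
          + ∑ α, ∑ β, (lieZIter (slab S.T) I S.F α β (0, x)) ^ 2) * weight γ μ (‖x‖ - 0))
        ≤ ENNReal.ofReal (C * S.size ^ 2)) := fun k I => by
    by_cases hk : k ≤ N
    · obtain ⟨C, hC, h⟩ := H.exists_lintegral_le μ hk I
      exact ⟨C, hC, fun _ => h⟩
    · exact ⟨0, le_rfl, fun h => absurd h hk⟩
  choose C hC h using h
  set B := ∑ k ∈ Finset.range (N + 1), ∑ I, C k I with hB
  have hB0 : 0 ≤ B := Finset.sum_nonneg fun k _ => Finset.sum_nonneg fun I _ => hC k I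
  -- The summand `1` makes the constant positive even if `B = 0`.
  refine ⟨Real.sqrt B + 1, by positivity, fun S => ?_⟩
  have hsq : energySq (slab S.T) N γ μ S.h1 S.F 0 ≤ ENNReal.ofReal (B * S.size ^ 2) := by
    refine iSup₂_le fun τ hτ => ?_
    obtain rfl : τ = 0 := le_antisymm hτ.2 hτ.1
    rw [hB, Finset.sum_mul, ENNReal.ofReal_sum_of_nonneg fun k _ =>
      mul_nonneg (Finset.sum_nonneg fun I _ => hC k I) (sq_nonneg _)]
    refine Finset.sum_le_sum fun k hk => ?_
    rw [Finset.sum_mul, ENNReal.ofReal_sum_of_nonneg fun I _ => mul_nonneg (hC k I) (sq_nonneg _)]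
    exact Finset.sum_le_sum fun I _ => h k I (Nat.lt_succ_iff.1 (Finset.mem_range.1 hk)) S
  have hs := S.size_nonneg
  calc energy (slab S.T) N γ μ S.h1 S.F 0
      ≤ ENNReal.ofReal (B * S.size ^ 2) ^ (1 / 2 : ℝ) :=
        ENNReal.rpow_le_rpow hsq (by norm_num)
    _ = ENNReal.ofReal (Real.sqrt B * S.size) := by
        rw [ENNReal.ofReal_rpow_of_nonneg (by positivity) (by norm_num), ← Real.sqrt_eq_rpow,
          Real.sqrt_mul hB0, Real.sqrt_sq hs]
    _ ≤ _ := ENNReal.ofReal_le_ofReal (by nlinarith)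

end Energy

end EinsteinNLEM

/-! ### Conclusion -/

theorem propositionP
    (χ : ℝ → ℝ) (hχ : IsCutoff χ)
    (γ μ : ℝ) (hγ : 0 < γ) (hγ' : γ < 1 / 2) (hμ : 0 < μ) (hμ' : μ < 1 / 2)
    (U : Set (ℝ × ℝ)) (L : ℝ × ℝ → ℝ) (hL : IsMaxwellLike U L) :
    ∃ ε₀ : ℝ, 0 < ε₀ ∧
      ∀ N : ℕ, 8 ≤ N → ContDiffOn ℝ ((N + 2 : ℕ) : WithTop ℕ∞) L U →
        ∃ C C' : ℝ, 0 < C ∧ 0 < C' ∧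
          ∀ (κ : ℝ) (d : AbstractData) (T : ℝ) (h1 F : Fin 4 → Fin 4 → Spacetime → ℝ) (ε : ℝ),
            0 < κ → 0 ≤ d.M → 0 < T →
            d.AsymptoticallyFlat N κ →
            d.IsAdmissible χ L (fun x α β => F α β (0, x)) →
            IsReducedSolution χ U L d.M N T h1 F →
            IsLaunchedBy χ L d T h1 F →
            0 ≤ ε → ε ≤ ε₀ →
            d.norm N γ + ENNReal.ofReal d.M ≤ ENNReal.ofReal ε →
            energy (slab T) N γ μ h1 F 0 ≤ ENNReal.ofReal C * (d.norm N γ + ENNReal.ofReal d.M) ∧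
            ENNReal.ofReal C * (d.norm N γ + ENNReal.ofReal d.M) ≤ ENNReal.ofReal (C' * ε) := by
  by_cases hreg : ContDiffOn ℝ 2 L U
  -- The ball and the threshold are fixed here, before `N`, using `L ∈ C²` only.
  · obtain ⟨G⟩ := nonempty_goodBall hL hreg
    obtain ⟨δ, hδ, hδ1, hsmall⟩ := exists_isSmall hχ hγ G
    refine ⟨δ, hδ, fun N hN hLN => ?_⟩
    have H : Setting χ U L γ N δ :=
      ⟨hχ, hγ, hγ', hN, hδ1, hL, hLN, G, hsmall N (by omega)⟩
    obtain ⟨C, hC, hE⟩ := H.exists_energy_le μ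
    refine ⟨C, C, hC, hC, fun κ d T h1 F ε hκ hM hT hflat _ hsol hlaunch hε hε' hsize => ⟨?_, ?_⟩⟩
    · have hfin : d.norm N γ + ENNReal.ofReal d.M ≠ ∞ := ne_top_of_le_ne_top (by simp) hsize
      -- The size is taken to be `E + M` itself rather than `ε`, so that the bound is linear in `E +
      -- M`.
      set s := (d.norm N γ + ENNReal.ofReal d.M).toReal with hs
      have hs' : ENNReal.ofReal s = d.norm N γ + ENNReal.ofReal d.M := ENNReal.ofReal_toReal hfin
      have hs0 : 0 ≤ s := ENNReal.toReal_nonneg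
      rw [← hs', ← ENNReal.ofReal_mul hC.le]
      exact hE ⟨κ, d, T, h1, F, s, hκ, hM, hT, hflat, hsol, hlaunch, hs0,
        (ENNReal.toReal_le_of_le_ofReal hε hsize).trans hε', hs' ▸ le_self_add,
        (ENNReal.ofReal_le_ofReal_iff hs0).1 (hs' ▸ le_add_self)⟩
    · rw [ENNReal.ofReal_mul hC.le]
      gcongr
  -- If `L` is not `C²`, then it is not `C^{N+2}` for any `N`, and the assertion is empty.
  · exact ⟨1, one_pos, fun N _ hLN => absurd (hLN.of_le (by exact_mod_cast Nat.le_add_left 2 N)) hreg⟩
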